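/- **Setting.** For $T>0$ let $m_T(\xi)=\sqrt{(1+T\xi^2)\tanh(\xi)/\xi}$ for $\xi\neq0$ and $m_T(0)=1$. For $\kappa>0$ let $M_{T,\kappa}$ be the Fourier multiplier on $\mathbb T=\mathbb R/2\pi\mathbb Z$ with symbol $k\mapsto m_T(\kappa k)$. The scaled steady capillary Whitham equation is $$(M_{T,\kappa}-c)u+u^2=0 \qquad(\ast)$$ (in the sense of distributions on $\mathbb T$) for a real function $u$ on $\mathbb T$ and $c,\kappa,T>0$. For $s>0$, $\mathcal C^s(\mathbb T)$ is the Zygmund space with norm $\sup_{j\ge0}2^{js}\|u*\phi_j\|_{L^\infty}$, where $\widehat{\phi_0}=\chi$ and $\widehat{\phi_j}=\chi(2^{-j}\cdot)-\chi(2^{-(j-1)}\cdot)$ for $j\ge 1$, $\chi$ being a smooth even real function equal to $1$ on $[-1,1]$ and to $0$ outside $(-2,2)$. A function $u:\mathbb R\to\mathbb R$ is *symmetric* if $x\mapsto u(x+a)$ is even for some $a\in\mathbb R$, and *asymmetric* otherwise. Let $1\le k_1<k_2$ be coprime integers. A triple $(c_0,\kappa_0,T_0)$ of positive numbers is a *double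 bifurcation point* with wave numbers $k_1,k_2$ if $k_1,k_2$ are exactly the positive integers $k$ with $m_{T_0}(\kappa_0k)=c_0$. For $T\in(0,\tfrac13)$ let $\kappa_0(T)>0$ be the unique positive number with $m_T(\kappa_0(T)k_1)=m_T(\kappa_0(T)k_2)$, let $c_0(T)$ be this common value, and put $\ell(k)=(c_0(T)-m_T(\kappa_0(T)k))^{-1}$ for $k\in\mathbb Z\setminus\{\pm k_1,\pm k_2\}$ and $\ell(\pm k_1)=\ell(\pm k_2)=0$. For $\alpha,\beta\in\mathbb N_0^2$ define $\hat u_{0,0}=0$, $\hat u_{\alpha,\beta}=\tfrac12$ if $|\alpha|+|\beta|=1$, and $$\hat u_{\alpha,\beta}=\ell\big(k_1(\alpha_1-\beta_1)+k_2(\alpha_2-\beta_2)\big)\sum_{\alpha'+\alpha''=\alpha,\ \beta'+\beta''=\beta}\hat u_{\alpha',\beta'}\hat u_{\alpha'',\beta''}\qquad\text{if }|\alpha|+|\beta|\ge2 ,$$ and let $$\phi(T;k_1,k_2)=\sum_{\alpha'+\alpha''=(k_2-1,0),\ \beta'+\beta''=(0,k_1)}\hat u_{\alpha',\beta'}\hat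 u_{\alpha'',\beta''}.$$ The double bifurcation point $(c_0,\kappa_0,T_0)$ is a *nondegenerate symmetry breaking bifurcation point* if $\phi(T_0;k_1,k_2)=0$, $\phi(\cdot;k_1,k_2)$ is strictly monotone near $T_0$, and $\partial_T\phi(T_0;k_1,k_2)\ne0$. **Theorem.** Let $s>0$, let $1\le k_1<k_2$ be coprime, and let $(c_0,\kappa_0,T_0)$ be a nondegenerate symmetry breaking bifurcation point with wave numbers $k_1,k_2$. Put $\Theta=(\mathbb R/\tfrac{2\pi}{k_1}\mathbb Z)\times(\mathbb R/\tfrac{2\pi}{k_2}\mathbb Z)$. Then, for some $\varepsilon>0$, there is a map $$[0,\varepsilon)^2\times\Theta\to\mathcal C^s(\mathbb T)\times(0,\infty)^2\times(0,\tfrac13),\qquad (r,\theta)\mapsto\big(u(r,\theta),c(r,\theta),\kappa(r,\theta),T(r,\theta)\big),$$ all of whose values are solutions of $(\ast)$, such that: 1. all four components are real analytic in $(r,\theta)$ (up to the boundary of $[0,\varepsilon)^2$, i.e. they extend analytically to a neighbourhood), and the image $\mathcal M$ of the map is a four-dimensional (topological) manifold; 2. $u(r,\theta)(x)=r_1\cos(k_1(x+\theta_1))+r_2\cos(k_2(x+\theta_2))+\mathcal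 O(|r|^2)$ in $\mathcal C^s(\mathbb T)$, and $c(r,\theta)=c_0+\mathcal O(|r|^2)$, $\kappa(r,\theta)=\kappa_0+\mathcal O(|r|^2)$, $T(r,\theta)=T_0+\mathcal O(|r|^2)$, uniformly on $[0,\varepsilon)^2\times\Theta$; 3. $x\mapsto u(r,\theta)(x)$ is asymmetric if, and only if, $r_1r_2\ne0$ and $\theta_1-\theta_2\notin\frac{\pi}{k_1k_2}\mathbb Z$; 4. $\mathcal M$ contains every solution $(u,c,\kappa,T)$ of $(\ast)$ with $u$ asymmetric that is sufficiently close to $(0,c_0,\kappa_0,T_0)$ in $\mathcal C^s(\mathbb T)\times\mathbb R^3$. -/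

import Mathlib

open Set
open scoped ContDiff

noncomputable section

namespace Whitham

instance instFactTwoPiPos : Fact (0 < 2 * Real.pi) := ⟨Real.two_pi_pos⟩

/-- The circle `ℝ / 2πℤ`. -/
abbrev Circ : Type := AddCircle (2 * Real.pi)

/-- The Fourier coefficients `(1 / 2π) ∫ u(x) e^{-ikx} dx` of a real-valued continuous function on
the circle. -/
def coeff (u : C(Circ, ℝ)) (k : ℤ) : ℂ :=
  fourierCoeff (fun x : Circ => ((u x : ℝ) : ℂ)) k

/-! ### Zygmund spaces -/

/-- The (Fourier transforms of the) cut-off functions used in the dyadic decomposition: smooth, even,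
equal to `1` on `[-1, 1]` and equal to `0` outside `(-2, 2)`. -/
structure LPCutoff where
  toFun : ℝ → ℝ
  smooth : ContDiff ℝ ∞ toFun
  even : ∀ ξ, toFun (-ξ) = toFun ξ
  eq_one : ∀ ξ, |ξ| ≤ 1 → toFun ξ = 1
  eq_zero : ∀ ξ, 2 ≤ |ξ| → toFun ξ = 0

/-- The symbol of the `j`-th dyadic block: `χ(ξ)` for `j = 0`, and
`χ(2^{-j} ξ) - χ(2^{-(j-1)} ξ)` for `j ≥ 1`. It vanishes for `|ξ| ≥ 2^{j+1}`. -/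
def LPCutoff.symbol (χ : LPCutoff) : ℕ → ℝ → ℝ
  | 0, ξ => χ.toFun ξ
  | j + 1, ξ => χ.toFun (ξ / 2 ^ (j + 1)) - χ.toFun (ξ / 2 ^ j)

/-- The `j`-th dyadic block of `u`, i.e. the Fourier multiplier with symbol `χ.symbol j` applied
to `u`. It is a trigonometric polynomial, since the symbol vanishes for `|k| ≥ 2^{j+1}`. -/
def block (χ : LPCutoff) (j : ℕ) (u : C(Circ, ℝ)) : C(Circ, ℂ) :=
  ∑ k ∈ Finset.Icc (-(2 : ℤ) ^ (j + 1)) (2 ^ (j + 1)),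
    (((χ.symbol j (k : ℝ) : ℝ) : ℂ) * coeff u k) • fourier k

/-- The terms `2^{js} ‖block j u‖_{L^∞}` of the Zygmund norm. -/
def zTerm (χ : LPCutoff) (s : ℝ) (u : C(Circ, ℝ)) (j : ℕ) : ℝ :=
  (2 : ℝ) ^ ((j : ℝ) * s) * ‖block χ j u‖

lemma integrable_coe (u : C(Circ, ℝ)) :
    MeasureTheory.Integrable (fun x : Circ => ((u x : ℝ) : ℂ)) AddCircle.haarAddCircle := by
  have hc : Continuous (fun x : Circ => ((u x : ℝ) : ℂ)) :=
    Complex.continuous_ofReal.comp u.continuous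
  exact hc.integrable_of_hasCompactSupport (HasCompactSupport.of_compactSpace _)

lemma coeff_add (u v : C(Circ, ℝ)) (k : ℤ) : coeff (u + v) k = coeff u k + coeff v k := by
  have h := fourierCoeff.add (integrable_coe u) (integrable_coe v)
  have h' := congrFun h k
  simp only [Pi.add_apply] at h'
  rw [coeff, coeff, coeff, ← h']
  congr 1
  funext x
  simp

lemma coeff_smul (a : ℝ) (u : C(Circ, ℝ)) (k : ℤ) : coeff (a • u) k = (a : ℂ) * coeff u k := by
  rw [coeff, coeff, ← fourierCoeff.const_mul]
  congr 1
  funext x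
  simp

lemma block_add (χ : LPCutoff) (j : ℕ) (u v : C(Circ, ℝ)) :
    block χ j (u + v) = block χ j u + block χ j v := by
  simp only [block, coeff_add, mul_add, add_smul, Finset.sum_add_distrib]

lemma block_smul (χ : LPCutoff) (j : ℕ) (a : ℝ) (u : C(Circ, ℝ)) :
    block χ j (a • u) = (a : ℂ) • block χ j u := by
  simp only [block, coeff_smul, Finset.smul_sum, smul_smul]
  refine Finset.sum_congr rfl fun k _ => ?_
  congr 1
  ring

lemma zTerm_nonneg (χ : LPCutoff) (s : ℝ) (u : C(Circ, ℝ)) (j : ℕ) : 0 ≤ zTerm χ s u j := by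
  unfold zTerm; positivity

lemma zTerm_add_le (χ : LPCutoff) (s : ℝ) (u v : C(Circ, ℝ)) (j : ℕ) :
    zTerm χ s (u + v) j ≤ zTerm χ s u j + zTerm χ s v j := by
  unfold zTerm
  rw [block_add, ← mul_add]
  exact mul_le_mul_of_nonneg_left (norm_add_le _ _) (by positivity)

lemma zTerm_smul (χ : LPCutoff) (s a : ℝ) (u : C(Circ, ℝ)) (j : ℕ) :
    zTerm χ s (a • u) j = |a| * zTerm χ s u j := by
  unfold zTerm
  rw [block_smul, norm_smul, Complex.norm_real, Real.norm_eq_abs]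
  ring

/-- The Zygmund space `𝒞^s(𝕋)`, as a space of real-valued continuous functions on the circle. For
`s > 0` every distribution on the circle with a finite Zygmund norm is a continuous function, so
that nothing is lost by this choice of ambient space. -/
def zygmundSubmodule (χ : LPCutoff) (s : ℝ) : Submodule ℝ C(Circ, ℝ) where
  carrier := {u | BddAbove (Set.range (zTerm χ s u))}
  add_mem' := by
    rintro u v ⟨A, hA⟩ ⟨B, hB⟩
    refine ⟨A + B, ?_⟩
    rintro _ ⟨j, rfl⟩
    exact (zTerm_add_le χ s u v j).trans (add_le_add (hA ⟨j, rfl⟩) (hB ⟨j, rfl⟩))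
  zero_mem' := by
    refine ⟨0, ?_⟩
    rintro _ ⟨j, rfl⟩
    have h := zTerm_smul χ s 0 0 j
    rw [zero_smul, abs_zero, zero_mul] at h
    exact h.le
  smul_mem' := by
    rintro a u ⟨A, hA⟩
    refine ⟨|a| * A, ?_⟩
    rintro _ ⟨j, rfl⟩
    rw [zTerm_smul]
    exact mul_le_mul_of_nonneg_left (hA ⟨j, rfl⟩) (abs_nonneg a)

/-- The Zygmund space as a type of its own: its norm is the Zygmund norm and not the supremum norm
inherited from the continuous functions. -/
def Zygmund (χ : LPCutoff) (s : ℝ) : Type := zygmundSubmodule χ s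

instance (χ : LPCutoff) (s : ℝ) : AddCommGroup (Zygmund χ s) :=
  inferInstanceAs (AddCommGroup (zygmundSubmodule χ s))

instance (χ : LPCutoff) (s : ℝ) : Module ℝ (Zygmund χ s) :=
  inferInstanceAs (Module ℝ (zygmundSubmodule χ s))

/-- The underlying continuous function on the circle. -/
def Zygmund.toCont {χ : LPCutoff} {s : ℝ} (u : Zygmund χ s) : C(Circ, ℝ) := Subtype.val u

/-- The Zygmund norm `sup_j 2^{js} ‖block j u‖_{L^∞}`. -/
instance (χ : LPCutoff) (s : ℝ) : Norm (Zygmund χ s) :=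
  ⟨fun u => ⨆ j, zTerm χ s u.toCont j⟩

lemma Zygmund.bdd {χ : LPCutoff} {s : ℝ} (u : Zygmund χ s) :
    BddAbove (Set.range (zTerm χ s u.toCont)) := Subtype.property u

lemma Zygmund.norm_def {χ : LPCutoff} {s : ℝ} (u : Zygmund χ s) :
    ‖u‖ = ⨆ j, zTerm χ s u.toCont j := rfl

lemma sum_symbol (χ : LPCutoff) (ξ : ℝ) (n : ℕ) :
    ∑ j ∈ Finset.range (n + 1), χ.symbol j ξ = χ.toFun (ξ / 2 ^ n) := by
  induction n with
  | zero => simp [LPCutoff.symbol]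
  | succ n ih => rw [Finset.sum_range_succ, ih]; simp [LPCutoff.symbol]

lemma exists_symbol_ne_zero (χ : LPCutoff) (k : ℤ) :
    ∃ j : ℕ, χ.symbol j (k : ℝ) ≠ 0 := by
  by_contra! h
  obtain ⟨n, hn⟩ := pow_unbounded_of_one_lt |(k : ℝ)| (one_lt_two)
  have h1 := sum_symbol χ k n
  rw [Finset.sum_eq_zero (fun j _ => h j), χ.eq_one] at h1
  · exact zero_ne_one h1
  · rw [abs_div, abs_of_pos (by positivity : (0 : ℝ) < 2 ^ n)]
    exact (div_le_one (by positivity)).2 hn.le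

lemma symbol_eq_zero (χ : LPCutoff) (j : ℕ) (k : ℤ)
    (hk : k ∉ Finset.Icc (-(2 : ℤ) ^ (j + 1)) (2 ^ (j + 1))) : χ.symbol j (k : ℝ) = 0 := by
  have h1 : (2 : ℝ) ^ (j + 1) ≤ |(k : ℝ)| := by
    have : (2 : ℤ) ^ (j + 1) ≤ |k| := by
      by_contra! h
      exact hk (Finset.mem_Icc.2 ⟨(abs_lt.1 h).1.le, (abs_lt.1 h).2.le⟩)
    exact_mod_cast this
  cases j with
  | zero => exact χ.eq_zero _ (by simpa using h1)
  | succ j =>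
    have e1 : χ.toFun ((k : ℝ) / 2 ^ (j + 1)) = 0 := by
      apply χ.eq_zero
      rw [abs_div, abs_of_pos (by positivity : (0 : ℝ) < 2 ^ (j + 1)),
        le_div_iff₀ (by positivity)]
      rw [pow_succ] at h1; linarith
    have e2 : χ.toFun ((k : ℝ) / 2 ^ j) = 0 := by
      apply χ.eq_zero
      rw [abs_div, abs_of_pos (by positivity : (0 : ℝ) < 2 ^ j), le_div_iff₀ (by positivity)]
      have : (0 : ℝ) < 2 ^ j := by positivity
      rw [pow_succ, pow_succ] at h1; linarith
    simp [LPCutoff.symbol, e1, e2]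

lemma coeff_eq_zero_of_block (χ : LPCutoff) (u : C(Circ, ℝ)) (h : ∀ j, block χ j u = 0) (k : ℤ) :
    coeff u k = 0 := by
  obtain ⟨j, hj⟩ := exists_symbol_ne_zero χ k
  have hk : k ∈ Finset.Icc (-(2 : ℤ) ^ (j + 1)) (2 ^ (j + 1)) := by
    by_contra hk
    exact hj (symbol_eq_zero χ j k hk)
  have hli : LinearIndependent ℂ (fun n : ℤ => (fourier n : C(Circ, ℂ))) := by
    have h2 := (orthonormal_fourier (T := 2 * Real.pi)).linearIndependent
    exact LinearIndependent.of_comp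
      (ContinuousMap.toLp (E := ℂ) 2 AddCircle.haarAddCircle ℂ).toLinearMap h2
  have h3 := linearIndependent_iff'.1 hli _ _ (h j) k hk
  rcases mul_eq_zero.1 h3 with h4 | h4
  · exact absurd (by exact_mod_cast h4) hj
  · exact h4

lemma eq_zero_of_coeff (u : C(Circ, ℝ)) (h : ∀ k, coeff u k = 0) : u = 0 := by
  let U : C(Circ, ℂ) := ⟨fun x => ((u x : ℝ) : ℂ), Complex.continuous_ofReal.comp u.continuous⟩
  have hU : fourierCoeff U = 0 := funext h
  have hs : Summable (fourierCoeff U) := by rw [hU]; exact summable_zero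
  ext x
  have h1 := has_pointwise_sum_fourier_series_of_summable hs x
  simp only [hU, Pi.zero_apply, zero_smul] at h1
  have h2 : (U x : ℂ) = 0 := h1.unique hasSum_zero
  exact Complex.ofReal_eq_zero.1 h2

lemma zygmundCore (χ : LPCutoff) (s : ℝ) : NormedSpace.Core ℝ (Zygmund χ s) where
  norm_nonneg u := Real.iSup_nonneg fun j => zTerm_nonneg χ s _ j
  norm_smul a u := by
    have e : ∀ j, zTerm χ s (a • u).toCont j = |a| * zTerm χ s u.toCont j :=
      fun j => zTerm_smul χ s a u.toCont j
    rw [Zygmund.norm_def, Zygmund.norm_def, Real.norm_eq_abs,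
      Real.mul_iSup_of_nonneg (abs_nonneg a)]
    simp only [e]
  norm_triangle u v := by
    rw [Zygmund.norm_def, Zygmund.norm_def, Zygmund.norm_def]
    refine ciSup_le fun j => (zTerm_add_le χ s u.toCont v.toCont j).trans ?_
    exact add_le_add (le_ciSup u.bdd j) (le_ciSup v.bdd j)
  norm_eq_zero_iff u := by
    constructor
    · intro h
      rw [Zygmund.norm_def] at h
      apply Subtype.ext
      refine eq_zero_of_coeff _ (coeff_eq_zero_of_block χ _ fun j => ?_)
      have h1 : zTerm χ s u.toCont j ≤ 0 := h ▸ le_ciSup u.bdd j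
      have h2 : zTerm χ s u.toCont j = 0 := le_antisymm h1 (zTerm_nonneg _ _ _ _)
      rcases mul_eq_zero.1 h2 with h3 | h3
      · exact absurd h3 (by positivity)
      · exact norm_eq_zero.1 h3
    · rintro rfl
      rw [Zygmund.norm_def]
      have e : ∀ j, zTerm χ s (0 : Zygmund χ s).toCont j = 0 := by
        intro j
        have h := zTerm_smul χ s 0 0 j
        rw [zero_smul, abs_zero, zero_mul] at h
        exact h
      simp [e]

instance (χ : LPCutoff) (s : ℝ) : NormedAddCommGroup (Zygmund χ s) :=
  NormedAddCommGroup.ofCore (zygmundCore χ s)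

instance (χ : LPCutoff) (s : ℝ) : NormedSpace ℝ (Zygmund χ s) :=
  NormedSpace.ofCore (zygmundCore χ s)

/-- The `2π`-periodic function on the line given by an element of the Zygmund space. -/
def Zygmund.onLine {χ : LPCutoff} {s : ℝ} (u : Zygmund χ s) (x : ℝ) : ℝ := u.toCont (x : Circ)

/-! ### The steady equation -/

/-- The symbol `m_T(ξ) = √((1 + T ξ²) tanh ξ / ξ)`, with its limit `1` at `ξ = 0`. -/
def m (T ξ : ℝ) : ℝ :=
  if ξ = 0 then 1 else Real.sqrt ((1 + T * ξ ^ 2) * Real.tanh ξ / ξ)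

/-- The Fourier coefficients of the distribution `J(u; c, κ, T) = (M_{T,κ} - c) u + u²`, where
`M_{T,κ}` is the Fourier multiplier with symbol `ξ ↦ m_T(κ ξ)`. -/
def J (u : C(Circ, ℝ)) (c κ T : ℝ) (k : ℤ) : ℂ :=
  ((m T (κ * k) - c : ℝ) : ℂ) * coeff u k + coeff (u ^ 2) k

/-- `(u, c, κ, T)` solves `(M_{T,κ} - c) u + u² = 0` in the sense of distributions on the circle,
i.e. all the Fourier coefficients of the left-hand side vanish. -/
def IsSolution (u : C(Circ, ℝ)) (c κ T : ℝ) : Prop := ∀ k : ℤ, J u c κ T k = 0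

/-- A function is symmetric if one of its translates is even. -/
def IsSymmetric (f : ℝ → ℝ) : Prop := ∃ a : ℝ, Function.Even fun x => f (x + a)

/-- A function is asymmetric if it is not symmetric. -/
def IsAsymmetric (f : ℝ → ℝ) : Prop := ¬ IsSymmetric f

/-! ### Bifurcation points and the symmetry breaking criterion -/

/-- `(c, κ, T)` is a double bifurcation point with wave numbers `k₁ < k₂`: these are exactly the
positive integers `k` with `m_T(κ k) = c`. -/
structure IsDoubleBifurcationPoint (k₁ k₂ : ℕ) (c κ T : ℝ) : Prop where
  c_pos : 0 < c
  κ_pos : 0 < κ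
  T_pos : 0 < T
  one_le : 1 ≤ k₁
  lt : k₁ < k₂
  iff : ∀ k : ℕ, 1 ≤ k → (m T (κ * k) = c ↔ k = k₁ ∨ k = k₂)

/-- `κ₀(T; k₁, k₂)`: the (for `0 < T < 1/3` unique) positive number `κ` with
`m_T(κ k₁) = m_T(κ k₂)`. -/
def kappa0 (k₁ k₂ : ℕ) (T : ℝ) : ℝ :=
  Classical.epsilon fun κ : ℝ => 0 < κ ∧ m T (κ * k₁) = m T (κ * k₂)

/-- `c₀(T; k₁, k₂) = m_T(κ₀ k₁) = m_T(κ₀ k₂)`. -/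
def c0 (k₁ k₂ : ℕ) (T : ℝ) : ℝ := m T (kappa0 k₁ k₂ T * k₁)

/-- The symbol of the multiplier `L = (c - M_{T,κ})⁻¹ P_W`:
`ℓ(k) = 1 / (c - m_T(κ k))` for `k ∉ {±k₁, ±k₂}`, and `ℓ(k) = 0` otherwise. -/
def ell (k₁ k₂ : ℕ) (c κ T : ℝ) (k : ℤ) : ℝ :=
  if k.natAbs = k₁ ∨ k.natAbs = k₂ then 0 else (c - m T (κ * k))⁻¹

/-- Pairs `(α, β)` of multi-indices `α = (α₁, α₂)` and `β = (β₁, β₂)`. -/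
abbrev Idx : Type := (ℕ × ℕ) × (ℕ × ℕ)

/-- `|α| + |β|`. -/
def Idx.deg (p : Idx) : ℕ := p.1.1 + p.1.2 + (p.2.1 + p.2.2)

/-- The wave number `k₁ (α₁ - β₁) + k₂ (α₂ - β₂)` of the term with index `(α, β)`. -/
def Idx.freq (k₁ k₂ : ℕ) (p : Idx) : ℤ :=
  k₁ * ((p.1.1 : ℤ) - p.2.1) + k₂ * ((p.1.2 : ℤ) - p.2.2)

/-- The Taylor-Fourier coefficients `û_{α,β}` of `u = v + w`, where
`v = r₁ cos(k₁(x + θ₁)) + r₂ cos(k₂(x + θ₂))` and `w = L(v + w)²`, in the expansion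
`u = ∑ û_{α,β} r^{α+β} E^{α-β}`, `E = (e^{ik₁(x+θ₁)}, e^{ik₂(x+θ₂)})`. They are given by
`û_{0,0} = 0`, `û_{α,β} = 1/2` if `|α| + |β| = 1`, and
`û_{α,β} = ℓ(k₁(α₁-β₁) + k₂(α₂-β₂)) ∑ û_{α',β'} û_{α'',β''}` if `|α| + |β| ≥ 2`, the sum being over
all `(α', β') + (α'', β'') = (α, β)`; the terms with `(α', β') = 0` or `(α'', β'') = 0` vanish. -/
def uHat (k₁ k₂ : ℕ) (c κ T : ℝ) (p : Idx) : ℝ :=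
  if p.deg = 0 then 0
  else if p.deg = 1 then 1 / 2
  else ell k₁ k₂ c κ T (p.freq k₁ k₂) * ∑ q ∈ (Finset.Iic p).attach,
    if _h : 0 < q.1.deg ∧ q.1.deg < p.deg then
      uHat k₁ k₂ c κ T q.1 * uHat k₁ k₂ c κ T (p - q.1)
    else 0
termination_by p.deg
decreasing_by
  · exact _h.2
  · have hq := Finset.mem_Iic.1 q.2
    obtain ⟨⟨h1, h2⟩, h3, h4⟩ := hq
    have hpos := _h.1
    simp only [Idx.deg, Prod.fst_sub, Prod.snd_sub] at hpos ⊢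
    omega

/-- The Taylor-Fourier coefficients of `u²`: the sum of `û_{α',β'} û_{α'',β''}` over all
`(α', β') + (α'', β'') = (α, β)`. -/
def uSqHat (k₁ k₂ : ℕ) (c κ T : ℝ) (p : Idx) : ℝ :=
  ∑ q ∈ Finset.Iic p, uHat k₁ k₂ c κ T q * uHat k₁ k₂ c κ T (p - q)

/-- `φ(T; k₁, k₂)`: the coefficient of `u²` with index `α = (k₂ - 1, 0)`, `β = (0, k₁)` at
`(c, κ) = (c₀(T), κ₀(T))`. -/
def phi (k₁ k₂ : ℕ) (T : ℝ) : ℝ :=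
  uSqHat k₁ k₂ (c0 k₁ k₂ T) (kappa0 k₁ k₂ T) T ((k₂ - 1, 0), (0, k₁))

/-- A double bifurcation point at which `φ` vanishes, `φ` being strictly monotone near `T`. -/
structure IsSymmetryBreaking (k₁ k₂ : ℕ) (c κ T : ℝ) : Prop
    extends IsDoubleBifurcationPoint k₁ k₂ c κ T where
  phi_eq_zero : phi k₁ k₂ T = 0
  monotone : ∃ δ > 0, StrictMonoOn (phi k₁ k₂) (Ioo (T - δ) (T + δ)) ∨
    StrictAntiOn (phi k₁ k₂) (Ioo (T - δ) (T + δ))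

/-- A symmetry breaking bifurcation point with `∂_T φ ≠ 0`. -/
structure IsNondegenerateSymmetryBreaking (k₁ k₂ : ℕ) (c κ T : ℝ) : Prop
    extends IsSymmetryBreaking k₁ k₂ c κ T where
  deriv_ne_zero : deriv (phi k₁ k₂) T ≠ 0

/-! ### The parameter domain -/

/-- The parameters `((r₁, r₂), (θ₁, θ₂))` with `r ∈ [0, ε)²`; functions on the torus
`(ℝ / (2π/k₁)ℤ) × (ℝ / (2π/k₂)ℤ)` are written as functions of `θ ∈ ℝ²` that are `2π/k₁`-periodic in
`θ₁` and `2π/k₂`-periodic in `θ₂`. -/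
def paramDomain (ε : ℝ) : Set ((ℝ × ℝ) × (ℝ × ℝ)) := (Ico 0 ε ×ˢ Ico 0 ε) ×ˢ univ

/-- Periodicity in `θ`, i.e. the function descends to the torus. -/
def TorusPeriodic {E : Type*} (k₁ k₂ : ℕ) (F : (ℝ × ℝ) × (ℝ × ℝ) → E) : Prop :=
  ∀ r θ : ℝ × ℝ, F (r, (θ.1 + 2 * Real.pi / k₁, θ.2)) = F (r, θ) ∧
    F (r, (θ.1, θ.2 + 2 * Real.pi / k₂)) = F (r, θ)

end Whitham

end

open Whitham

noncomputable section

namespace Whitham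

section

open Filter Topology BoundedContinuousFunction

/-! ### The analytic implicit function theorem -/

section Implicit

variable {E₁ E₂ F : Type*} [NormedAddCommGroup E₁] [NormedSpace ℝ E₁] [CompleteSpace E₁]
  [NormedAddCommGroup E₂] [NormedSpace ℝ E₂] [CompleteSpace E₂]
  [NormedAddCommGroup F] [NormedSpace ℝ F] [CompleteSpace F]

/-! The proof is a Lyapunov–Schmidt reduction carried out on coefficient families.

Fix complex amplitudes Z = (Z₁, Z₂) and parameters l = (c, κ, T). The Fourier modes of the equation
other than ±k₁, ±k₂ are solved by a series u = ∑ a_{α,β} Z^α Z̄^β e_{k(α,β)} with a_{α,β} = û_{α,β}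
t^{|α|+|β|}, where t > 0 is small and fixed once and for all. The family a solves a quadratic fixed
point equation in ℓ¹, so the implicit function theorem at t = 0 makes it analytic in l
(`exists_analytic_uHat`). This uses that the multiplier `ell` is analytic in l uniformly in the wave
number (`exists_analytic_ellSeq`). Conversely, a small solution of the noncritical equations is
determined by its critical coefficients, through a contraction argument in L²
(`eq_of_coeff_eq_of_J_eq_zero`).

Two complex equations remain, for the modes k₁ and k₂. Put I = Z̄₁^{k₂} Z₂^{k₁}. Since k₁ and k₂ are
coprime and I² = 2 Re(I) I − |I|², every monomial of wave number k₁ is a combination of Z₁ and E₁ =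
Z̄₁^{k₂-1} Z₂^{k₁} whose real coefficients depend only on |Z₁|², |Z₂|², Re I (`mono_eq_red`);
likewise for k₂. The equations thus read A₁Z₁ + B₁E₁ = 0 and A₂Z₂ + B₂E₂ = 0, with A_i, B_i real.
Orthogonality of u² and u' gives (k₁B₁ − k₂B₂) Im I = 0, so that B₁ = 0 forces B₂E₂ = 0
(`eventually_redCoeff_mul_exc`).

This leaves three real equations A₁ = A₂ = B₁ = 0 for the three unknowns c, κ, T as functions of the
invariants (`exists_reduced_solution`). When the invariants vanish, the first two equations cut out
the curve of double bifurcation points, transversally because the symbol decreases at κ₀k₁ and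
increases at κ₀k₂. Along this curve B₁ is φ times a power of t, so ∂_T φ ≠ 0 makes the linearization
invertible (`linearization_injective`).

A wave is asymmetric exactly when Im I ≠ 0 (`isAsymmetric_iff`). In that case Z₁ and E₁ are
independent over ℝ, so the three real equations are necessary as well, and no asymmetric solution
nearby is lost. Finally Z is recovered continuously from the critical Fourier coefficients, so the
solutions over a ball in ℂ² form a four-dimensional manifold, and polar coordinates in Z give the
parameters (r, θ). -/

lemma exists_analytic_implicit {f : E₁ × E₂ → F} {x₀ : E₁} {y₀ : E₂}
    (hf : ContDiffAt ℝ ω f (x₀, y₀)) (A : E₂ ≃L[ℝ] F)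
    (hA : HasFDerivAt (fun y => f (x₀, y)) (A : E₂ →L[ℝ] F) y₀) (h0 : f (x₀, y₀) = 0) :
    ∃ φ : E₁ → E₂, φ x₀ = y₀ ∧ ContDiffAt ℝ ω φ x₀ ∧ (∀ᶠ x in 𝓝 x₀, f (x, φ x) = 0) ∧
      ∀ᶠ v in 𝓝 (x₀, y₀), (f v = 0 ↔ φ v.1 = v.2) := by
  have hω : (ω : WithTop ℕ∞) ≠ 0 := by simp
  have hd := (hf.differentiableAt hω).hasFDerivAt
  have e : fderiv ℝ f (x₀, y₀) ∘L .inr ℝ E₁ E₂ = (A : E₂ →L[ℝ] F) := by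
    have h1 : HasFDerivAt (fun y : E₂ => (x₀, y)) (ContinuousLinearMap.inr ℝ E₁ E₂) y₀ :=
      hasFDerivAt_prodMk_right x₀ y₀
    exact (HasFDerivAt.comp y₀ (g := f) hd h1).unique hA
  have hi : (fderiv ℝ f (x₀, y₀) ∘L .inr ℝ E₁ E₂).IsInvertible := ⟨A, e.symm⟩
  refine ⟨hf.implicitFunction hω hi, hf.implicitFunction_apply_self hω hi,
    hf.contDiffAt_implicitFunction hω hi, ?_, ?_⟩
  · simpa only [h0] using hf.eventually_apply_implicitFunction hω hi
  · simpa only [h0] using hf.eventually_apply_eq_iff_implicitFunction hω hi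

end Implicit

/-! ### The space of summable families -/

/-- Absolutely summable real families. -/
abbrev L1 (ι : Type*) : Type _ := lp (fun _ : ι => ℝ) 1

section L1

variable {ι : Type*}

lemma L1.hasSum_norm (a : L1 ι) : HasSum (fun i => |a i|) ‖a‖ := by
  simpa using lp.hasSum_norm (p := 1) (by norm_num) a

lemma L1.norm_eq (a : L1 ι) : ‖a‖ = ∑' i, |a i| := (L1.hasSum_norm a).tsum_eq.symm

lemma L1.summable (a : L1 ι) : Summable fun i => |a i| := (L1.hasSum_norm a).summable

/-- The summable family with given entries. -/
def L1.mk (f : ι → ℝ) (hf : Summable fun i => |f i|) : L1 ι :=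
  ⟨f, memℓp_gen (by simpa using hf)⟩

@[simp] lemma L1.mk_apply (f : ι → ℝ) (hf : Summable fun i => |f i|) (i : ι) :
    L1.mk f hf i = f i := rfl

variable {E : Type*} [NormedAddCommGroup E] [NormedSpace ℝ E]

section Pair

variable [TopologicalSpace ι]

lemma L1.norm_smul_le (M : ι →ᵇ E) (a : L1 ι) (i : ι) : ‖a i • M i‖ ≤ |a i| * ‖M‖ := by
  rw [norm_smul, Real.norm_eq_abs]
  exact mul_le_mul_of_nonneg_left (M.norm_coe_le_norm i) (abs_nonneg _)

variable [CompleteSpace E]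

lemma L1.summable_smul (M : ι →ᵇ E) (a : L1 ι) : Summable fun i => a i • M i :=
  .of_norm_bounded ((L1.summable a).mul_right ‖M‖) (L1.norm_smul_le M a)

/-- The pairing `∑ aᵢ Mᵢ` of a bounded vector-valued family with a summable family. -/
def pair : (ι →ᵇ E) →L[ℝ] L1 ι →L[ℝ] E :=
  LinearMap.mkContinuous₂ (LinearMap.mk₂ ℝ (fun (M : ι →ᵇ E) (a : L1 ι) => ∑' i, a i • M i)
    (fun M N a => by
      rw [← (L1.summable_smul M a).tsum_add (L1.summable_smul N a)]; simp)
    (fun c M a => by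
      rw [← (L1.summable_smul M a).tsum_const_smul c]; simp [smul_comm c])
    (fun M a b => by
      rw [← (L1.summable_smul M a).tsum_add (L1.summable_smul M b)]; simp [add_smul])
    (fun c M a => by
      rw [← (L1.summable_smul M a).tsum_const_smul c]; simp [mul_smul])) 1
    (fun M a => by
      rw [one_mul, LinearMap.mk₂_apply, mul_comm]
      exact tsum_of_norm_bounded ((L1.hasSum_norm a).mul_right ‖M‖) (L1.norm_smul_le M a))

lemma hasSum_pair (M : ι →ᵇ E) (a : L1 ι) : HasSum (fun i => a i • M i) (pair M a) :=
  (L1.summable_smul M a).hasSum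

lemma norm_pair_le (M : ι →ᵇ E) (a : L1 ι) : ‖pair M a‖ ≤ ‖M‖ * ‖a‖ := by
  rw [mul_comm]
  exact tsum_of_norm_bounded ((L1.hasSum_norm a).mul_right ‖M‖) (L1.norm_smul_le M a)

variable [DecidableEq ι]

lemma pair_single (M : ι →ᵇ E) (i : ι) : pair M (lp.single 1 i (1 : ℝ)) = M i := by
  have h := hasSum_single (f := fun j => (lp.single 1 i (1 : ℝ) : L1 ι) j • M j) i (fun j hj => by
    simp [lp.single_apply, Pi.single_eq_of_ne hj])
  refine (hasSum_pair M _).unique ?_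
  simpa using h

omit [TopologicalSpace ι] [CompleteSpace E] in
lemma L1.ext_clm {f g : L1 ι →L[ℝ] E} (h : ∀ i, f (lp.single 1 i 1) = g (lp.single 1 i 1)) :
    f = g := by
  refine lp.ext_continuousLinearMap (by simp) fun i => ?_
  ext
  simpa using h i

omit [TopologicalSpace ι] [CompleteSpace E] in
lemma L1.ext_clm₂ {f g : L1 ι →L[ℝ] L1 ι →L[ℝ] E}
    (h : ∀ i j, f (lp.single 1 i 1) (lp.single 1 j 1) = g (lp.single 1 i 1) (lp.single 1 j 1)) :
    f = g :=
  L1.ext_clm fun i => L1.ext_clm fun j => h i j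

end Pair

/-- Multiplication of a summable family by a bounded family. -/
def diag [TopologicalSpace ι] : (ι →ᵇ ℝ) →L[ℝ] L1 ι →L[ℝ] L1 ι :=
  have hs (f : ι →ᵇ ℝ) (a : L1 ι) (i : ι) : |f i * a i| ≤ ‖f‖ * |a i| := by
    rw [abs_mul]
    exact mul_le_mul_of_nonneg_right (f.norm_coe_le_norm i) (abs_nonneg _)
  have hsum (f : ι →ᵇ ℝ) (a : L1 ι) : Summable fun i => |f i * a i| :=
    .of_nonneg_of_le (fun _ => abs_nonneg _) (hs f a) ((L1.summable a).mul_left _)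
  LinearMap.mkContinuous₂ (LinearMap.mk₂ ℝ (fun (f : ι →ᵇ ℝ) (a : L1 ι) =>
      L1.mk (fun i => f i * a i) (hsum f a))
    (fun f g a => by ext i; simp [add_mul])
    (fun c f a => by ext i; simp [mul_assoc])
    (fun f a b => by ext i; simp [mul_add])
    (fun c f a => by ext i; simp [mul_left_comm])) 1
    (fun f a => by
      rw [one_mul, LinearMap.mk₂_apply, L1.norm_eq, L1.norm_eq, ← tsum_mul_left]
      exact (hsum f a).tsum_le_tsum (hs f a) ((L1.summable a).mul_left _))

@[simp] lemma diag_apply [TopologicalSpace ι] (f : ι →ᵇ ℝ) (a : L1 ι) (i : ι) :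
    diag f a i = f i * a i := rfl

end L1

/-! ### Convolution of families indexed by a discrete monoid -/

section Conv

variable {G : Type*} [AddCommMonoid G] [DecidableEq G] [TopologicalSpace G] [DiscreteTopology G]

/-- Convolution `(a * b)_p = ∑_{q + q' = p} a_q b_{q'}` of summable families. -/
def conv : L1 G →L[ℝ] L1 G →L[ℝ] L1 G :=
  pair (ofNormedAddCommGroupDiscrete (fun q : G =>
    pair (ofNormedAddCommGroupDiscrete (fun q' : G => (lp.single 1 (q + q') (1 : ℝ) : L1 G)) 1
      (fun q' => by rw [lp.norm_single (by norm_num)]; simp))) 1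
    (fun q => ContinuousLinearMap.opNorm_le_bound _ zero_le_one fun a => by
      refine (norm_pair_le _ a).trans (mul_le_mul_of_nonneg_right ?_ (norm_nonneg a))
      refine (BoundedContinuousFunction.norm_le zero_le_one).2 fun q' => ?_
      change ‖(lp.single 1 (q + q') (1 : ℝ) : L1 G)‖ ≤ 1
      rw [lp.norm_single (by norm_num)]; simp))

lemma conv_single (q q' : G) :
    conv (lp.single 1 q 1) (lp.single 1 q' 1) = (lp.single 1 (q + q') (1 : ℝ) : L1 G) := by
  rw [conv, pair_single]
  exact pair_single _ _

variable {E : Type*} [NormedRing E] [NormedAlgebra ℝ E] [CompleteSpace E]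

/-- Both sides are continuous and bilinear in `a` and `b`, so it is enough to compare them on unit
vectors, where the claim is `hM`. For trigonometric monomials it expresses the square of a wave as a
convolution of coefficients. -/
lemma pair_conv_of_mul (M : G →ᵇ E) (hM : ∀ q q', M (q + q') = M q * M q') (a b : L1 G) :
    pair M (conv a b) = pair M a * pair M b := by
  have h : (ContinuousLinearMap.compL ℝ (L1 G) (L1 G) E (pair M)) ∘L conv =
      (ContinuousLinearMap.mul ℝ E).bilinearComp (pair M) (pair M) :=
    L1.ext_clm₂ fun i j => by simp [conv_single, pair_single, hM]
  exact congr($h a b)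

/-- Again a comparison of bilinear maps on unit vectors; in the application `D` is differentiation
in x and the claim is the Leibniz rule. -/
lemma pair_conv_of_derivation (M D : G →ᵇ E) (hM : ∀ q q', D (q + q') = D q * M q' + M q * D q')
    (a b : L1 G) : pair D (conv a b) = pair D a * pair M b + pair M a * pair D b := by
  have h : (ContinuousLinearMap.compL ℝ (L1 G) (L1 G) E (pair D)) ∘L conv =
      (ContinuousLinearMap.mul ℝ E).bilinearComp (pair D) (pair M) +
      (ContinuousLinearMap.mul ℝ E).bilinearComp (pair M) (pair D) :=
    L1.ext_clm₂ fun i j => by simp [conv_single, pair_single, hM]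
  exact congr($h a b)

end Conv

lemma conv_apply (a b : L1 Idx) (p : Idx) :
    conv a b p = ∑ q ∈ Finset.Iic p, a q * b (p - q) := by
  -- Convolution with a unit vector is a shift by `q`. The condition `q ≤ p` is needed because
  -- subtraction of indices is truncated.
  have key (q : Idx) : conv (lp.single 1 q 1) b p = if q ≤ p then b (p - q) else 0 := by
    have h1 := (hasSum_pair (ofNormedAddCommGroupDiscrete
      (fun q' : Idx => (lp.single 1 (q + q') (1 : ℝ) : L1 Idx)) 1
      (fun q' => by rw [lp.norm_single (by norm_num)]; simp)) b).mapL
      (lp.evalCLM ℝ (fun _ : Idx => ℝ) 1 p)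
    have h2 : conv (lp.single 1 q 1) b = pair (ofNormedAddCommGroupDiscrete
      (fun q' : Idx => (lp.single 1 (q + q') (1 : ℝ) : L1 Idx)) 1
      (fun q' => by rw [lp.norm_single (by norm_num)]; simp)) b := by
      rw [conv, pair_single]; rfl
    rw [h2]
    refine h1.unique ?_
    have e (q' : Idx) : (lp.evalCLM ℝ (fun _ : Idx => ℝ) 1 p)
        (b q' • (lp.single 1 (q + q') (1 : ℝ) : L1 Idx)) = if q + q' = p then b q' else 0 := by
      change b q' • (lp.single 1 (q + q') (1 : ℝ) : L1 Idx) p = _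
      rw [lp.single_apply]
      split_ifs with h
      · simp [h]
      · rw [Pi.single_eq_of_ne (Ne.symm h)]; simp
    change HasSum (fun q' : Idx => (lp.evalCLM ℝ (fun _ : Idx => ℝ) 1 p)
        (b q' • (lp.single 1 (q + q') (1 : ℝ) : L1 Idx))) _
    simp only [e]
    split_ifs with h
    · have h2 := hasSum_single (f := fun q' => if q + q' = p then b q' else 0) (p - q)
        (fun q' hq' => if_neg fun hq => hq' (by rw [← hq, add_tsub_cancel_left]))
      rwa [if_pos (add_tsub_cancel_of_le h)] at h2
    · have h2 : (fun q' => if q + q' = p then b q' else 0) = fun _ => 0 := by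
        funext q'
        exact if_neg fun hq : q + q' = p => h (hq ▸ le_self_add)
      rw [h2]
      exact hasSum_zero
  have h3 := ((lp.hasSum_single (by simp) a).mapL (conv (G := Idx))).mapL
    ((lp.evalCLM ℝ (fun _ : Idx => ℝ) 1 p) ∘L (ContinuousLinearMap.apply ℝ (L1 Idx) b))
  refine h3.unique ?_
  have e (q : Idx) : ((lp.evalCLM ℝ (fun _ : Idx => ℝ) 1 p) ∘L
      (ContinuousLinearMap.apply ℝ (L1 Idx) b)) (conv (lp.single 1 q (a q) : L1 Idx)) =
      if q ∈ Finset.Iic p then a q * b (p - q) else 0 := by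
    have : (lp.single 1 q (a q) : L1 Idx) = a q • lp.single 1 q (1 : ℝ) := by
      rw [← lp.single_smul]; simp
    rw [this]
    change (conv (a q • (lp.single 1 q (1 : ℝ) : L1 Idx)) b) p = _
    rw [map_smul, _root_.smul_apply, lp.coeFn_smul, Pi.smul_apply, key]
    simp
  simp only [e]
  have h4 := hasSum_sum_of_ne_finset_zero (s := Finset.Iic p)
    (f := fun q => if q ∈ Finset.Iic p then a q * b (p - q) else 0) (L := .unconditional _)
    (fun q hq => if_neg hq)
  rwa [Finset.sum_congr rfl fun q hq => if_pos hq] at h4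

/-! ### Analytic families of bounded sequences -/

section Seq

variable {𝕜 : Type*} [RCLike 𝕜]

/-- The right shift on bounded sequences. -/
def rshift : (ℕ →ᵇ 𝕜) →L[𝕜] (ℕ →ᵇ 𝕜) :=
  LinearMap.mkContinuous
    { toFun f := ofNormedAddCommGroupDiscrete (fun n => Nat.casesOn n 0 f) ‖f‖ (by
        rintro (_ | n)
        · simp
        · exact f.norm_coe_le_norm n)
      map_add' f g := by ext (_ | n) <;> simp
      map_smul' c f := by ext (_ | n) <;> simp } 1 (fun f => by
        rw [one_mul]
        refine (BoundedContinuousFunction.norm_le (norm_nonneg f)).2 ?_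
        rintro (_ | n)
        · simp
        · exact f.norm_coe_le_norm n)

@[simp] lemma rshift_zero (f : ℕ →ᵇ 𝕜) : rshift f 0 = 0 := rfl

@[simp] lemma rshift_succ (f : ℕ →ᵇ 𝕜) (n : ℕ) : rshift f (n + 1) = f n := rfl

lemma norm_rshift_le : ‖(rshift : (ℕ →ᵇ 𝕜) →L[𝕜] (ℕ →ᵇ 𝕜))‖ ≤ 1 :=
  LinearMap.mkContinuous_norm_le _ zero_le_one _

/-- The sequence with a single non-zero entry. -/
def deltaSeq (i : ℕ) : ℕ →ᵇ 𝕜 :=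
  ofNormedAddCommGroupDiscrete (fun n => if n = i then 1 else 0) 1 (fun n => by
    split_ifs <;> simp)

@[simp] lemma deltaSeq_apply (i n : ℕ) : (deltaSeq i : ℕ →ᵇ 𝕜) n = if n = i then 1 else 0 := rfl

/-- The algebra of bounded operators on bounded sequences. -/
abbrev SeqOp (𝕜 : Type*) [RCLike 𝕜] : Type _ := (ℕ →ᵇ 𝕜) →L[𝕜] (ℕ →ᵇ 𝕜)

/-- The geometric sequence `(qⁿ)`, for `‖q‖ < 1`. -/
def geoSeq (q : 𝕜) : ℕ →ᵇ 𝕜 := (Ring.inverse (1 - q • rshift) : SeqOp 𝕜) (deltaSeq 0)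

lemma isUnit_one_sub_rshift {q : 𝕜} (hq : ‖q‖ < 1) :
    IsUnit (1 - q • rshift : SeqOp 𝕜) := by
  refine isUnit_one_sub_of_norm_lt_one (R := SeqOp 𝕜) ?_
  rw [norm_smul]
  nlinarith [norm_rshift_le (𝕜 := 𝕜), norm_nonneg q,
    norm_nonneg (rshift : (ℕ →ᵇ 𝕜) →L[𝕜] (ℕ →ᵇ 𝕜))]

/-- Read entrywise, (1 − qS)x = δ₀ says x₀ = 1 and xₙ₊₁ = q xₙ. -/
lemma geoSeq_apply {q : 𝕜} (hq : ‖q‖ < 1) (n : ℕ) : geoSeq q n = q ^ n := by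
  have h : (1 - q • rshift : SeqOp 𝕜) (geoSeq q) = deltaSeq 0 := by
    have := Ring.mul_inverse_cancel _ (isUnit_one_sub_rshift hq)
    exact congr($this (deltaSeq 0))
  induction n with
  | zero => simpa using congr($h 0)
  | succ n ih =>
    have := congr($h (n + 1))
    simp only [_root_.sub_apply, one_apply_eq_self,
      _root_.smul_apply, BoundedContinuousFunction.sub_apply,
      BoundedContinuousFunction.smul_apply, rshift_succ, deltaSeq_apply, ih] at this
    rw [if_neg (Nat.succ_ne_zero n), sub_eq_zero] at this
    rw [this, pow_succ', smul_eq_mul]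

/-- The sequence is a resolvent of the shift applied to a fixed vector, and inversion is analytic.
This gives analyticity of all powers at once in the supremum norm, which analyticity of each entry
would not. -/
lemma contDiffAt_geoSeq {q : 𝕜} (hq : ‖q‖ < 1) : ContDiffAt 𝕜 ω (geoSeq : 𝕜 → ℕ →ᵇ 𝕜) q := by
  have h1 : ContDiffAt 𝕜 ω (fun q : 𝕜 => (1 - q • rshift : SeqOp 𝕜)) q := by
    fun_prop
  obtain ⟨u, hu⟩ := isUnit_one_sub_rshift hq
  have h2 : ContDiffAt 𝕜 ω Ring.inverse (1 - q • rshift : SeqOp 𝕜) := by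
    rw [← hu]; exact contDiffAt_ringInverse (R := SeqOp 𝕜) 𝕜 u
  exact (h2.comp q h1).clm_apply contDiffAt_const

/-- The polynomials with `V₀ = 0`, `V₁ = 1` and `Vₙ₊₂ = 2τ Vₙ₊₁ - η Vₙ`: for `w ∈ ℂ` with
`Re w = τ` and `|w|² = η` one has `Vₙ = Im wⁿ / Im w`. -/
def chebV (τ η : ℝ) : ℕ → ℝ
  | 0 => 0
  | 1 => 1
  | n + 2 => 2 * τ * chebV τ η (n + 1) - η * chebV τ η n

/-- The operator `1 - 2τS + ηS²`, for `S` the right shift. -/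
def chebOp (x : ℝ × ℝ) : SeqOp ℝ := 1 - ((2 * x.1) • rshift - x.2 • (rshift * rshift))

lemma contDiff_chebOp : ContDiff ℝ ω chebOp := by
  unfold chebOp
  fun_prop

/-- The sequence of the `Vₙ(τ, η)`, for small `(τ, η)`. -/
def chebSeq (x : ℝ × ℝ) : ℕ →ᵇ ℝ :=
  (Ring.inverse (chebOp x)) (deltaSeq 1)

lemma contDiffAt_chebSeq : ContDiffAt ℝ ω chebSeq 0 := by
  have h2 : ContDiffAt ℝ ω Ring.inverse (chebOp 0) := by
    rw [show chebOp 0 = ((1 : (SeqOp ℝ)ˣ) : SeqOp ℝ) by simp [chebOp]]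
    exact contDiffAt_ringInverse (R := SeqOp ℝ) ℝ 1
  exact (h2.comp 0 contDiff_chebOp.contDiffAt).clm_apply contDiffAt_const

/-- The three-term recursion is the entrywise form of (1 − 2τS + ηS²)V = δ₁, and the operator stays
invertible near (τ, η) = 0, where it is the identity. -/
lemma eventually_chebSeq : ∀ᶠ x in 𝓝 (0 : ℝ × ℝ), ∀ n, chebSeq x n = chebV x.1 x.2 n := by
  have h2 : ∀ᶠ x in 𝓝 (0 : ℝ × ℝ), IsUnit (chebOp x) := by
    refine contDiff_chebOp.continuous.continuousAt.eventually
      ((Units.isOpen (R := SeqOp ℝ)).mem_nhds ?_)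
    simp [chebOp]
  filter_upwards [h2] with x hx
  have h : chebOp x (chebSeq x) = deltaSeq 1 := by
    have := Ring.mul_inverse_cancel _ hx
    exact congr($this (deltaSeq 1))
  have h0 : chebSeq x 0 = 0 := by simpa [chebOp] using congr($h 0)
  have h3 (n : ℕ) : chebSeq x (n + 1) = 2 * x.1 * chebSeq x n - x.2 * (rshift (chebSeq x) n) +
      (if n = 0 then 1 else 0) := by
    have := congr($h (n + 1))
    simp only [chebOp, _root_.sub_apply, one_apply_eq_self,
      _root_.smul_apply, BoundedContinuousFunction.sub_apply, smul_eq_mul,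
      BoundedContinuousFunction.smul_apply, rshift_succ, deltaSeq_apply,
      mul_apply_eq_comp, Nat.add_eq_right] at this
    linarith
  have h4 (n : ℕ) : chebSeq x n = chebV x.1 x.2 n ∧
      chebSeq x (n + 1) = chebV x.1 x.2 (n + 1) := by
    induction n with
    | zero => exact ⟨by simp [h0, chebV], by rw [h3]; simp [h0, chebV]⟩
    | succ n ih => exact ⟨ih.2, by rw [h3, ih.2, rshift_succ, ih.1]; simp [chebV]⟩
  exact fun n => (h4 n).1

/-- The square root is an analytic function on the bounded sequences bounded away from zero. -/
lemma exists_analytic_sqrt {x₀ : ℕ →ᵇ ℝ} {δ : ℝ} (hδ : 0 < δ) (hx : ∀ n, δ ≤ x₀ n) :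
    ∃ R : (ℕ →ᵇ ℝ) → (ℕ →ᵇ ℝ), ContDiffAt ℝ ω R x₀ ∧
      ∀ᶠ x in 𝓝 x₀, ∀ n, R x n = √(x n) := by
  let y₀ : ℕ →ᵇ ℝ := ofNormedAddCommGroupDiscrete (fun n => √(x₀ n)) (√‖x₀‖) (fun n => by
    rw [Real.norm_of_nonneg (Real.sqrt_nonneg _)]
    exact Real.sqrt_le_sqrt (x₀.apply_le_norm n))
  let z₀ : ℕ →ᵇ ℝ := ofNormedAddCommGroupDiscrete (fun n => (2 * √(x₀ n))⁻¹) ((2 * √δ)⁻¹)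
    (fun n => by
      rw [Real.norm_of_nonneg (by positivity)]
      have := Real.sqrt_pos.2 hδ
      gcongr
      exact hx n)
  have hpos (n : ℕ) : 0 < √(x₀ n) := Real.sqrt_pos.2 (hδ.trans_le (hx n))
  have hyz : 2 * y₀ * z₀ = 1 := by
    ext n
    have := hpos n
    change 2 * √(x₀ n) * (2 * √(x₀ n))⁻¹ = 1
    field_simp
  have hyy : y₀ * y₀ = x₀ := by
    ext n
    exact Real.mul_self_sqrt (hδ.le.trans (hx n))
  -- The derivative of y ↦ y² at `y₀` is multiplication by `2 * y₀`; its inverse is multiplication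
  -- by `z₀`, bounded because `x₀` is bounded away from zero.
  let A : (ℕ →ᵇ ℝ) ≃L[ℝ] (ℕ →ᵇ ℝ) := ContinuousLinearEquiv.equivOfInverse
    (ContinuousLinearMap.mul ℝ (ℕ →ᵇ ℝ) (2 * y₀)) (ContinuousLinearMap.mul ℝ (ℕ →ᵇ ℝ) z₀)
    (fun f => by
      change z₀ * (2 * y₀ * f) = f
      rw [← mul_assoc, mul_comm z₀, hyz, one_mul])
    (fun f => by
      change 2 * y₀ * (z₀ * f) = f
      rw [← mul_assoc, hyz, one_mul])
  have hd : HasFDerivAt (fun y : ℕ →ᵇ ℝ => y * y - x₀) (A : (ℕ →ᵇ ℝ) →L[ℝ] (ℕ →ᵇ ℝ)) y₀ := by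
    have := ((hasFDerivAt_id (𝕜 := ℝ) y₀).mul (hasFDerivAt_id (𝕜 := ℝ) y₀)).sub_const x₀
    refine this.congr_fderiv ?_
    ext1 f
    change y₀ * f + y₀ * f = 2 * y₀ * f
    ring
  obtain ⟨R, hR0, hR, hR1, -⟩ := exists_analytic_implicit (x₀ := x₀) (y₀ := y₀)
    (f := fun v : (ℕ →ᵇ ℝ) × (ℕ →ᵇ ℝ) => v.2 * v.2 - v.1)
    (by fun_prop) A hd (by simp [hyy])
  refine ⟨R, hR, ?_⟩
  -- The implicit function only gives some square root. Staying within `√δ` of `y₀ ≥ √δ` excludes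
  -- negative entries.
  have hnear : ∀ᶠ x in 𝓝 x₀, ‖R x - y₀‖ < √δ := by
    have : Tendsto (fun x => ‖R x - y₀‖) (𝓝 x₀) (𝓝 0) := by
      simpa [hR0] using (hR.continuousAt.tendsto.sub_const y₀).norm
    exact this.eventually (gt_mem_nhds (Real.sqrt_pos.2 hδ))
  filter_upwards [hR1, hnear] with x h1 h2 n
  have h3 : R x n * R x n = x n := by
    have : R x n * R x n - x n = 0 := congr($h1 n)
    linarith
  have h4 : 0 ≤ R x n := by
    have h5 := ((R x - y₀).norm_coe_le_norm n).trans_lt h2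
    rw [BoundedContinuousFunction.sub_apply, Real.norm_eq_abs, abs_lt] at h5
    have h6 : √δ ≤ y₀ n := Real.sqrt_le_sqrt (hx n)
    linarith
  rw [← h3, Real.sqrt_mul_self h4]

end Seq

end

section

open Real

/-! ### The shape of the symbol -/

/-- The hyperbolic inequalities below are obtained by iterating this: differentiate, check that the
function vanishes at 0, and stop once positivity is evident. -/
lemma pos_of_hasDerivAt_pos {f f' : ℝ → ℝ} (h0 : f 0 = 0) (hd : ∀ x, HasDerivAt f (f' x) x)
    (hp : ∀ x, 0 < x → 0 < f' x) {x : ℝ} (hx : 0 < x) : 0 < f x := by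
  have h1 : StrictMonoOn f (Ici 0) := by
    refine strictMonoOn_of_deriv_pos (convex_Ici 0)
      (fun x _ => (hd x).continuousAt.continuousWithinAt) fun y hy => ?_
    rw [interior_Ici] at hy
    rw [(hd y).deriv]
    exact hp y hy
  rw [← h0]
  exact h1 (mem_Ici.2 le_rfl) (mem_Ici.2 hx.le) hx

lemma sq_le_two_mul_cosh_sub_one (y : ℝ) : y ^ 2 ≤ 2 * (cosh y - 1) := by
  have h1 : cosh y = 1 + 2 * sinh (y / 2) ^ 2 := by
    have := cosh_two_mul (y / 2)
    rw [cosh_sq, show 2 * (y / 2) = y by ring] at this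
    linarith
  have h2 : (y / 2) ^ 2 ≤ sinh (y / 2) ^ 2 := by
    rw [sq_le_sq, abs_sinh]
    exact self_le_sinh_iff.2 (abs_nonneg _)
  rw [h1]
  linarith

/-- This is `3 < critRatio y` with denominators cleared, hence the source of the bound T < 1/3. The
fourth derivative of the difference is visibly positive. -/
lemma cubic_lt_sinh {y : ℝ} (hy : 0 < y) :
    12 * (sinh y - y) < y ^ 2 * (sinh y + y) := by
  have d1 (x : ℝ) := hasDerivAt_sinh x
  have d2 (x : ℝ) := hasDerivAt_cosh x
  have d3 (x : ℝ) := hasDerivAt_id x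
  have d4 (x : ℝ) := (hasDerivAt_id x).pow 2
  have d5 (x : ℝ) := (hasDerivAt_id x).pow 3
  have h3 {x : ℝ} (hx : 0 < x) : 0 < -6 * cosh x + 6 * x * sinh x + x ^ 2 * cosh x + 6 := by
    refine pos_of_hasDerivAt_pos (f := fun x => -6 * cosh x + 6 * x * sinh x + x ^ 2 * cosh x + 6)
      (f' := fun x => 8 * x * cosh x + x ^ 2 * sinh x) (by simp) (fun x => ?_) (fun x hx => ?_) hx
    · have := ((((d2 x).const_mul (-6)).add (((d3 x).const_mul 6).mul (d1 x))).add
        ((d4 x).mul (d2 x))).add_const 6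
      refine this.congr_deriv ?_
      simp; ring
    · have := cosh_pos x
      have := sinh_pos_iff.2 hx
      positivity
  have h2 {x : ℝ} (hx : 0 < x) : 0 < -10 * sinh x + 4 * x * cosh x + x ^ 2 * sinh x + 6 * x := by
    refine pos_of_hasDerivAt_pos
      (f := fun x => -10 * sinh x + 4 * x * cosh x + x ^ 2 * sinh x + 6 * x)
      (by simp) (fun x => ?_) (fun x hx => h3 hx) hx
    have := ((((d1 x).const_mul (-10)).add (((d3 x).const_mul 4).mul (d2 x))).add
        ((d4 x).mul (d1 x))).add ((d3 x).const_mul 6)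
    refine this.congr_deriv ?_
    simp; ring
  have h1 {x : ℝ} (hx : 0 < x) :
      0 < 2 * x * sinh x + x ^ 2 * cosh x + 3 * x ^ 2 - 12 * cosh x + 12 := by
    refine pos_of_hasDerivAt_pos
      (f := fun x => 2 * x * sinh x + x ^ 2 * cosh x + 3 * x ^ 2 - 12 * cosh x + 12)
      (by simp) (fun x => ?_) (fun x hx => h2 hx) hx
    have := ((((((d3 x).const_mul 2).mul (d1 x)).add ((d4 x).mul (d2 x))).add
        ((d4 x).const_mul 3)).sub ((d2 x).const_mul 12)).add_const 12
    refine this.congr_deriv ?_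
    simp; ring
  have h0 : 0 < y ^ 2 * sinh y + y ^ 3 - 12 * sinh y + 12 * y := by
    refine pos_of_hasDerivAt_pos (f := fun x => x ^ 2 * sinh x + x ^ 3 - 12 * sinh x + 12 * x)
      (by simp) (fun x => ?_) (fun x hx => h1 hx) hy
    have := ((((d4 x).mul (d1 x)).add (d5 x)).sub ((d1 x).const_mul 12)).add ((d3 x).const_mul 12)
    refine this.congr_deriv ?_
    simp
  linarith

/-- At y = 2x this reads 2 sinh² x < x (sinh x cosh x + x), the form needed to show that the symbol
is below 1 on its decreasing branch. -/
lemma four_mul_cosh_lt {y : ℝ} (hy : 0 < y) : 4 * (cosh y - 1) < y * sinh y + y ^ 2 := by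
  have d1 (x : ℝ) := hasDerivAt_sinh x
  have d2 (x : ℝ) := hasDerivAt_cosh x
  have d3 (x : ℝ) := hasDerivAt_id x
  have d4 (x : ℝ) := (hasDerivAt_id x).pow 2
  have h3 {x : ℝ} (hx : 0 < x) : 0 < x * cosh x - sinh x := by
    refine pos_of_hasDerivAt_pos (f := fun x => x * cosh x - sinh x) (f' := fun x => x * sinh x)
      (by simp) (fun x => ?_) (fun x hx => mul_pos hx (sinh_pos_iff.2 hx)) hx
    refine (((d3 x).mul (d2 x)).sub (d1 x)).congr_deriv ?_
    simp
  have h2 {x : ℝ} (hx : 0 < x) : 0 < x * sinh x + 2 - 2 * cosh x := by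
    refine pos_of_hasDerivAt_pos (f := fun x => x * sinh x + 2 - 2 * cosh x)
      (by simp) (fun x => ?_) (fun x hx => h3 hx) hx
    refine ((((d3 x).mul (d1 x)).add_const 2).sub ((d2 x).const_mul 2)).congr_deriv ?_
    simp; ring
  have h1 {x : ℝ} (hx : 0 < x) : 0 < x * cosh x + 2 * x - 3 * sinh x := by
    refine pos_of_hasDerivAt_pos (f := fun x => x * cosh x + 2 * x - 3 * sinh x)
      (by simp) (fun x => ?_) (fun x hx => h2 hx) hx
    refine ((((d3 x).mul (d2 x)).add ((d3 x).const_mul 2)).sub ((d1 x).const_mul 3)).congr_deriv ?_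
    simp; ring
  have h0 : 0 < y * sinh y + y ^ 2 - 4 * cosh y + 4 := by
    refine pos_of_hasDerivAt_pos (f := fun x => x * sinh x + x ^ 2 - 4 * cosh x + 4)
      (by simp) (fun x => ?_) (fun x hx => h1 hx) hy
    refine (((((d3 x).mul (d1 x)).add (d4 x)).sub ((d2 x).const_mul 4)).add_const 4).congr_deriv ?_
    simp; ring
  linarith

/-- The difference of the two sides is, up to the factor 8y, the numerator of the derivative of
`critRatio`. It vanishes at 0 together with its first five derivatives; the sixth is bounded below
using cosh x − 1 ≥ x²/2 and x ≤ sinh x. -/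
lemma quartic_lt_sinh_sq {y : ℝ} (hy : 0 < y) :
    y ^ 2 + y ^ 2 * cosh y < sinh y ^ 2 + y * sinh y := by
  have d1 (x : ℝ) := hasDerivAt_sinh x
  have d2 (x : ℝ) := hasDerivAt_cosh x
  have d3 (x : ℝ) := hasDerivAt_id x
  have d4 (x : ℝ) := (hasDerivAt_id x).pow 2
  have d5 (x : ℝ) := (hasDerivAt_sinh x).pow 2
  have d6 (x : ℝ) := (hasDerivAt_cosh x).pow 2
  have h5 {x : ℝ} (hx : 0 < x) :
      0 < 32 * cosh x ^ 2 + 32 * sinh x ^ 2 - 24 * cosh x - 11 * x * sinh x - x ^ 2 * cosh x := by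
    have e1 := sq_le_two_mul_cosh_sub_one x
    have e2 : x * sinh x ≤ sinh x * sinh x :=
      mul_le_mul_of_nonneg_right (self_le_sinh_iff.2 hx.le) (sinh_pos_iff.2 hx).le
    have e3 := one_le_cosh x
    have e4 := cosh_sq x
    have e5 := mul_le_mul_of_nonneg_right e1 (zero_le_one.trans e3)
    nlinarith
  have h4 {x : ℝ} (hx : 0 < x) :
      0 < 32 * (sinh x * cosh x) - 15 * sinh x - 9 * x * cosh x - x ^ 2 * sinh x := by
    refine pos_of_hasDerivAt_pos
      (f := fun x => 32 * (sinh x * cosh x) - 15 * sinh x - 9 * x * cosh x - x ^ 2 * sinh x)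
      (by simp) (fun x => ?_) (fun x hx => h5 hx) hx
    refine ((((((d1 x).mul (d2 x)).const_mul 32).sub ((d1 x).const_mul 15)).sub
      (((d3 x).const_mul 9).mul (d2 x))).sub ((d4 x).mul (d1 x))).congr_deriv ?_
    simp; ring
  have h3 {x : ℝ} (hx : 0 < x) :
      0 < 8 * cosh x ^ 2 + 8 * sinh x ^ 2 - 8 * cosh x - 7 * x * sinh x - x ^ 2 * cosh x := by
    refine pos_of_hasDerivAt_pos (f := fun x =>
      8 * cosh x ^ 2 + 8 * sinh x ^ 2 - 8 * cosh x - 7 * x * sinh x - x ^ 2 * cosh x)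
      (by simp) (fun x => ?_) (fun x hx => h4 hx) hx
    refine ((((((d6 x).const_mul 8).add ((d5 x).const_mul 8)).sub ((d2 x).const_mul 8)).sub
      (((d3 x).const_mul 7).mul (d1 x))).sub ((d4 x).mul (d2 x))).congr_deriv ?_
    simp; ring
  have h2 {x : ℝ} (hx : 0 < x) :
      0 < 8 * (sinh x * cosh x) - 3 * sinh x - 5 * x * cosh x - x ^ 2 * sinh x := by
    refine pos_of_hasDerivAt_pos
      (f := fun x => 8 * (sinh x * cosh x) - 3 * sinh x - 5 * x * cosh x - x ^ 2 * sinh x)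
      (by simp) (fun x => ?_) (fun x hx => h3 hx) hx
    refine ((((((d1 x).mul (d2 x)).const_mul 8).sub ((d1 x).const_mul 3)).sub
      (((d3 x).const_mul 5).mul (d2 x))).sub ((d4 x).mul (d1 x))).congr_deriv ?_
    simp; ring
  have h1 {x : ℝ} (hx : 0 < x) :
      0 < 4 * sinh x ^ 2 - 3 * x * sinh x - x ^ 2 * cosh x := by
    refine pos_of_hasDerivAt_pos
      (f := fun x => 4 * sinh x ^ 2 - 3 * x * sinh x - x ^ 2 * cosh x)
      (by simp) (fun x => ?_) (fun x hx => h2 hx) hx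
    refine ((((d5 x).const_mul 4).sub
      (((d3 x).const_mul 3).mul (d1 x))).sub ((d4 x).mul (d2 x))).congr_deriv ?_
    simp; ring
  have h0 {x : ℝ} (hx : 0 < x) :
      0 < 2 * (sinh x * cosh x) - 2 * x + sinh x - x * cosh x - x ^ 2 * sinh x := by
    refine pos_of_hasDerivAt_pos
      (f := fun x => 2 * (sinh x * cosh x) - 2 * x + sinh x - x * cosh x - x ^ 2 * sinh x)
      (by simp) (fun x => ?_) (fun x hx => h1 hx) hx
    refine (((((((d1 x).mul (d2 x)).const_mul 2).sub ((d3 x).const_mul 2)).add (d1 x)).sub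
      ((d3 x).mul (d2 x))).sub ((d4 x).mul (d1 x))).congr_deriv ?_
    have := cosh_sq x
    simp only [id_eq, Nat.cast_ofNat, Nat.add_one_sub_one, pow_one, mul_one, Pi.pow_apply]
    linear_combination 2 * this
  have h : 0 < sinh y ^ 2 - y ^ 2 + y * sinh y - y ^ 2 * cosh y := by
    refine pos_of_hasDerivAt_pos
      (f := fun x => sinh x ^ 2 - x ^ 2 + x * sinh x - x ^ 2 * cosh x)
      (by simp) (fun x => ?_) (fun x hx => h0 hx) hy
    refine ((((d5 x).sub (d4 x)).add ((d3 x).mul (d1 x))).sub ((d4 x).mul (d2 x))).congr_deriv ?_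
    simp; ring
  linarith

/-- The function `y² (sinh y + y) / (4 (sinh y - y))`; the symbol is decreasing in `ξ` where
`T · critRatio (2ξ) < 1`, and increasing where it is `> 1`. -/
def critRatio (y : ℝ) : ℝ := y ^ 2 * (sinh y + y) / (4 * (sinh y - y))

lemma strictMonoOn_critRatio : StrictMonoOn critRatio (Ioi 0) := by
  have hpos {y : ℝ} (hy : 0 < y) : 0 < sinh y - y := sub_pos.2 (self_lt_sinh_iff.2 hy)
  have hd {y : ℝ} (hy : 0 < y) := ((((hasDerivAt_id y).pow 2).mul
    ((hasDerivAt_sinh y).add (hasDerivAt_id y))).div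
    (((hasDerivAt_sinh y).sub (hasDerivAt_id y)).const_mul 4)
    (mul_pos four_pos (hpos hy)).ne')
  refine strictMonoOn_of_deriv_pos (convex_Ioi 0)
    (fun y hy => (hd hy).continuousAt.continuousWithinAt) fun y hy => ?_
  rw [interior_Ioi] at hy
  have hy : 0 < y := hy
  have h1 := (hd hy).deriv
  have h2 : deriv critRatio y = _ := h1
  rw [h2]
  refine div_pos ?_ (by have := hpos hy; simp only [Pi.sub_apply, id_eq]; positivity)
  have h3 := quartic_lt_sinh_sq hy
  simp only [id_eq, Nat.cast_ofNat, Nat.add_one_sub_one, pow_one, mul_one, Pi.pow_apply,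
    Pi.sub_apply, Pi.add_apply, Pi.mul_apply]
  -- The numerator of the quotient rule simplifies to 8y (sinh² y + y sinh y − y² − y² cosh y).
  have h4 := mul_pos (mul_pos (show (0 : ℝ) < 8 by norm_num) hy) (sub_pos.2 h3)
  nlinarith

lemma three_lt_critRatio {y : ℝ} (hy : 0 < y) : 3 < critRatio y := by
  have h : 0 < sinh y - y := sub_pos.2 (self_lt_sinh_iff.2 hy)
  rw [critRatio, lt_div_iff₀ (by positivity)]
  linarith [cubic_lt_sinh hy]

/-- The square of the symbol, away from the origin. -/
def mSq (T ξ : ℝ) : ℝ := (1 + T * ξ ^ 2) * tanh ξ / ξ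

lemma m_eq_sqrt {T ξ : ℝ} (h : ξ ≠ 0) : m T ξ = √(mSq T ξ) := if_neg h

lemma mSq_pos {T ξ : ℝ} (hT : 0 < T) (hξ : 0 < ξ) : 0 < mSq T ξ := by
  have : 0 < tanh ξ := by
    rw [tanh_eq_sinh_div_cosh]
    exact div_pos (sinh_pos_iff.2 hξ) (cosh_pos _)
  unfold mSq
  positivity

/-- The double-angle formula lets the numerator of the quotient rule factor through `critRatio (2 *
ξ)`. All other factors are positive, so the sign of the derivative is that of T · critRatio(2ξ) − 1.
-/
lemma hasDerivAt_mSq {T ξ : ℝ} (hξ : 0 < ξ) :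
    HasDerivAt (mSq T) ((sinh (2 * ξ) - 2 * ξ) * (T * critRatio (2 * ξ) - 1) /
      (2 * (ξ * cosh ξ) ^ 2)) ξ := by
  have hc := (cosh_pos ξ).ne'
  have h : HasDerivAt (fun ξ => (1 + T * ξ ^ 2) * sinh ξ / (ξ * cosh ξ))
      (((T * (2 * ξ) * sinh ξ + (1 + T * ξ ^ 2) * cosh ξ) * (ξ * cosh ξ) -
        (1 + T * ξ ^ 2) * sinh ξ * (1 * cosh ξ + ξ * sinh ξ)) / (ξ * cosh ξ) ^ 2) ξ := by
    refine HasDerivAt.div (HasDerivAt.mul ?_ (hasDerivAt_sinh ξ))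
      ((hasDerivAt_id ξ).mul (hasDerivAt_cosh ξ)) (mul_ne_zero hξ.ne' hc)
    simpa using (((hasDerivAt_id ξ).pow 2).const_mul T).const_add 1
  have e : mSq T = fun ξ => (1 + T * ξ ^ 2) * sinh ξ / (ξ * cosh ξ) := by
    funext x
    rw [mSq, tanh_eq_sinh_div_cosh, mul_div_assoc', div_div, mul_comm (cosh x)]
  rw [e]
  refine h.congr_deriv ?_
  have h1 : 0 < sinh (2 * ξ) - 2 * ξ := sub_pos.2 (self_lt_sinh_iff.2 (by positivity))
  have h2 : (sinh (2 * ξ) - 2 * ξ) * (T * critRatio (2 * ξ) - 1) =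
      T * ξ ^ 2 * (sinh (2 * ξ) + 2 * ξ) - (sinh (2 * ξ) - 2 * ξ) := by
    rw [critRatio]
    field_simp
    ring
  rw [h2, sinh_two_mul, ← div_div]
  congr 1
  linear_combination (ξ + T * ξ ^ 3) * cosh_sq ξ

lemma hasDerivAt_m {T ξ : ℝ} (hT : 0 < T) (hξ : 0 < ξ) :
    HasDerivAt (m T) ((sinh (2 * ξ) - 2 * ξ) * (T * critRatio (2 * ξ) - 1) /
      (2 * (ξ * cosh ξ) ^ 2) / (2 * √(mSq T ξ))) ξ := by
  refine ((hasDerivAt_mSq hξ).sqrt (mSq_pos hT hξ).ne').congr_of_eventuallyEq ?_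
  filter_upwards [lt_mem_nhds hξ] with x hx
  exact m_eq_sqrt hx.ne'

/-- If the symbol takes the same value twice on the positive half-line, it is decreasing up to some
point and increasing from there on. -/
lemma exists_critical_point {T x y : ℝ} (hT : 0 < T) (hx : 0 < x) (hxy : x < y)
    (h : m T x = m T y) : ∃ ξ, x < ξ ∧ ξ < y ∧ T * critRatio (2 * ξ) = 1 := by
  have hpos {z : ℝ} (hz : z ∈ Icc x y) : 0 < z := hx.trans_le hz.1
  have hpos' {z : ℝ} (hz : z ∈ Ioo x y) : 0 < z := hx.trans hz.1
  -- By Rolle's theorem the derivative vanishes somewhere, and only the factor with `critRatio` can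
  -- vanish.
  obtain ⟨ξ, hξ, hξ'⟩ := exists_hasDerivAt_eq_zero hxy
    (fun z hz => (hasDerivAt_m hT (hpos hz)).continuousAt.continuousWithinAt) h
    (fun z hz => hasDerivAt_m hT (hpos' hz))
  refine ⟨ξ, hξ.1, hξ.2, ?_⟩
  have h0 := hpos' hξ
  have h1 : 0 < sinh (2 * ξ) - 2 * ξ := sub_pos.2 (self_lt_sinh_iff.2 (by positivity))
  have h2 := sqrt_pos.2 (mSq_pos hT h0)
  have h3 := cosh_pos ξ
  rw [div_eq_zero_iff, div_eq_zero_iff, mul_eq_zero] at hξ'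
  rcases hξ' with ((h4 | h4) | h4) | h4
  · exact absurd h4 h1.ne'
  · linarith
  · exact absurd h4 (by positivity)
  · exact absurd h4 (by positivity)

lemma deriv_m_neg {T ξ x : ℝ} (hT : 0 < T) (hξ : T * critRatio (2 * ξ) = 1) (hx : 0 < x)
    (hxξ : x < ξ) : deriv (m T) x < 0 := by
  rw [(hasDerivAt_m hT hx).deriv]
  have h1 : 0 < sinh (2 * x) - 2 * x := sub_pos.2 (self_lt_sinh_iff.2 (by positivity))
  have h2 := sqrt_pos.2 (mSq_pos hT hx)
  have h3 := cosh_pos x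
  have h4 : critRatio (2 * x) < critRatio (2 * ξ) := strictMonoOn_critRatio
    (by simpa using hx) (by simpa using hx.trans hxξ) (by linarith)
  have h5 : T * critRatio (2 * x) - 1 < 0 := by nlinarith
  exact div_neg_of_neg_of_pos (div_neg_of_neg_of_pos (mul_neg_of_pos_of_neg h1 h5)
    (by positivity)) (by positivity)

lemma deriv_m_pos {T ξ x : ℝ} (hT : 0 < T) (hξ : T * critRatio (2 * ξ) = 1) (hξ0 : 0 < ξ)
    (hxξ : ξ < x) : 0 < deriv (m T) x := by
  have hx := hξ0.trans hxξ
  rw [(hasDerivAt_m hT hx).deriv]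
  have h1 : 0 < sinh (2 * x) - 2 * x := sub_pos.2 (self_lt_sinh_iff.2 (by positivity))
  have h2 := sqrt_pos.2 (mSq_pos hT hx)
  have h3 := cosh_pos x
  have h4 : critRatio (2 * ξ) < critRatio (2 * x) := strictMonoOn_critRatio
    (by simpa using hξ0) (by simpa using hx) (by linarith)
  have h5 : 0 < T * critRatio (2 * x) - 1 := by nlinarith
  positivity

lemma continuousOn_m {T : ℝ} (hT : 0 < T) : ContinuousOn (m T) (Ioi 0) :=
  fun _ hx => (hasDerivAt_m hT hx).continuousAt.continuousWithinAt

lemma strictAntiOn_m {T ξ : ℝ} (hT : 0 < T) (hξ : T * critRatio (2 * ξ) = 1) :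
    StrictAntiOn (m T) (Ioc 0 ξ) := by
  refine strictAntiOn_of_deriv_neg (convex_Ioc 0 ξ)
    ((continuousOn_m hT).mono fun x hx => hx.1) fun x hx => ?_
  rw [interior_Ioc] at hx
  exact deriv_m_neg hT hξ hx.1 hx.2

lemma strictMonoOn_m {T ξ : ℝ} (hT : 0 < T) (hξ : T * critRatio (2 * ξ) = 1) (hξ0 : 0 < ξ) :
    StrictMonoOn (m T) (Ici ξ) := by
  refine strictMonoOn_of_deriv_pos (convex_Ici ξ)
    ((continuousOn_m hT).mono fun x hx => hξ0.trans_le hx) fun x hx => ?_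
  rw [interior_Ici] at hx
  exact deriv_m_pos hT hξ hξ0 hx

lemma lt_one_third_of_critical {T ξ : ℝ} (hT : 0 < T) (hξ : T * critRatio (2 * ξ) = 1)
    (hξ0 : 0 < ξ) : T < 1 / 3 := by
  have := three_lt_critRatio (y := 2 * ξ) (by positivity)
  nlinarith

/-- Left of the critical point T · critRatio(2x) < 1, that is 1 + Tx² < 2 sinh x cosh x / (sinh x
cosh x + x). Multiplying by sinh x / (x cosh x) leaves 2 sinh² x / (x (sinh x cosh x + x)), which is
below 1 by `four_mul_cosh_lt`. -/
lemma m_lt_one {T ξ x : ℝ} (hT : 0 < T) (hξ : T * critRatio (2 * ξ) = 1) (hx : 0 < x)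
    (hxξ : x < ξ) : m T x < 1 := by
  rw [m_eq_sqrt hx.ne', sqrt_lt' one_pos, one_pow, mSq, tanh_eq_sinh_div_cosh, mul_div_assoc',
    div_div, div_lt_one (by have := cosh_pos x; positivity)]
  have h1 : 0 < sinh (2 * x) - 2 * x := sub_pos.2 (self_lt_sinh_iff.2 (by positivity))
  have h4 : critRatio (2 * x) < critRatio (2 * ξ) := strictMonoOn_critRatio
    (by simpa using hx) (by simpa using hx.trans hxξ) (by linarith)
  have h5 : T * critRatio (2 * x) < 1 := by nlinarith
  rw [critRatio, mul_div_assoc', div_lt_one (by positivity)] at h5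
  have h6 := four_mul_cosh_lt (y := 2 * x) (by positivity)
  have hS := sinh_pos_iff.2 hx
  have hC := cosh_pos x
  rw [sinh_two_mul] at h5 h6
  rw [cosh_two_mul, cosh_sq] at h6
  have h7 : T * x ^ 2 * (sinh x * cosh x + x) < sinh x * cosh x - x := by nlinarith
  have h8 : 2 * sinh x ^ 2 < x * (sinh x * cosh x + x) := by nlinarith
  have h9 : 0 < sinh x * cosh x + x := by positivity
  have h10 : (1 + T * x ^ 2) * (sinh x * cosh x + x) < 2 * (sinh x * cosh x) := by nlinarith
  have h11 : (1 + T * x ^ 2) * sinh x * (sinh x * cosh x + x) <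
      cosh x * x * (sinh x * cosh x + x) := by
    have e1 := mul_lt_mul_of_pos_left h10 hS
    have e2 := mul_lt_mul_of_pos_left h8 hC
    nlinarith
  exact lt_of_mul_lt_mul_right h11 h9.le

/-- For given `0 < a < b` there is at most one `κ` with `m_T(κ a) = m_T(κ b)`. -/
lemma eq_of_m_eq {T a b κ κ' : ℝ} (hT : 0 < T) (ha : 0 < a) (hab : a < b) (hκ : 0 < κ)
    (hκ' : 0 < κ') (h : m T (κ * a) = m T (κ * b)) (h' : m T (κ' * a) = m T (κ' * b)) :
    κ = κ' := by
  wlog hlt : κ < κ' generalizing κ κ'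
  · rcases (not_lt.1 hlt).eq_or_lt with e | e
    · exact e.symm
    · exact (this hκ' hκ h' h e).symm
  obtain ⟨ξ, h1, h2, h3⟩ := exists_critical_point hT (mul_pos hκ ha)
    (mul_lt_mul_of_pos_left hab hκ) h
  obtain ⟨ξ', h1', h2', h3'⟩ := exists_critical_point hT (mul_pos hκ' ha)
    (mul_lt_mul_of_pos_left hab hκ') h'
  have hξ : 0 < ξ := (mul_pos hκ ha).trans h1
  have hξ' : 0 < ξ' := (mul_pos hκ' ha).trans h1'
  have e : 2 * ξ = 2 * ξ' := strictMonoOn_critRatio.injOn (by simpa using hξ) (by simpa using hξ')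
    (mul_left_cancel₀ hT.ne' (h3.trans h3'.symm))
  have e' : ξ = ξ' := by linarith
  subst e'
  -- Both pairs straddle the same critical point, so raising κ to κ' lowers the value at κa and
  -- raises the value at κb; equality cannot hold twice.
  have l1 := strictAntiOn_m hT h3 ⟨mul_pos hκ ha, h1.le⟩ ⟨mul_pos hκ' ha, h1'.le⟩
    (mul_lt_mul_of_pos_right hlt ha)
  have l2 := strictMonoOn_m hT h3 hξ (mem_Ici.2 h2.le) (mem_Ici.2 h2'.le)
    (mul_lt_mul_of_pos_right hlt (ha.trans hab))
  linarith

end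

section

open Filter Topology BoundedContinuousFunction

/-! ### The multiplier `(c - M_{T,κ})⁻¹ P_W` as an analytic family of bounded sequences -/

lemma m_zero (T : ℝ) : m T 0 = 1 := if_pos rfl

lemma m_neg (T ξ : ℝ) : m T (-ξ) = m T ξ := by
  by_cases h : ξ = 0
  · simp [h]
  · rw [m, m, if_neg h, if_neg (neg_ne_zero.2 h), Real.tanh_neg]
    congr 1
    field_simp

lemma m_natAbs (T κ : ℝ) (k : ℤ) : m T (κ * (k.natAbs : ℝ)) = m T (κ * k) := by
  rcases Int.natAbs_eq k with h | h
  · conv_rhs => rw [h]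
    simp
  · conv_rhs => rw [h]
    rw [Int.cast_neg, mul_neg, m_neg]
    simp

lemma Seq.isUnit_of_le {f : ℕ →ᵇ ℝ} {δ : ℝ} (hδ : 0 < δ) (hf : ∀ n, δ ≤ |f n|) : IsUnit f := by
  let g : ℕ →ᵇ ℝ := ofNormedAddCommGroupDiscrete (fun n => (f n)⁻¹) δ⁻¹ (fun n => by
    rw [norm_inv]
    exact inv_anti₀ hδ (hf n))
  refine IsUnit.of_mul_eq_one g ?_
  ext n
  have h : f n ≠ 0 := abs_pos.1 (hδ.trans_le (hf n))
  exact mul_inv_cancel₀ h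

lemma Seq.inverse_apply {f : ℕ →ᵇ ℝ} (hf : IsUnit f) (n : ℕ) : Ring.inverse f n = (f n)⁻¹ := by
  have h : f n * Ring.inverse f n = 1 := congr($(Ring.mul_inverse_cancel f hf) n)
  exact eq_inv_of_mul_eq_one_right h

lemma Seq.contDiffAt_inverse {f : ℕ →ᵇ ℝ} (hf : IsUnit f) :
    ContDiffAt ℝ ω (Ring.inverse : (ℕ →ᵇ ℝ) → ℕ →ᵇ ℝ) f := by
  obtain ⟨u, rfl⟩ := hf
  exact contDiffAt_ringInverse ℝ u

lemma Seq.eventually_isUnit {f : ℕ →ᵇ ℝ} (hf : IsUnit f) : ∀ᶠ g in 𝓝 f, IsUnit g :=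
  (Units.isOpen (R := ℕ →ᵇ ℝ)).mem_nhds hf

/-- The weights `k^{-1/2}` (and `1` for `k = 0`). -/
def wSeq : ℕ →ᵇ ℝ :=
  ofNormedAddCommGroupDiscrete (fun k => if k = 0 then 1 else (√(k : ℝ))⁻¹) 1 (fun k => by
    split_ifs with h
    · simp
    · rw [norm_inv, Real.norm_of_nonneg (Real.sqrt_nonneg _)]
      refine inv_le_one_of_one_le₀ (Real.one_le_sqrt.2 ?_)
      exact_mod_cast Nat.one_le_iff_ne_zero.2 h)

lemma wSeq_apply (k : ℕ) : wSeq k = if k = 0 then 1 else (√(k : ℝ))⁻¹ := rfl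

lemma wSeq_pos (k : ℕ) : 0 < wSeq k := by
  rw [wSeq_apply]
  split_ifs with h
  · exact one_pos
  · have : (0 : ℝ) < k := by exact_mod_cast Nat.pos_of_ne_zero h
    positivity

lemma tendsto_wSeq : Tendsto wSeq atTop (𝓝 0) := by
  have h := (Real.tendsto_sqrt_atTop.comp tendsto_natCast_atTop_atTop).inv_tendsto_atTop
  refine h.congr' ?_
  filter_upwards [eventually_ne_atTop 0] with k hk
  exact (if_neg hk).symm

/-- The sequence `k⁻²` (and `0` for `k = 0`). -/
def invSqSeq : ℕ →ᵇ ℝ :=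
  ofNormedAddCommGroupDiscrete (fun k => ((k : ℝ) ^ 2)⁻¹) 1 (fun k => by
    rw [norm_inv, Real.norm_of_nonneg (by positivity)]
    rcases Nat.eq_zero_or_pos k with h | h
    · simp [h]
    · refine inv_le_one_of_one_le₀ (one_le_pow₀ ?_)
      exact_mod_cast h)

/-- The sequence `tanh (κ k)`, for `κ > 0`. -/
def tanhSeq (κ : ℝ) : ℕ →ᵇ ℝ :=
  (1 - geoSeq (Real.exp (-2 * κ))) * Ring.inverse (1 + geoSeq (Real.exp (-2 * κ)))

lemma norm_exp_lt_one {κ : ℝ} (h : 0 < κ) : ‖Real.exp (-2 * κ)‖ < 1 := by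
  rw [Real.norm_of_nonneg (Real.exp_pos _).le, Real.exp_lt_one_iff]
  linarith

lemma isUnit_one_add_geoSeq {κ : ℝ} (h : 0 < κ) :
    IsUnit (1 + geoSeq (Real.exp (-2 * κ)) : ℕ →ᵇ ℝ) := by
  refine Seq.isUnit_of_le one_pos fun n => ?_
  have e : (1 + geoSeq (Real.exp (-2 * κ)) : ℕ →ᵇ ℝ) n = 1 + Real.exp (-2 * κ) ^ n := by
    rw [← geoSeq_apply (norm_exp_lt_one h)]
    rfl
  have := pow_pos (Real.exp_pos (-2 * κ)) n
  rw [e, abs_of_pos (by positivity)]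
  linarith

lemma tanhSeq_eq {κ : ℝ} (h : 0 < κ) (n : ℕ) :
    tanhSeq κ n = (1 - Real.exp (-2 * κ) ^ n) * (1 + Real.exp (-2 * κ) ^ n)⁻¹ := by
  have e1 : (1 + geoSeq (Real.exp (-2 * κ)) : ℕ →ᵇ ℝ) n = 1 + Real.exp (-2 * κ) ^ n := by
    rw [← geoSeq_apply (norm_exp_lt_one h)]
    rfl
  have e2 : (1 - geoSeq (Real.exp (-2 * κ)) : ℕ →ᵇ ℝ) n = 1 - Real.exp (-2 * κ) ^ n := by
    rw [← geoSeq_apply (norm_exp_lt_one h)]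
    rfl
  rw [tanhSeq, BoundedContinuousFunction.mul_apply, Seq.inverse_apply (isUnit_one_add_geoSeq h),
    e1, e2]

/-- With q = e^{-2κ} one has tanh(κn) = (1 − qⁿ)/(1 + qⁿ), which reduces uniform analyticity in κ to
that of the geometric sequence. -/
lemma tanhSeq_apply {κ : ℝ} (h : 0 < κ) (n : ℕ) : tanhSeq κ n = Real.tanh (κ * n) := by
  rw [tanhSeq_eq h, ← Real.exp_nat_mul, Real.tanh_eq, ← div_eq_mul_inv]
  have e1 : Real.exp (n * (-2 * κ)) = Real.exp (-(κ * n)) * Real.exp (-(κ * n)) := by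
    rw [← Real.exp_add]; ring_nf
  have e2 : Real.exp (κ * n) = (Real.exp (-(κ * n)))⁻¹ := by rw [← Real.exp_neg, neg_neg]
  have := Real.exp_pos (-(κ * n))
  rw [e1, e2]
  field_simp

lemma contDiffAt_tanhSeq {κ : ℝ} (h : 0 < κ) : ContDiffAt ℝ ω tanhSeq κ := by
  have h0 : ContDiffAt ℝ ω (fun κ : ℝ => Real.exp (-2 * κ)) κ := by fun_prop
  have h1 : ContDiffAt ℝ ω (fun κ : ℝ => (geoSeq (Real.exp (-2 * κ)) : ℕ →ᵇ ℝ)) κ :=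
    ContDiffAt.comp (g := geoSeq) κ (contDiffAt_geoSeq (norm_exp_lt_one h)) h0
  have h2 : ContDiffAt ℝ ω (fun κ : ℝ => (1 + geoSeq (Real.exp (-2 * κ)) : ℕ →ᵇ ℝ)) κ :=
    contDiffAt_const.add h1
  exact (contDiffAt_const.sub h1).mul
    (ContDiffAt.comp (g := Ring.inverse) κ (Seq.contDiffAt_inverse (isUnit_one_add_geoSeq h)) h2)

/-- The sequence `m_T(κ k)² / k` (and `1` for `k = 0`), as a function of `(κ, T)`. -/
def mSqSeq (x : ℝ × ℝ) : ℕ →ᵇ ℝ :=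
  deltaSeq 0 + ((x.2 * x.1) • (1 : ℕ →ᵇ ℝ) + x.1⁻¹ • invSqSeq) * tanhSeq x.1

lemma mSqSeq_zero {κ T : ℝ} (hκ : 0 < κ) : mSqSeq (κ, T) 0 = 1 := by
  have h : tanhSeq κ 0 = 0 := by rw [tanhSeq_apply hκ]; simp
  simp [mSqSeq, h]

lemma mSqSeq_of_pos {κ T : ℝ} (hκ : 0 < κ) {k : ℕ} (hk : 0 < k) :
    mSqSeq (κ, T) k = (T * κ + κ⁻¹ * ((k : ℝ) ^ 2)⁻¹) * Real.tanh (κ * k) := by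
  rw [← tanhSeq_apply hκ]
  have : mSqSeq (κ, T) k =
      (if k = 0 then 1 else 0) + ((T * κ) * 1 + κ⁻¹ * ((k : ℝ) ^ 2)⁻¹) * tanhSeq κ k := rfl
  rw [this, if_neg hk.ne', zero_add, mul_one]

/-- The symbol grows like √k. The weight makes the sequence bounded, and also bounded away from
zero, so that the analytic square root applies to it. -/
lemma sqrt_mSqSeq {κ T : ℝ} (hκ : 0 < κ) (k : ℕ) :
    √(mSqSeq (κ, T) k) = wSeq k * m T (κ * k) := by
  rcases Nat.eq_zero_or_pos k with rfl | hk
  · simp [mSqSeq_zero hκ, wSeq_apply, m_zero]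
  · have hk' : (0 : ℝ) < k := by exact_mod_cast hk
    rw [wSeq_apply, if_neg hk.ne', m_eq_sqrt (by positivity), ← Real.sqrt_inv,
      ← Real.sqrt_mul (by positivity), mSqSeq_of_pos hκ hk, mSq]
    congr 1
    field_simp
    ring

/-- For k ≥ 1, drop the nonnegative term with k⁻² and bound tanh(κk) = (1 − qᵏ)/(1 + qᵏ) below by (1
− q)/2, where q = e^{-2κ} < 1. -/
lemma exists_le_mSqSeq {κ T : ℝ} (hκ : 0 < κ) (hT : 0 < T) :
    ∃ δ > 0, ∀ k, δ ≤ mSqSeq (κ, T) k := by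
  have h1 : 0 < 1 - Real.exp (-2 * κ) := by
    have := norm_exp_lt_one hκ
    rw [Real.norm_of_nonneg (Real.exp_pos _).le] at this
    linarith
  refine ⟨min 1 (T * κ * ((1 - Real.exp (-2 * κ)) / 2)), by positivity, fun k => ?_⟩
  rcases Nat.eq_zero_or_pos k with rfl | hk
  · rw [mSqSeq_zero hκ]
    exact min_le_left _ _
  · refine (min_le_right _ _).trans ?_
    rw [mSqSeq_of_pos hκ hk, ← tanhSeq_apply hκ, tanhSeq_eq hκ]
    have h2 := Real.exp_pos (-2 * κ)
    have h3 : Real.exp (-2 * κ) ^ k ≤ Real.exp (-2 * κ) :=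
      pow_le_of_le_one h2.le (by linarith) hk.ne'
    have h4 := pow_pos h2 k
    have h5 : (0 : ℝ) ≤ κ⁻¹ * ((k : ℝ) ^ 2)⁻¹ := by positivity
    rw [← div_eq_mul_inv (1 - _)]
    refine mul_le_mul (by linarith) ?_ (by positivity) (by positivity)
    exact div_le_div₀ (by linarith) (by linarith) (by linarith) (by linarith)

lemma contDiffAt_mSqSeq {x : ℝ × ℝ} (hκ : 0 < x.1) : ContDiffAt ℝ ω mSqSeq x := by
  have h1 : ContDiffAt ℝ ω (fun x : ℝ × ℝ => tanhSeq x.1) x :=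
    (contDiffAt_tanhSeq hκ).comp x contDiffAt_fst
  have h2 : ContDiffAt ℝ ω (fun x : ℝ × ℝ => x.1⁻¹) x := contDiffAt_fst.inv hκ.ne'
  unfold mSqSeq
  exact contDiffAt_const.add ((((contDiffAt_snd.mul contDiffAt_fst).smul contDiffAt_const).add
    (h2.smul contDiffAt_const)).mul h1)

/-- The sequence `m_T(κ k) / √k` depends analytically on `(κ, T)`. -/
lemma exists_analytic_symbolSeq {x₀ : ℝ × ℝ} (hκ : 0 < x₀.1) (hT : 0 < x₀.2) :
    ∃ Y : ℝ × ℝ → ℕ →ᵇ ℝ, ContDiffAt ℝ ω Y x₀ ∧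
      ∀ᶠ x in 𝓝 x₀, ∀ k : ℕ, Y x k = wSeq k * m x.2 (x.1 * k) := by
  obtain ⟨δ, hδ, hle⟩ := exists_le_mSqSeq hκ hT
  obtain ⟨R, hR, hR'⟩ := exists_analytic_sqrt hδ hle
  have h1 := contDiffAt_mSqSeq hκ
  refine ⟨fun x => R (mSqSeq x), hR.comp x₀ h1, ?_⟩
  filter_upwards [h1.continuousAt.eventually hR', (continuousAt_fst (p := x₀)).eventually
    (lt_mem_nhds hκ)] with x hx hx' k
  rw [hx, sqrt_mSqSeq hx']

lemma _root_.ContDiffAt.bcf_apply {E F ι : Type*} [NormedAddCommGroup E] [NormedSpace ℝ E]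
    [NormedAddCommGroup F] [NormedSpace ℝ F] [TopologicalSpace ι] {f : E → ι →ᵇ F} {x : E}
    (hf : ContDiffAt ℝ ω f x) (i : ι) : ContDiffAt ℝ ω (fun y => f y i) x :=
  (BoundedContinuousFunction.evalCLM (β := F) ℝ i).contDiff.contDiffAt.comp x hf

/-- For fixed `k`, the symbol `m_T(κ k)` depends analytically on `(κ, T)`. -/
lemma contDiffAt_m {x₀ : ℝ × ℝ} (hκ : 0 < x₀.1) (hT : 0 < x₀.2) (k : ℕ) :
    ContDiffAt ℝ ω (fun x : ℝ × ℝ => m x.2 (x.1 * k)) x₀ := by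
  obtain ⟨Y, hY, hY'⟩ := exists_analytic_symbolSeq hκ hT
  have h1 : ContDiffAt ℝ ω (fun x => (wSeq k)⁻¹ * Y x k) x₀ :=
    contDiffAt_const.mul (hY.bcf_apply k)
  refine h1.congr_of_eventuallyEq ?_
  filter_upwards [hY'] with x hx
  rw [hx, inv_mul_cancel_left₀ (wSeq_pos k).ne']

variable {k₁ k₂ : ℕ} {c₀ κ₀ T₀ : ℝ}

lemma IsDoubleBifurcationPoint.exists_critical (h : IsDoubleBifurcationPoint k₁ k₂ c₀ κ₀ T₀) :
    ∃ ξ, κ₀ * k₁ < ξ ∧ ξ < κ₀ * k₂ ∧ T₀ * critRatio (2 * ξ) = 1 := by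
  have h1 : (0 : ℝ) < k₁ := by exact_mod_cast h.one_le
  refine exists_critical_point h.T_pos (mul_pos h.κ_pos h1)
    (mul_lt_mul_of_pos_left (by exact_mod_cast h.lt) h.κ_pos) ?_
  rw [(h.iff k₁ h.one_le).2 (Or.inl rfl), (h.iff k₂ (h.one_le.trans h.lt.le)).2 (Or.inr rfl)]

lemma IsDoubleBifurcationPoint.m_left (h : IsDoubleBifurcationPoint k₁ k₂ c₀ κ₀ T₀) :
    m T₀ (κ₀ * k₁) = c₀ := (h.iff k₁ h.one_le).2 (Or.inl rfl)

/-- The definition of a bifurcation point only concerns positive wave numbers. This excludes a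
resonance of the mean, since the symbol equals 1 at k = 0. -/
lemma IsDoubleBifurcationPoint.c_lt_one (h : IsDoubleBifurcationPoint k₁ k₂ c₀ κ₀ T₀) :
    c₀ < 1 := by
  have h1 : (0 : ℝ) < k₁ := by exact_mod_cast h.one_le
  obtain ⟨ξ, hξ, -, hξ'⟩ := h.exists_critical
  rw [← h.m_left]
  exact m_lt_one h.T_pos hξ' (mul_pos h.κ_pos h1) hξ

/-- The symbol `ell` depends analytically on the parameters, as a bounded sequence. -/
lemma exists_analytic_ellSeq (h : IsDoubleBifurcationPoint k₁ k₂ c₀ κ₀ T₀) :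
    ∃ L : ℝ × ℝ × ℝ → ℕ →ᵇ ℝ, ContDiffAt ℝ ω L (c₀, κ₀, T₀) ∧
      ∀ᶠ l in 𝓝 (c₀, κ₀, T₀), ∀ k : ℤ, L l k.natAbs = ell k₁ k₂ l.1 l.2.1 l.2.2 k ∧
        (k.natAbs ≠ k₁ → k.natAbs ≠ k₂ → l.1 - m l.2.2 (l.2.1 * k) ≠ 0) := by
  obtain ⟨Y, hY, hY'⟩ := exists_analytic_symbolSeq (x₀ := (κ₀, T₀)) h.κ_pos h.T_pos
  obtain ⟨δ, hδ, hle⟩ := exists_le_mSqSeq h.κ_pos h.T_pos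
  let e : ℕ →ᵇ ℝ := 1 - deltaSeq k₁ - deltaSeq k₂
  have hk : k₁ ≠ k₂ := h.lt.ne
  have he (k : ℕ) : e k = if k = k₁ ∨ k = k₂ then 0 else 1 := by
    have : e k = 1 - (if k = k₁ then 1 else 0) - (if k = k₂ then 1 else 0) := rfl
    rw [this]
    split_ifs <;> grind
  -- Off k₁ and k₂ this is the weighted divisor `wSeq k * (c - m T (κ * k))`; at k₁ and k₂ it is
  -- replaced by 1 so as to be invertible.
  let g : ℝ × ℝ × ℝ → ℕ →ᵇ ℝ := fun l => e * (l.1 • wSeq - Y l.2) + (1 - e)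
  have hg (l : ℝ × ℝ × ℝ) (k : ℕ) : g l k = e k * (l.1 * wSeq k - Y l.2 k) + (1 - e k) := rfl
  have hgc : ContDiffAt ℝ ω g (c₀, κ₀, T₀) := by
    have h1 : ContDiffAt ℝ ω (fun l : ℝ × ℝ × ℝ => Y l.2) (c₀, κ₀, T₀) :=
      hY.comp (c₀, κ₀, T₀) contDiffAt_snd
    exact (contDiffAt_const.mul ((contDiffAt_fst.smul contDiffAt_const).sub h1)).add
      contDiffAt_const
  have hY0 := hY'.self_of_nhds
  have hne (k : ℕ) : g (c₀, κ₀, T₀) k ≠ 0 := by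
    rw [hg, he, hY0]
    split_ifs with hkk
    · simp
    · have hm : c₀ - m T₀ (κ₀ * k) ≠ 0 := by
        rcases Nat.eq_zero_or_pos k with rfl | hk0
        · simp only [CharP.cast_eq_zero, mul_zero, m_zero]
          exact (sub_neg.2 h.c_lt_one).ne
        · exact sub_ne_zero.2 fun hc => hkk ((h.iff k hk0).1 hc.symm)
      have : 1 * (c₀ * wSeq k - wSeq k * m T₀ (κ₀ * k)) + (1 - 1) =
          wSeq k * (c₀ - m T₀ (κ₀ * k)) := by ring
      simp only [this]
      exact mul_ne_zero (wSeq_pos k).ne' hm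
  -- For large k the weighted c tends to zero while the weighted symbol stays above `√δ`. Only
  -- finitely many entries are left, and each of them is nonzero.
  have hfar : ∀ᶠ k in atTop, √δ / 2 ≤ |g (c₀, κ₀, T₀) k| := by
    have h1 : Tendsto (fun k => c₀ * wSeq k) atTop (𝓝 0) := by
      simpa using tendsto_wSeq.const_mul c₀
    have hs := Real.sqrt_pos.2 hδ
    filter_upwards [h1.eventually (gt_mem_nhds (half_pos hs)), eventually_gt_atTop k₁,
      eventually_gt_atTop k₂] with k hk hk1 hk2
    rw [hg, he, if_neg (by grind), hY0]
    have h2 : √δ ≤ wSeq k * m T₀ (κ₀ * k) := by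
      rw [← sqrt_mSqSeq h.κ_pos]
      exact Real.sqrt_le_sqrt (hle k)
    refine le_trans ?_ (neg_le_abs _)
    simp only
    linarith
  obtain ⟨N, hN⟩ := eventually_atTop.1 hfar
  have hunit : IsUnit (g (c₀, κ₀, T₀)) := by
    obtain ⟨ε, hε, hε'⟩ : ∃ ε > 0, ∀ k < N, ε ≤ |g (c₀, κ₀, T₀) k| := by
      rcases Nat.eq_zero_or_pos N with rfl | hN0
      · exact ⟨1, one_pos, by simp⟩
      · obtain ⟨k₀, -, hk₀⟩ := (Finset.range N).exists_min_image
          (fun k => |g (c₀, κ₀, T₀) k|) ⟨0, by simpa using hN0⟩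
        exact ⟨_, abs_pos.2 (hne k₀), fun k hk => hk₀ k (by simpa using hk)⟩
    refine Seq.isUnit_of_le (δ := min ε (√δ / 2)) (lt_min hε (by positivity)) fun k => ?_
    rcases lt_or_ge k N with hk | hk
    · exact (min_le_left _ _).trans (hε' k hk)
    · exact (min_le_right _ _).trans (hN k hk)
  -- Multiplying back by the weight yields (c − m)⁻¹, and `e` removes the critical entries.
  refine ⟨fun l => e * wSeq * Ring.inverse (g l), ?_, ?_⟩
  · exact contDiffAt_const.mul
      (ContDiffAt.comp (g := Ring.inverse) _ (Seq.contDiffAt_inverse hunit) hgc)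
  · have hY2 : ∀ᶠ l : ℝ × ℝ × ℝ in 𝓝 (c₀, κ₀, T₀),
        ∀ k : ℕ, Y l.2 k = wSeq k * m l.2.2 (l.2.1 * k) :=
      (continuousAt_snd (p := (c₀, κ₀, T₀))).eventually hY'
    filter_upwards [hgc.continuousAt.eventually (Seq.eventually_isUnit hunit), hY2] with l hl hl2 k
    have e1 : (e * wSeq * Ring.inverse (g l)) k.natAbs =
        e k.natAbs * wSeq k.natAbs * (g l k.natAbs)⁻¹ := by
      rw [← Seq.inverse_apply hl]; rfl
    have e2 : k.natAbs ≠ k₁ → k.natAbs ≠ k₂ →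
        g l k.natAbs = wSeq k.natAbs * (l.1 - m l.2.2 (l.2.1 * k)) := by
      intro h1 h2
      rw [hg, he, hl2, if_neg (by grind), m_natAbs]
      ring
    refine ⟨?_, fun h1 h2 h3 => ?_⟩
    · rw [e1, ell, he]
      split_ifs with hkk
      · simp
      · rw [e2 (by grind) (by grind), mul_inv, one_mul,
          mul_inv_cancel_left₀ (wSeq_pos _).ne']
    · rw [h3, mul_zero] at e2
      have h4 := Seq.inverse_apply hl k.natAbs
      have h5 : g l k.natAbs * Ring.inverse (g l) k.natAbs = 1 :=
        congr($(Ring.mul_inverse_cancel _ hl) k.natAbs)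
      rw [e2 h1 h2, zero_mul] at h5
      exact zero_ne_one h5

end

section

open Filter Topology BoundedContinuousFunction

/-! ### The Taylor-Fourier coefficients as an analytic family in `ℓ¹` -/

section Coefficients

variable (k₁ k₂ : ℕ) (c κ T : ℝ)

lemma uHat_of_deg_eq_zero {p : Idx} (h : p.deg = 0) : uHat k₁ k₂ c κ T p = 0 := by
  rw [uHat, if_pos h]

lemma uHat_of_deg_eq_one {p : Idx} (h : p.deg = 1) : uHat k₁ k₂ c κ T p = 1 / 2 := by
  rw [uHat, if_neg (by omega), if_pos h]

lemma Idx.deg_add (p q : Idx) : (p + q).deg = p.deg + q.deg := by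
  simp only [Idx.deg, Prod.fst_add, Prod.snd_add]
  omega

lemma Idx.deg_sub {p q : Idx} (h : q ≤ p) : (p - q).deg + q.deg = p.deg := by
  rw [← Idx.deg_add, tsub_add_cancel_of_le h]

lemma Idx.freq_add (p q : Idx) : (p + q).freq k₁ k₂ = p.freq k₁ k₂ + q.freq k₁ k₂ := by
  simp only [Idx.freq, Prod.fst_add, Prod.snd_add]
  push_cast
  ring

lemma uHat_of_two_le_deg {p : Idx} (h : 2 ≤ p.deg) :
    uHat k₁ k₂ c κ T p = ell k₁ k₂ c κ T (p.freq k₁ k₂) * uSqHat k₁ k₂ c κ T p := by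
  rw [uHat, if_neg (by omega), if_neg (by omega), uSqHat, ← Finset.sum_attach (Finset.Iic p)]
  congr 1
  refine Finset.sum_congr rfl fun q _ => ?_
  have hq := Idx.deg_sub (Finset.mem_Iic.1 q.2)
  split_ifs with h1
  · rfl
  · rw [not_and_or, not_lt, not_lt] at h1
    rcases h1 with h1 | h1
    · rw [uHat_of_deg_eq_zero k₁ k₂ c κ T (p := q.1) (by omega), zero_mul]
    · rw [uHat_of_deg_eq_zero k₁ k₂ c κ T (p := p - q.1) (by omega), mul_zero]

lemma Idx.deg_swap (p : Idx) : Idx.deg p.swap = p.deg := by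
  simp only [Idx.deg, Prod.fst_swap, Prod.snd_swap]
  omega

lemma Idx.freq_swap (p : Idx) : Idx.freq k₁ k₂ p.swap = -p.freq k₁ k₂ := by
  simp only [Idx.freq, Prod.fst_swap, Prod.snd_swap]
  ring

lemma ell_neg (k : ℤ) : ell k₁ k₂ c κ T (-k) = ell k₁ k₂ c κ T k := by
  rw [ell, ell, Int.natAbs_neg, Int.cast_neg, mul_neg, m_neg]

/-- Stated with a hypothesis on the products only, so that it serves both inside the induction for
`uHat_swap`, where factors of lower degree alone are under control, and afterwards. -/
lemma uSqHat_swap_of {p : Idx} (h : ∀ q ≤ p, uHat k₁ k₂ c κ T q.swap *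
    uHat k₁ k₂ c κ T (p - q).swap = uHat k₁ k₂ c κ T q * uHat k₁ k₂ c κ T (p - q)) :
    uSqHat k₁ k₂ c κ T p.swap = uSqHat k₁ k₂ c κ T p := by
  rw [uSqHat, uSqHat]
  refine (Finset.sum_bij (fun q _ => Prod.swap q) (fun q hq => ?_) (fun q _ q' _ h => ?_)
    (fun q hq => ⟨Prod.swap q, ?_, Prod.swap_swap q⟩) (fun q hq => ?_)).symm
  · exact Finset.mem_Iic.2 (Prod.swap_le_swap.2 (Finset.mem_Iic.1 hq))
  · exact Prod.swap_injective h
  · rw [Finset.mem_Iic, ← Prod.swap_le_swap, Prod.swap_swap]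
    exact Finset.mem_Iic.1 hq
  · exact (h q (Finset.mem_Iic.1 hq)).symm

/-- Exchanging α and β changes the sign of the wave number, and `ell` is even. This symmetry is what
makes the resulting waves real-valued. -/
lemma uHat_swap (p : Idx) : uHat k₁ k₂ c κ T p.swap = uHat k₁ k₂ c κ T p := by
  induction hn : p.deg using Nat.strong_induction_on generalizing p with
  | _ n ih =>
    rcases lt_or_ge p.deg 2 with h | h
    · obtain hd | hd : p.deg = 0 ∨ p.deg = 1 := by omega
      · rw [uHat_of_deg_eq_zero _ _ _ _ _ hd, uHat_of_deg_eq_zero]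
        rw [Idx.deg_swap, hd]
      · rw [uHat_of_deg_eq_one _ _ _ _ _ hd, uHat_of_deg_eq_one]
        rw [Idx.deg_swap, hd]
    · rw [uHat_of_two_le_deg _ _ _ _ _ h, uHat_of_two_le_deg _ _ _ _ _ (by rwa [Idx.deg_swap]),
        Idx.freq_swap, ell_neg, uSqHat_swap_of]
      intro q hq
      have h1 := Idx.deg_sub hq
      by_cases h2 : q.deg = 0
      · rw [uHat_of_deg_eq_zero _ _ _ _ _ h2, uHat_of_deg_eq_zero k₁ k₂ c κ T (p := q.swap),
          zero_mul, zero_mul]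
        rw [Idx.deg_swap, h2]
      by_cases h3 : (p - q).deg = 0
      · rw [uHat_of_deg_eq_zero _ _ _ _ _ h3,
          uHat_of_deg_eq_zero k₁ k₂ c κ T (p := (p - q).swap), mul_zero, mul_zero]
        rw [Idx.deg_swap, h3]
      rw [ih q.deg (by omega) q rfl, ih (p - q).deg (by omega) (p - q) rfl]

lemma uSqHat_swap (p : Idx) : uSqHat k₁ k₂ c κ T p.swap = uSqHat k₁ k₂ c κ T p :=
  uSqHat_swap_of _ _ _ _ _ fun q _ => by rw [uHat_swap, uHat_swap]

lemma uSqHat_of_deg_lt_two {p : Idx} (h : p.deg < 2) : uSqHat k₁ k₂ c κ T p = 0 := by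
  refine Finset.sum_eq_zero fun q hq => ?_
  have h1 := Idx.deg_sub (Finset.mem_Iic.1 hq)
  by_cases h2 : q.deg = 0
  · rw [uHat_of_deg_eq_zero _ _ _ _ _ h2, zero_mul]
  · rw [uHat_of_deg_eq_zero _ _ _ _ _ (p := p - q) (by omega), mul_zero]

end Coefficients

lemma Idx.finite_deg_eq_one : {p : Idx | Idx.deg p = 1}.Finite := by
  refine (Finset.finite_toSet (Finset.Iic (((1, 1), (1, 1)) : Idx))).subset fun p hp => ?_
  have : Idx.deg p = 1 := hp
  simp only [Idx.deg] at this
  simp only [Finset.coe_Iic, Set.mem_Iic]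
  exact ⟨⟨by grind, by grind⟩, by grind, by grind⟩

/-- The family of the linear terms. -/
def linTerm : L1 Idx := L1.mk (fun p => if p.deg = 1 then 1 / 2 else 0) (by
  refine summable_of_hasFiniteSupport (Idx.finite_deg_eq_one.subset fun p hp => ?_)
  by_contra h
  exact hp (by simp [show p.deg ≠ 1 from h]))

/-- The sequence `μ` seen as a family on the terms of degree at least two, through the wave
number. -/
def freqPull (k₁ k₂ : ℕ) (μ : ℕ →ᵇ ℝ) : Idx →ᵇ ℝ :=
  (ofNormedAddCommGroupDiscrete (fun p : Idx => if 2 ≤ p.deg then 1 else 0) 1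
    (fun p => by split_ifs <;> simp)) *
  compContinuousCLM ℝ ℝ ⟨fun p : Idx => (p.freq k₁ k₂).natAbs, continuous_of_discreteTopology⟩ μ

lemma freqPull_apply (k₁ k₂ : ℕ) (μ : ℕ →ᵇ ℝ) (p : Idx) :
    freqPull k₁ k₂ μ p = if 2 ≤ p.deg then μ (p.freq k₁ k₂).natAbs else 0 := by
  change (if 2 ≤ p.deg then (1 : ℝ) else 0) * μ (p.freq k₁ k₂).natAbs = _
  split_ifs <;> simp

/-- The equation forces the entry of degree 0 to vanish, so the convolution at `p` involves only
entries of smaller degree and the recursion for `uHat` determines `a`. The powers of t follow from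
homogeneity. -/
lemma eq_uHat_of_fixedPoint {k₁ k₂ : ℕ} {c κ T t : ℝ} {μ : ℕ →ᵇ ℝ} {a : L1 Idx}
    (hμ : ∀ k : ℤ, μ k.natAbs = ell k₁ k₂ c κ T k)
    (ha : a = t • linTerm + diag (freqPull k₁ k₂ μ) (conv a a)) (p : Idx) :
    a p = uHat k₁ k₂ c κ T p * t ^ p.deg := by
  have h (p : Idx) : a p = t * (if p.deg = 1 then 1 / 2 else 0) +
      (if 2 ≤ p.deg then ell k₁ k₂ c κ T (p.freq k₁ k₂) else 0) *
        ∑ q ∈ Finset.Iic p, a q * a (p - q) := by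
    rw [← conv_apply, ← hμ, ← freqPull_apply, ← diag_apply]
    exact congr($ha p)
  have h0 {p : Idx} (hp : p.deg = 0) : a p = 0 := by rw [h, hp]; simp
  induction hn : p.deg using Nat.strong_induction_on generalizing p with
  | _ n ih =>
    subst hn
    rcases lt_or_ge p.deg 2 with hd | hd
    · obtain hd | hd : p.deg = 0 ∨ p.deg = 1 := by omega
      · rw [h0 hd, uHat_of_deg_eq_zero _ _ _ _ _ hd, zero_mul]
      · rw [h, hd, uHat_of_deg_eq_one _ _ _ _ _ hd]
        simp
        ring
    · rw [h, if_neg (by omega), if_pos hd, uHat_of_two_le_deg _ _ _ _ _ hd, uSqHat, mul_zero,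
        zero_add, mul_assoc, Finset.sum_mul]
      congr 1
      refine Finset.sum_congr rfl fun q hq => ?_
      have h1 := Idx.deg_sub (Finset.mem_Iic.1 hq)
      by_cases h2 : q.deg = 0
      · rw [h0 h2, uHat_of_deg_eq_zero _ _ _ _ _ h2]
        ring
      by_cases h3 : (p - q).deg = 0
      · rw [h0 h3, uHat_of_deg_eq_zero _ _ _ _ _ h3]
        ring
      rw [ih q.deg (by omega) q rfl, ih (p - q).deg (by omega) (p - q) rfl, ← h1, pow_add]
      ring

/-- The Taylor-Fourier coefficients, scaled by powers of a small `t > 0`, form a summable family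
that depends analytically on the parameters. -/
lemma exists_analytic_uHat {k₁ k₂ : ℕ} {c₀ κ₀ T₀ : ℝ}
    (h : IsDoubleBifurcationPoint k₁ k₂ c₀ κ₀ T₀) :
    ∃ t > 0, ∃ a : ℝ × ℝ × ℝ → L1 Idx, ContDiffAt ℝ ω a (c₀, κ₀, T₀) ∧
      ∀ᶠ l in 𝓝 (c₀, κ₀, T₀), ∀ p : Idx,
        a l p = uHat k₁ k₂ l.1 l.2.1 l.2.2 p * t ^ p.deg ∧
        conv (a l) (a l) p = uSqHat k₁ k₂ l.1 l.2.1 l.2.2 p * t ^ p.deg := by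
  obtain ⟨L, hL, hL'⟩ := exists_analytic_ellSeq h
  let l₀ : ℝ × ℝ × ℝ := (c₀, κ₀, T₀)
  let f : ((ℝ × ℝ × ℝ) × ℝ) × L1 Idx → L1 Idx := fun v =>
    v.2 - (v.1.2 • linTerm + diag (freqPull k₁ k₂ (L v.1.1)) (conv v.2 v.2))
  have hf : ContDiffAt ℝ ω f ((l₀, 0), 0) := by
    have h1 : ContDiffAt ℝ ω (fun v : ((ℝ × ℝ × ℝ) × ℝ) × L1 Idx => L v.1.1) ((l₀, 0), 0) :=
      ContDiffAt.comp (g := L) _ hL (by fun_prop)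
    have h2 : ContDiffAt ℝ ω (fun v : ((ℝ × ℝ × ℝ) × ℝ) × L1 Idx =>
        freqPull k₁ k₂ (L v.1.1)) ((l₀, 0), 0) := by
      unfold freqPull
      exact contDiffAt_const.mul ((compContinuousCLM ℝ ℝ _).contDiff.contDiffAt.comp _ h1)
    have h3 : ContDiffAt ℝ ω (fun v : ((ℝ × ℝ × ℝ) × ℝ) × L1 Idx =>
        diag (freqPull k₁ k₂ (L v.1.1))) ((l₀, 0), 0) :=
      diag.contDiff.contDiffAt.comp _ h2
    have h4 : ContDiffAt ℝ ω (fun v : ((ℝ × ℝ × ℝ) × ℝ) × L1 Idx => conv v.2 v.2) ((l₀, 0), 0) :=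
      (conv.contDiff.contDiffAt.comp _ contDiffAt_snd).clm_apply contDiffAt_snd
    exact contDiffAt_snd.sub (((contDiffAt_snd.comp _ contDiffAt_fst).smul contDiffAt_const).add
      (h3.clm_apply h4))
  -- At t = 0 and a = 0 the nonlinearity is quadratic in `a`, so the derivative is the identity.
  have hA : HasFDerivAt (fun a : L1 Idx => f ((l₀, 0), a))
      ((ContinuousLinearEquiv.refl ℝ (L1 Idx) : L1 Idx ≃L[ℝ] L1 Idx) : L1 Idx →L[ℝ] L1 Idx) 0 := by
    have h1 : HasFDerivAt (fun a : L1 Idx => conv a a) (0 : L1 Idx →L[ℝ] L1 Idx) 0 := by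
      have := (conv (G := Idx)).hasFDerivAt_of_bilinear (hasFDerivAt_id (𝕜 := ℝ) (0 : L1 Idx))
        (hasFDerivAt_id (𝕜 := ℝ) (0 : L1 Idx))
      refine this.congr_fderiv ?_
      ext a : 1
      simp
    have h2 : HasFDerivAt (fun a : L1 Idx => diag (freqPull k₁ k₂ (L l₀)) (conv a a))
        (0 : L1 Idx →L[ℝ] L1 Idx) 0 := by
      have := (diag (freqPull k₁ k₂ (L l₀))).hasFDerivAt.comp (0 : L1 Idx) h1
      exact this.congr_fderiv (by simp)
    have h3 := (hasFDerivAt_id (𝕜 := ℝ) (0 : L1 Idx)).sub (h2.const_add ((0 : ℝ) • linTerm))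
    refine h3.congr_fderiv ?_
    ext a : 1
    simp
  obtain ⟨φ, hφ0, hφ, hφ', -⟩ := exists_analytic_implicit hf
    (ContinuousLinearEquiv.refl ℝ (L1 Idx)) hA (by simp [f])
  have hev : ∀ᶠ v in 𝓝 (l₀, (0 : ℝ)), ContDiffAt ℝ ω φ v ∧ ∀ᶠ w in 𝓝 v, f (w, φ w) = 0 :=
    (hφ.eventually (by simp)).and (eventually_eventually_nhds.2 hφ')
  have ht : Tendsto (fun t : ℝ => (l₀, t)) (𝓝[>] 0) (𝓝 (l₀, 0)) :=
    ((Continuous.prodMk_right l₀).tendsto 0).mono_left nhdsWithin_le_nhds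
  -- The implicit function is analytic and solves the equation throughout a neighbourhood of (l₀,
  -- 0); any (l₀, t) in it with t > 0 will do, and t is fixed from here on.
  obtain ⟨t, ⟨ht1, ht2⟩, ht0⟩ := ((ht.eventually hev).and self_mem_nhdsWithin).exists
  have hc : ContinuousAt (fun l : ℝ × ℝ × ℝ => (l, t)) l₀ := by fun_prop
  refine ⟨t, ht0, fun l => φ (l, t), ContDiffAt.comp (g := φ) l₀ ht1 (by fun_prop), ?_⟩
  filter_upwards [hL', hc.eventually ht2] with l hl1 hl2
  have key := eq_uHat_of_fixedPoint (t := t) (fun k => (hl1 k).1) (sub_eq_zero.1 hl2)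
  refine fun p => ⟨key p, ?_⟩
  rw [conv_apply, uSqHat, Finset.sum_mul]
  refine Finset.sum_congr rfl fun q hq => ?_
  rw [key, key, ← Idx.deg_sub (Finset.mem_Iic.1 hq), pow_add]
  ring

end

section

open Filter Topology BoundedContinuousFunction
open scoped ComplexConjugate

/-! ### Monomials and their reduction modulo the invariants -/

/-- The monomial `Z₁^{α₁} Z̄₁^{β₁} Z₂^{α₂} Z̄₂^{β₂}`. -/
def mono (Z : ℂ × ℂ) (p : Idx) : ℂ :=
  Z.1 ^ p.1.1 * conj Z.1 ^ p.2.1 * (Z.2 ^ p.1.2 * conj Z.2 ^ p.2.2)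

lemma mono_add (Z : ℂ × ℂ) (p q : Idx) : mono Z (p + q) = mono Z p * mono Z q := by
  simp only [mono, Prod.fst_add, Prod.snd_add, pow_add]
  ring

lemma mono_swap (Z : ℂ × ℂ) (p : Idx) : mono Z p.swap = conj (mono Z p) := by
  simp only [mono, Prod.fst_swap, Prod.snd_swap, map_mul, map_pow, Complex.conj_conj]
  ring

/-- Pulling back a bounded sequence along an integer-valued function of the index. -/
def pull {E : Type*} [NormedAddCommGroup E] [NormedSpace ℝ E] (g : Idx → ℕ) :
    (ℕ →ᵇ E) →L[ℝ] (Idx →ᵇ E) :=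
  compContinuousCLM E ℝ ⟨g, continuous_of_discreteTopology⟩

@[simp] lemma pull_apply {E : Type*} [NormedAddCommGroup E] [NormedSpace ℝ E] (g : Idx → ℕ)
    (f : ℕ →ᵇ E) (p : Idx) : pull g f p = f (g p) := rfl

lemma contDiffAt_pull {E F : Type*} [NormedAddCommGroup E] [NormedSpace ℝ E]
    [NormedAddCommGroup F] [NormedSpace ℝ F] {f : F → ℕ →ᵇ E} {x : F} (hf : ContDiffAt ℝ ω f x)
    (g : Idx → ℕ) : ContDiffAt ℝ ω (fun y => pull g (f y)) x :=
  (pull (E := E) g).contDiff.contDiffAt.comp x hf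

/-- The family of all monomials, for `|Z₁|, |Z₂| < 1`. -/
def monoFam (Z : ℂ × ℂ) : Idx →ᵇ ℂ :=
  pull (fun p => p.1.1) (geoSeq Z.1) * pull (fun p => p.2.1) (geoSeq (conj Z.1)) *
    (pull (fun p => p.1.2) (geoSeq Z.2) * pull (fun p => p.2.2) (geoSeq (conj Z.2)))

lemma monoFam_apply {Z : ℂ × ℂ} (h1 : ‖Z.1‖ < 1) (h2 : ‖Z.2‖ < 1) (p : Idx) :
    monoFam Z p = mono Z p := by
  simp only [monoFam, BoundedContinuousFunction.mul_apply, pull_apply, mono]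
  rw [geoSeq_apply h1, geoSeq_apply h2, geoSeq_apply (by rwa [RCLike.norm_conj]),
    geoSeq_apply (by rwa [RCLike.norm_conj])]

lemma contDiffAt_monoFam {Z : ℂ × ℂ} (h1 : ‖Z.1‖ < 1) (h2 : ‖Z.2‖ < 1) :
    ContDiffAt ℝ ω monoFam Z := by
  have hc : ContDiff ℝ ω (fun z : ℂ => conj z) := Complex.conjCLE.contDiff
  have key {f : ℂ × ℂ → ℂ} (hf : ContDiffAt ℝ ω f Z) (hn : ‖f Z‖ < 1) (g : Idx → ℕ) :
      ContDiffAt ℝ ω (fun Z => pull g (geoSeq (f Z))) Z :=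
    contDiffAt_pull
      (ContDiffAt.comp (g := geoSeq) Z ((contDiffAt_geoSeq hn).restrict_scalars ℝ) hf) g
  exact ((key contDiffAt_fst h1 _).mul (key (hc.contDiffAt.comp Z contDiffAt_fst)
    (by simpa using h1) _)).mul ((key contDiffAt_snd h2 _).mul
    (key (hc.contDiffAt.comp Z contDiffAt_snd) (by simpa using h2) _))

/-- The integer `m` with `α₂ - β₂ = m k`, for indices of wave number `k`. -/
def Idx.mult (k : ℕ) (p : Idx) : ℤ := ((p.1.2 : ℤ) - p.2.2) / k

/-- The coefficient of `Z₁` in the reduction of a monomial of wave number `k`, as a function of the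
invariants `(|Z₁|², |Z₂|², Re Z̄₁ˡ Z₂ᵏ)`. -/
def redA (k l : ℕ) (s : ℝ × ℝ × ℝ) (p : Idx) : ℝ :=
  if p.freq k l = k then s.1 ^ min p.1.1 p.2.1 * s.2.1 ^ min p.1.2 p.2.2 *
    (if 1 ≤ p.mult k then
      -(s.1 ^ (l - 1) * s.2.1 ^ k) * chebV s.2.2 (s.1 ^ l * s.2.1 ^ k) (p.mult k - 1).toNat
    else chebV s.2.2 (s.1 ^ l * s.2.1 ^ k) (1 - p.mult k).toNat) else 0

/-- The coefficient of `Z̄₁ˡ⁻¹ Z₂ᵏ` in the reduction of a monomial of wave number `k`. -/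
def redB (k l : ℕ) (s : ℝ × ℝ × ℝ) (p : Idx) : ℝ :=
  if p.freq k l = k then s.1 ^ min p.1.1 p.2.1 * s.2.1 ^ min p.1.2 p.2.2 *
    (if 1 ≤ p.mult k then chebV s.2.2 (s.1 ^ l * s.2.1 ^ k) (p.mult k).toNat
    else -s.1 * chebV s.2.2 (s.1 ^ l * s.2.1 ^ k) (-p.mult k).toNat) else 0

/-- The invariants of `Z` under translations. -/
def invariants (k l : ℕ) (Z : ℂ × ℂ) : ℝ × ℝ × ℝ :=
  (Complex.normSq Z.1, Complex.normSq Z.2, (conj Z.1 ^ l * Z.2 ^ k).re)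

/-- The exceptional monomial of wave number `k`. -/
def exc (k l : ℕ) (Z : ℂ × ℂ) : ℂ := conj Z.1 ^ (l - 1) * Z.2 ^ k

lemma conj_mul_exc {k l : ℕ} (hl : 1 ≤ l) (Z : ℂ × ℂ) :
    conj Z.1 * exc k l Z = conj Z.1 ^ l * Z.2 ^ k := by
  obtain ⟨l, rfl⟩ := Nat.exists_eq_add_of_le' hl
  rw [exc, Nat.add_sub_cancel, pow_succ]
  ring

/-! ### Powers of the resonant product -/

section Cheb

variable {k l : ℕ} (Z : ℂ × ℂ)

/-- With I = Z̄₁ˡ Z₂ᵏ, the relation I² = 2 Re(I) I − |I|² is the recursion defining `chebV`. The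
term in Z₁ arises from E Ī = |Z₁|^{2(l-1)} |Z₂|^{2k} Z₁, for E the exceptional monomial. -/
lemma exc_mul_pow (hl : 1 ≤ l) (n : ℕ) :
    exc k l Z * (conj Z.1 ^ l * Z.2 ^ k) ^ n =
      chebV (invariants k l Z).2.2 ((invariants k l Z).1 ^ l * (invariants k l Z).2.1 ^ k) (n + 1) *
        exc k l Z -
      (invariants k l Z).1 ^ (l - 1) * (invariants k l Z).2.1 ^ k *
        chebV (invariants k l Z).2.2 ((invariants k l Z).1 ^ l * (invariants k l Z).2.1 ^ k) n *
        Z.1 := by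
  simp only [invariants]
  have hI := conj_mul_exc (k := k) hl Z
  have h1 : (2 * (conj Z.1 ^ l * Z.2 ^ k).re : ℂ) =
      conj Z.1 ^ l * Z.2 ^ k + conj (conj Z.1 ^ l * Z.2 ^ k) := by
    rw [Complex.add_conj]
    push_cast
    ring
  have h2 : exc k l Z * conj (conj Z.1 ^ l * Z.2 ^ k) =
      (Complex.normSq Z.1 : ℂ) ^ (l - 1) * (Complex.normSq Z.2 : ℂ) ^ k * Z.1 := by
    rw [← Complex.mul_conj, ← Complex.mul_conj, ← hI, exc]
    simp only [map_mul, map_pow, Complex.conj_conj]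
    ring
  have h3 : (Complex.normSq Z.1 : ℂ) ^ l * (Complex.normSq Z.2 : ℂ) ^ k =
      Complex.normSq Z.1 * ((Complex.normSq Z.1 : ℂ) ^ (l - 1) * (Complex.normSq Z.2 : ℂ) ^ k) := by
    obtain ⟨l, rfl⟩ := Nat.exists_eq_add_of_le' hl
    rw [Nat.add_sub_cancel, pow_succ]
    ring
  have h4 : (Complex.normSq Z.1 : ℂ) = Z.1 * conj Z.1 := (Complex.mul_conj _).symm
  induction n with
  | zero => simp [chebV]
  | succ n ih =>
    rw [pow_succ, ← mul_assoc, ih]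
    simp only [chebV]
    push_cast
    rw [h1, h3]
    set V := (chebV (conj Z.1 ^ l * Z.2 ^ k).re
      (Complex.normSq Z.1 ^ l * Complex.normSq Z.2 ^ k) (n + 1) : ℂ)
    set W := (chebV (conj Z.1 ^ l * Z.2 ^ k).re
      (Complex.normSq Z.1 ^ l * Complex.normSq Z.2 ^ k) n : ℂ)
    set η := (Complex.normSq Z.1 : ℂ) ^ (l - 1) * (Complex.normSq Z.2 : ℂ) ^ k
    rw [← hI] at h2 ⊢
    linear_combination (-V) * h2 + η * W * exc k l Z * h4

/-- The conjugate counterpart: the same recursion for Ī, started from Z₁, where Z₁ Ī is reduced by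
Z̄₁E = I and Z₁Z̄₁ = |Z₁|². -/
lemma mul_conj_pow (hl : 1 ≤ l) (n : ℕ) :
    Z.1 * conj (conj Z.1 ^ l * Z.2 ^ k) ^ n =
      chebV (invariants k l Z).2.2 ((invariants k l Z).1 ^ l * (invariants k l Z).2.1 ^ k) (n + 1) *
        Z.1 - (invariants k l Z).1 *
        chebV (invariants k l Z).2.2 ((invariants k l Z).1 ^ l * (invariants k l Z).2.1 ^ k) n *
        exc k l Z := by
  simp only [invariants]
  have hI := conj_mul_exc (k := k) hl Z
  have h1 : (2 * (conj Z.1 ^ l * Z.2 ^ k).re : ℂ) =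
      conj Z.1 ^ l * Z.2 ^ k + conj (conj Z.1 ^ l * Z.2 ^ k) := by
    rw [Complex.add_conj]
    push_cast
    ring
  have h2 : exc k l Z * conj (conj Z.1 ^ l * Z.2 ^ k) =
      (Complex.normSq Z.1 : ℂ) ^ (l - 1) * (Complex.normSq Z.2 : ℂ) ^ k * Z.1 := by
    rw [← Complex.mul_conj, ← Complex.mul_conj, ← hI, exc]
    simp only [map_mul, map_pow, Complex.conj_conj]
    ring
  have h3 : (Complex.normSq Z.1 : ℂ) ^ l * (Complex.normSq Z.2 : ℂ) ^ k =
      Complex.normSq Z.1 * ((Complex.normSq Z.1 : ℂ) ^ (l - 1) * (Complex.normSq Z.2 : ℂ) ^ k) := by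
    obtain ⟨l, rfl⟩ := Nat.exists_eq_add_of_le' hl
    rw [Nat.add_sub_cancel, pow_succ]
    ring
  have h4 : (Complex.normSq Z.1 : ℂ) = Z.1 * conj Z.1 := (Complex.mul_conj _).symm
  induction n with
  | zero => simp [chebV]
  | succ n ih =>
    rw [pow_succ, ← mul_assoc, ih]
    simp only [chebV]
    push_cast
    rw [h1, h3]
    set V := (chebV (conj Z.1 ^ l * Z.2 ^ k).re
      (Complex.normSq Z.1 ^ l * Complex.normSq Z.2 ^ k) (n + 1) : ℂ)
    set W := (chebV (conj Z.1 ^ l * Z.2 ^ k).re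
      (Complex.normSq Z.1 ^ l * Complex.normSq Z.2 ^ k) n : ℂ)
    set η := (Complex.normSq Z.1 : ℂ) ^ (l - 1) * (Complex.normSq Z.2 : ℂ) ^ k
    rw [← hI] at h2 ⊢
    linear_combination V * exc k l Z * h4 - (Complex.normSq Z.1 : ℂ) * W * h2

end Cheb

lemma pow_mul_conj_pow_of_le (z : ℂ) {a b : ℕ} (h : b ≤ a) :
    z ^ a * conj z ^ b = (Complex.normSq z : ℂ) ^ b * z ^ (a - b) := by
  obtain ⟨d, rfl⟩ := Nat.exists_eq_add_of_le h
  rw [← Complex.mul_conj, Nat.add_sub_cancel_left, pow_add]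
  ring

lemma pow_mul_conj_pow_of_ge (z : ℂ) {a b : ℕ} (h : a ≤ b) :
    z ^ a * conj z ^ b = (Complex.normSq z : ℂ) ^ a * conj z ^ (b - a) := by
  obtain ⟨d, rfl⟩ := Nat.exists_eq_add_of_le h
  rw [← Complex.mul_conj, Nat.add_sub_cancel_left, pow_add]
  ring

/-- The frequency equation shows that k divides l(α₂ − β₂), hence α₂ − β₂ by coprimality. -/
lemma Idx.mult_spec {k l : ℕ} (hk : 1 ≤ k) (hkl : Nat.Coprime k l) {p : Idx}
    (hp : p.freq k l = k) : (p.1.1 : ℤ) - p.2.1 = 1 - p.mult k * l ∧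
      (p.1.2 : ℤ) - p.2.2 = p.mult k * k := by
  have hk0 : (k : ℤ) ≠ 0 := by exact_mod_cast (by omega : k ≠ 0)
  rw [Idx.freq] at hp
  have hdvd : (k : ℤ) ∣ (p.1.2 : ℤ) - p.2.2 := by
    have h1 : (k : ℤ) ∣ l * ((p.1.2 : ℤ) - p.2.2) :=
      ⟨1 - ((p.1.1 : ℤ) - p.2.1), by linarith⟩
    exact (Nat.isCoprime_iff_coprime.2 hkl).dvd_of_dvd_mul_left h1
  have h2 : (p.1.2 : ℤ) - p.2.2 = p.mult k * k := (Int.ediv_mul_cancel hdvd).symm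
  refine ⟨?_, h2⟩
  rw [h2] at hp
  apply mul_left_cancel₀ hk0
  linarith

/-- Every monomial of wave number `k` is a combination of `Z₁` and the exceptional monomial, with
coefficients that are functions of the invariants. -/
lemma mono_eq_red {k l : ℕ} (hk : 1 ≤ k) (hl : 1 ≤ l) (hkl : Nat.Coprime k l) (Z : ℂ × ℂ)
    {p : Idx} (hp : p.freq k l = k) :
    mono Z p = redA k l (invariants k l Z) p * Z.1 +
      redB k l (invariants k l Z) p * exc k l Z := by
  obtain ⟨h1, h2⟩ := Idx.mult_spec hk hkl hp
  have hl' : (1 : ℤ) ≤ l := by exact_mod_cast hl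
  have hk' : (1 : ℤ) ≤ k := by exact_mod_cast hk
  rw [redA, redB, if_pos hp, if_pos hp, mono]
  split_ifs with hm
  -- For multiplicity n + 1 ≥ 1, removing common factors |Z₁|² and |Z₂|² leaves E · Iⁿ.
  · obtain ⟨n, hn⟩ : ∃ n : ℕ, p.mult k = n + 1 :=
      ⟨(p.mult k - 1).toNat, by rw [Int.toNat_of_nonneg (by linarith)]; ring⟩
    rw [hn] at h1 h2 ⊢
    have e1 : p.1.1 ≤ p.2.1 := by nlinarith
    have e2 : p.2.2 ≤ p.1.2 := by nlinarith
    have e3 : p.2.1 - p.1.1 = (l - 1) + l * n := by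
      have : ((p.2.1 - p.1.1 : ℕ) : ℤ) = ((l - 1 + l * n : ℕ) : ℤ) := by
        push_cast [Nat.cast_sub e1, Nat.cast_sub hl]
        linarith
      exact_mod_cast this
    have e4 : p.1.2 - p.2.2 = k + k * n := by
      have : ((p.1.2 - p.2.2 : ℕ) : ℤ) = ((k + k * n : ℕ) : ℤ) := by
        push_cast [Nat.cast_sub e2]
        linarith
      exact_mod_cast this
    rw [pow_mul_conj_pow_of_ge _ e1, pow_mul_conj_pow_of_le _ e2, min_eq_left e1, min_eq_right e2,
      e3, e4, show ((n : ℤ) + 1 - 1).toNat = n by simp, show ((n : ℤ) + 1).toNat = n + 1 by omega]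
    have key := exc_mul_pow (k := k) Z hl n
    have e5 : conj Z.1 ^ (l - 1 + l * n) * Z.2 ^ (k + k * n) =
        exc k l Z * (conj Z.1 ^ l * Z.2 ^ k) ^ n := by
      rw [exc, pow_add, pow_add, mul_pow, pow_mul, pow_mul]
      ring
    have e6 : ∀ u v : ℂ, u * conj Z.1 ^ (l - 1 + l * n) * (v * Z.2 ^ (k + k * n)) =
        u * v * (conj Z.1 ^ (l - 1 + l * n) * Z.2 ^ (k + k * n)) := fun u v => by ring
    rw [e6, e5, key]
    simp only [invariants]
    push_cast
    ring
  -- For multiplicity −n ≤ 0, removing common factors leaves Z₁ · Īⁿ.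
  · obtain ⟨n, hn⟩ : ∃ n : ℕ, p.mult k = -n :=
      ⟨(-p.mult k).toNat, by rw [Int.toNat_of_nonneg (by linarith)]; ring⟩
    rw [hn] at h1 h2 ⊢
    have e1 : p.2.1 ≤ p.1.1 := by nlinarith
    have e2 : p.1.2 ≤ p.2.2 := by nlinarith
    have e3 : p.1.1 - p.2.1 = 1 + l * n := by
      have : ((p.1.1 - p.2.1 : ℕ) : ℤ) = ((1 + l * n : ℕ) : ℤ) := by
        push_cast [Nat.cast_sub e1]
        linarith
      exact_mod_cast this
    have e4 : p.2.2 - p.1.2 = k * n := by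
      have : ((p.2.2 - p.1.2 : ℕ) : ℤ) = ((k * n : ℕ) : ℤ) := by
        push_cast [Nat.cast_sub e2]
        linarith
      exact_mod_cast this
    rw [pow_mul_conj_pow_of_le _ e1, pow_mul_conj_pow_of_ge _ e2, min_eq_right e1, min_eq_left e2,
      e3, e4, show (1 - -(n : ℤ)).toNat = n + 1 by omega, show (- -(n : ℤ)).toNat = n by simp]
    have key := mul_conj_pow (k := k) Z hl n
    have e5 : Z.1 ^ (1 + l * n) * conj Z.2 ^ (k * n) =
        Z.1 * conj (conj Z.1 ^ l * Z.2 ^ k) ^ n := by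
      simp only [map_mul, map_pow, Complex.conj_conj]
      rw [pow_add, mul_pow, pow_mul, pow_mul]
      ring
    have e6 : ∀ u v : ℂ, u * Z.1 ^ (1 + l * n) * (v * conj Z.2 ^ (k * n)) =
        u * v * (Z.1 ^ (1 + l * n) * conj Z.2 ^ (k * n)) := fun u v => by ring
    rw [e6, e5, key]
    simp only [invariants]
    push_cast
    ring

/-- The indicator function of a set of indices. -/
def indFam (P : Idx → Prop) [DecidablePred P] : Idx →ᵇ ℝ :=
  ofNormedAddCommGroupDiscrete (fun p => if P p then 1 else 0) 1 (fun p => by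
    split_ifs <;> simp)

@[simp] lemma indFam_apply (P : Idx → Prop) [DecidablePred P] (p : Idx) :
    indFam P p = if P p then 1 else 0 := rfl

/-- `redA` as a bounded family. -/
def redAFam (k l : ℕ) (s : ℝ × ℝ × ℝ) : Idx →ᵇ ℝ :=
  indFam (fun p => p.freq k l = k) *
    (pull (fun p => min p.1.1 p.2.1) (geoSeq s.1) *
      pull (fun p => min p.1.2 p.2.2) (geoSeq s.2.1)) *
    (indFam (fun p => 1 ≤ p.mult k) * ((-(s.1 ^ (l - 1) * s.2.1 ^ k)) •
      pull (fun p => (p.mult k - 1).toNat) (chebSeq (s.2.2, s.1 ^ l * s.2.1 ^ k))) +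
    indFam (fun p => ¬ 1 ≤ p.mult k) *
      pull (fun p => (1 - p.mult k).toNat) (chebSeq (s.2.2, s.1 ^ l * s.2.1 ^ k)))

/-- `redB` as a bounded family. -/
def redBFam (k l : ℕ) (s : ℝ × ℝ × ℝ) : Idx →ᵇ ℝ :=
  indFam (fun p => p.freq k l = k) *
    (pull (fun p => min p.1.1 p.2.1) (geoSeq s.1) *
      pull (fun p => min p.1.2 p.2.2) (geoSeq s.2.1)) *
    (indFam (fun p => 1 ≤ p.mult k) *
      pull (fun p => (p.mult k).toNat) (chebSeq (s.2.2, s.1 ^ l * s.2.1 ^ k)) +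
    indFam (fun p => ¬ 1 ≤ p.mult k) * ((-s.1) •
      pull (fun p => (-p.mult k).toNat) (chebSeq (s.2.2, s.1 ^ l * s.2.1 ^ k))))

lemma continuousAt_chebArg {k l : ℕ} (hl : 1 ≤ l) :
    Tendsto (fun s : ℝ × ℝ × ℝ => (s.2.2, s.1 ^ l * s.2.1 ^ k)) (𝓝 0) (𝓝 0) := by
  have h : Continuous (fun s : ℝ × ℝ × ℝ => (s.2.2, s.1 ^ l * s.2.1 ^ k)) := by fun_prop
  exact h.tendsto' 0 0 (by simp [zero_pow (by omega : l ≠ 0)])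

lemma eventually_redFam (k : ℕ) {l : ℕ} (hl : 1 ≤ l) : ∀ᶠ s in 𝓝 (0 : ℝ × ℝ × ℝ), ∀ p,
    redAFam k l s p = redA k l s p ∧ redBFam k l s p = redB k l s p := by
  have h1 : ∀ᶠ s in 𝓝 (0 : ℝ × ℝ × ℝ), ‖s.1‖ < 1 :=
    (continuous_fst.norm.tendsto' 0 0 (by simp)).eventually (gt_mem_nhds one_pos)
  have h2 : ∀ᶠ s in 𝓝 (0 : ℝ × ℝ × ℝ), ‖s.2.1‖ < 1 :=
    ((continuous_fst.comp continuous_snd).norm.tendsto' 0 0 (by simp)).eventually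
      (gt_mem_nhds one_pos)
  filter_upwards [h1, h2, (continuousAt_chebArg (k := k) hl).eventually eventually_chebSeq]
    with s hs1 hs2 hs3 p
  constructor
  · simp only [redAFam, BoundedContinuousFunction.mul_apply, BoundedContinuousFunction.add_apply,
      BoundedContinuousFunction.smul_apply, pull_apply, indFam_apply, geoSeq_apply hs1,
      geoSeq_apply hs2, hs3, redA, smul_eq_mul]
    split_ifs <;> ring
  · simp only [redBFam, BoundedContinuousFunction.mul_apply, BoundedContinuousFunction.add_apply,
      BoundedContinuousFunction.smul_apply, pull_apply, indFam_apply, geoSeq_apply hs1,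
      geoSeq_apply hs2, hs3, redB, smul_eq_mul]
    split_ifs <;> ring

lemma contDiffAt_redFam (k : ℕ) {l : ℕ} (hl : 1 ≤ l) :
    ContDiffAt ℝ ω (redAFam k l) 0 ∧ ContDiffAt ℝ ω (redBFam k l) 0 := by
  have hg {f : ℝ × ℝ × ℝ → ℝ} (hf : ContDiffAt ℝ ω f 0) (hn : f 0 = 0) (g : Idx → ℕ) :
      ContDiffAt ℝ ω (fun s => pull g (geoSeq (f s))) 0 :=
    contDiffAt_pull
      (ContDiffAt.comp (g := geoSeq) 0 (contDiffAt_geoSeq (by simp [hn])) hf) g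
  have hV (g : Idx → ℕ) : ContDiffAt ℝ ω
      (fun s : ℝ × ℝ × ℝ => pull g (chebSeq (s.2.2, s.1 ^ l * s.2.1 ^ k))) 0 := by
    refine contDiffAt_pull (ContDiffAt.comp (g := chebSeq)
      (f := fun s : ℝ × ℝ × ℝ => (s.2.2, s.1 ^ l * s.2.1 ^ k)) 0 ?_ (by fun_prop)) g
    rw [show ((0 : ℝ × ℝ × ℝ).2.2, (0 : ℝ × ℝ × ℝ).1 ^ l * (0 : ℝ × ℝ × ℝ).2.1 ^ k) = 0 by
      simp [zero_pow (by omega : l ≠ 0)]]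
    exact contDiffAt_chebSeq
  have h1 := hg (f := fun s : ℝ × ℝ × ℝ => s.1) contDiffAt_fst rfl (fun p => min p.1.1 p.2.1)
  have h2 := hg (f := fun s : ℝ × ℝ × ℝ => s.2.1) (by fun_prop) rfl (fun p => min p.1.2 p.2.2)
  have h3 : ContDiffAt ℝ ω (fun s : ℝ × ℝ × ℝ => -(s.1 ^ (l - 1) * s.2.1 ^ k)) 0 := by fun_prop
  have h4 : ContDiffAt ℝ ω (fun s : ℝ × ℝ × ℝ => -s.1) 0 := by fun_prop
  exact ⟨(contDiffAt_const.mul (h1.mul h2)).mul ((contDiffAt_const.mul (h3.smul (hV _))).add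
      (contDiffAt_const.mul (hV _))),
    (contDiffAt_const.mul (h1.mul h2)).mul ((contDiffAt_const.mul (hV _)).add
      (contDiffAt_const.mul (h4.smul (hV _))))⟩

lemma chebV_zero_zero : ∀ n, chebV 0 0 n = if n = 1 then 1 else 0
  | 0 => by simp [chebV]
  | 1 => by simp [chebV]
  | n + 2 => by simp [chebV]

/-- At vanishing invariants a nonzero value requires multiplicity 0 and no factor |Z₁|² or |Z₂|²,
that is, the monomial Z₁ itself, which has degree 1. -/
lemma redA_zero {k l : ℕ} (hk : 1 ≤ k) (hkl : Nat.Coprime k l) {p : Idx}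
    (hp : p.deg ≠ 1) : redA k l 0 p = 0 := by
  rw [redA]
  split_ifs with h1 h2
  · simp [zero_pow (by omega : k ≠ 0)]
  · obtain ⟨e1, e2⟩ := Idx.mult_spec hk hkl h1
    simp only [Prod.fst_zero, Prod.snd_zero, zero_pow (by omega : k ≠ 0), mul_zero,
      chebV_zero_zero, mul_ite, mul_one]
    split_ifs with h3
    · have h4 : p.mult k = 0 := by omega
      rw [h4, zero_mul] at e1 e2
      by_contra h5
      have h6 : min p.1.1 p.2.1 = 0 := by
        by_contra h; exact h5 (by rw [zero_pow h, zero_mul])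
      have h7 : min p.1.2 p.2.2 = 0 := by
        by_contra h; exact h5 (by rw [zero_pow h, mul_zero])
      simp only [Idx.deg] at hp
      omega
    · rfl
  · rfl

/-- At vanishing invariants only multiplicity 1 without factors |Z₁|² or |Z₂|² survives, which is
the exceptional monomial. This singles out the coefficient φ. -/
lemma redB_zero {k l : ℕ} (hk : 1 ≤ k) (hl : 1 ≤ l) (hkl : Nat.Coprime k l) (p : Idx) :
    redB k l 0 p = if p = ((0, k), (l - 1, 0)) then 1 else 0 := by
  have hk0 : (0 : ℝ) ^ k = 0 := zero_pow (by omega)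
  split_ifs with hp
  · subst hp
    have h1 : Idx.freq k l ((0, k), (l - 1, 0)) = k := by
      simp only [Idx.freq]
      push_cast [Nat.cast_sub hl]
      ring
    have h2 : Idx.mult k ((0, k), (l - 1, 0)) = 1 := by
      have hk0 : (k : ℤ) ≠ 0 := by exact_mod_cast (by omega : k ≠ 0)
      simpa [Idx.mult] using Int.ediv_self hk0
    simp [redB, h1, h2, chebV]
  · rw [redB]
    split_ifs with h1 h2
    · obtain ⟨e1, e2⟩ := Idx.mult_spec hk hkl h1
      simp only [Prod.fst_zero, Prod.snd_zero, hk0, mul_zero, chebV_zero_zero, mul_ite, mul_one]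
      split_ifs with h3
      · have h4 : p.mult k = 1 := by omega
        rw [h4] at e1 e2
        by_contra h5
        have h6 : min p.1.1 p.2.1 = 0 := by
          by_contra h; exact h5 (by rw [zero_pow h, zero_mul])
        have h7 : min p.1.2 p.2.2 = 0 := by
          by_contra h; exact h5 (by rw [zero_pow h, mul_zero])
        refine hp ?_
        ext <;> simp only <;> omega
      · rfl
    · simp
    · rfl

end

section

open Filter Topology BoundedContinuousFunction MeasureTheory AddCircle
open scoped ComplexConjugate

/-! ### Fourier coefficients of continuous functions -/

lemma integrable_continuousMap (U : C(Circ, ℂ)) : Integrable U haarAddCircle :=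
  U.continuous.integrable_of_hasCompactSupport (HasCompactSupport.of_compactSpace _)

/-- The `k`-th Fourier coefficient as a continuous linear functional. -/
def coeffC (k : ℤ) : C(Circ, ℂ) →L[ℂ] ℂ :=
  LinearMap.mkContinuous
    { toFun U := fourierCoeff U k
      map_add' U V := congrFun
        (fourierCoeff.add (integrable_continuousMap U) (integrable_continuousMap V)) k
      map_smul' c U := fourierCoeff.const_smul U c k } 1 (fun U => by
        rw [one_mul]
        refine (norm_integral_le_of_norm_le_const (C := ‖U‖) (.of_forall fun x => ?_)).trans ?_
        · rw [norm_smul]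
          have h1 : ‖(fourier (-k) : C(Circ, ℂ)) x‖ = 1 := by
            rw [fourier_apply]; exact Circle.norm_coe _
          rw [h1, one_mul]
          exact U.norm_coe_le_norm x
        · simp)

lemma coeffC_apply (k : ℤ) (U : C(Circ, ℂ)) : coeffC k U = fourierCoeff U k := rfl

lemma coeffC_fourier (k n : ℤ) : coeffC k (fourier n : C(Circ, ℂ)) = if k = n then 1 else 0 := by
  rw [coeffC_apply, fourierCoeff_fourier, Pi.single_apply]

lemma eq_of_coeffC {U V : C(Circ, ℂ)} (h : ∀ k, coeffC k U = coeffC k V) : U = V := by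
  have h1 : fourierCoeff (U - V) = 0 := by
    funext k
    change coeffC k (U - V) = 0
    rw [map_sub, h, sub_self]
  have hs : Summable (fourierCoeff (U - V)) := by rw [h1]; exact summable_zero
  have h2 := hasSum_fourier_series_of_summable (f := U - V) hs
  have h3 : (fun i : ℤ => fourierCoeff (U - V) i • (fourier i : C(Circ, ℂ))) = fun _ => 0 := by
    funext i
    rw [h1]
    simp
  have h4 := h2.unique (h3 ▸ hasSum_zero)
  exact sub_eq_zero.1 h4

/-- The complexification of a real-valued function. -/
def toC : C(Circ, ℝ) →L[ℝ] C(Circ, ℂ) := Complex.ofRealCLM.compLeftContinuous ℝ Circ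

/-- The real part of a complex-valued function. -/
def reC : C(Circ, ℂ) →L[ℝ] C(Circ, ℝ) := Complex.reCLM.compLeftContinuous ℝ Circ

@[simp] lemma toC_apply (u : C(Circ, ℝ)) (x : Circ) : toC u x = (u x : ℂ) := rfl

@[simp] lemma reC_apply (U : C(Circ, ℂ)) (x : Circ) : reC U x = (U x).re := rfl

lemma coeff_eq (u : C(Circ, ℝ)) (k : ℤ) : coeff u k = coeffC k (toC u) := rfl

lemma norm_toC (u : C(Circ, ℝ)) : ‖toC u‖ = ‖u‖ := by
  refine le_antisymm ((ContinuousMap.norm_le _ (norm_nonneg _)).2 fun x => ?_)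
    ((ContinuousMap.norm_le _ (norm_nonneg _)).2 fun x => ?_)
  · rw [toC_apply, Complex.norm_real]
    exact u.norm_coe_le_norm x
  · rw [← Complex.norm_real, ← toC_apply]
    exact (toC u).norm_coe_le_norm x

lemma toC_pow (u : C(Circ, ℝ)) (n : ℕ) : toC (u ^ n) = toC u ^ n := by
  ext x
  simp

lemma coeffC_star (k : ℤ) (U : C(Circ, ℂ)) : coeffC k (star U) = conj (coeffC (-k) U) := by
  rw [coeffC_apply, coeffC_apply, fourierCoeff, fourierCoeff, ← integral_conj]
  congr 1
  funext x
  simp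

lemma coeff_neg (u : C(Circ, ℝ)) (k : ℤ) : coeff u (-k) = conj (coeff u k) := by
  have h : star (toC u) = toC u := by
    ext x
    simp
  rw [coeff_eq, ← h, coeffC_star, neg_neg, coeff_eq]

/-- The Parseval identity. -/
lemma hasSum_coeffC_mul (f g : C(Circ, ℂ)) :
    HasSum (fun k : ℤ => coeffC (-k) f * coeffC k g) (coeffC 0 (f * g)) := by
  have h1 := (fourierBasis (T := 2 * Real.pi)).hasSum_inner_mul_inner
    (ContinuousMap.toLp (E := ℂ) 2 haarAddCircle ℂ (star f))
    (ContinuousMap.toLp (E := ℂ) 2 haarAddCircle ℂ g)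
  have e2 : inner ℂ (ContinuousMap.toLp (E := ℂ) 2 haarAddCircle ℂ (star f))
      (ContinuousMap.toLp (E := ℂ) 2 haarAddCircle ℂ g) = coeffC 0 (f * g) := by
    rw [ContinuousMap.inner_toLp, coeffC_apply, fourierCoeff]
    congr 1
    funext x
    simp [mul_comm]
  rw [e2] at h1
  convert! h1 using 2 with k
  have e3 (U : C(Circ, ℂ)) : inner ℂ (fourierBasis (T := 2 * Real.pi) k)
      (ContinuousMap.toLp (E := ℂ) 2 haarAddCircle ℂ U) = coeffC k U := by
    rw [← HilbertBasis.repr_apply_apply, fourierBasis_repr, fourierCoeff_toLp, coeffC_apply]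
  rw [e3, ← inner_conj_symm, e3, coeffC_star]
  simp

lemma hasSum_norm_sq_coeffC (f : C(Circ, ℂ)) :
    HasSum (fun k : ℤ => ‖coeffC k f‖ ^ 2) (∫ x, ‖f x‖ ^ 2 ∂(haarAddCircle (T := 2 * Real.pi))) := by
  have h := hasSum_sq_fourierCoeff (ContinuousMap.toLp (E := ℂ) 2 haarAddCircle ℂ f)
  have e : ∫ t : Circ, ‖ContinuousMap.toLp (E := ℂ) 2 haarAddCircle ℂ f t‖ ^ 2 ∂haarAddCircle =
      ∫ x, ‖f x‖ ^ 2 ∂(haarAddCircle (T := 2 * Real.pi)) := by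
    refine integral_congr_ae ?_
    filter_upwards [ContinuousMap.coeFn_toLp (E := ℂ) (p := 2) (𝕜 := ℂ) haarAddCircle f] with x hx
    rw [hx]
  rw [e] at h
  simp only [fourierCoeff_toLp] at h
  exact h

/-- By Parseval the hypothesis gives ‖d‖ ≤ B‖gd‖ ≤ B‖g‖_∞‖d‖ in L², with B‖g‖_∞ < 1. Working in L²
avoids any product estimate in Zygmund spaces. -/
lemma eq_zero_of_norm_coeffC_le {d g : C(Circ, ℂ)} {B : ℝ}
    (h : ∀ k, ‖coeffC k d‖ ≤ B * ‖coeffC k (g * d)‖) (hB : 0 ≤ B) (hg : B * ‖g‖ < 1) : d = 0 := by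
  have h1 := hasSum_norm_sq_coeffC d
  have h2 := (hasSum_norm_sq_coeffC (g * d)).mul_left (B ^ 2)
  have hi (f : C(Circ, ℂ)) : Integrable (fun x => ‖f x‖ ^ 2) (haarAddCircle (T := 2 * Real.pi)) :=
    (by fun_prop : Continuous fun x => ‖f x‖ ^ 2).integrable_of_hasCompactSupport
      (HasCompactSupport.of_compactSpace _)
  have h3 := hasSum_le (fun k => by
    rw [← mul_pow]
    exact pow_le_pow_left₀ (norm_nonneg _) (h k) 2) h1 h2
  have h4 : ∫ x, ‖(g * d) x‖ ^ 2 ∂(haarAddCircle (T := 2 * Real.pi)) ≤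
      ‖g‖ ^ 2 * ∫ x, ‖d x‖ ^ 2 ∂(haarAddCircle (T := 2 * Real.pi)) := by
    rw [← integral_const_mul]
    refine integral_mono (hi _) ((hi d).const_mul _) fun x => ?_
    simp only [ContinuousMap.mul_apply, norm_mul, mul_pow]
    have := g.norm_coe_le_norm x
    gcongr
  set D := ∫ x, ‖d x‖ ^ 2 ∂(haarAddCircle (T := 2 * Real.pi)) with hD
  have hD0 : 0 ≤ D := integral_nonneg fun x => by positivity
  have h5 : D ≤ (B * ‖g‖) ^ 2 * D := by
    rw [mul_pow, mul_assoc]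
    exact h3.trans (mul_le_mul_of_nonneg_left h4 (by positivity))
  have h6 : (B * ‖g‖) ^ 2 < 1 := by
    have : 0 ≤ B * ‖g‖ := by positivity
    nlinarith
  have h7 : D = 0 := by nlinarith
  rw [h7] at h1
  refine eq_of_coeffC fun k => ?_
  have h8 := (hasSum_zero_iff_of_nonneg (fun k => by positivity)).1 h1
  have h9 : ‖coeffC k d‖ ^ 2 = 0 := congrFun h8 k
  simpa using h9

/-- Small solutions of the equations of order different from `k₁` and `k₂` are determined by their
Fourier coefficients of order `k₁` and `k₂`. -/
lemma eq_of_coeff_eq_of_J_eq_zero {k₁ k₂ : ℕ} {c κ T B : ℝ} {u v : C(Circ, ℝ)}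
    (hu : ∀ k : ℤ, k.natAbs ≠ k₁ → k.natAbs ≠ k₂ → J u c κ T k = 0)
    (hv : ∀ k : ℤ, k.natAbs ≠ k₁ → k.natAbs ≠ k₂ → J v c κ T k = 0)
    (hc : ∀ k : ℤ, k.natAbs ≠ k₁ → k.natAbs ≠ k₂ → c - m T (κ * k) ≠ 0)
    (hB : ∀ k : ℤ, |ell k₁ k₂ c κ T k| ≤ B)
    (h1 : coeff u k₁ = coeff v k₁) (h2 : coeff u k₂ = coeff v k₂)
    (hsmall : B * ‖u + v‖ < 1) : u = v := by
  have hB0 : 0 ≤ B := (abs_nonneg _).trans (hB 0)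
  have hnat {k : ℤ} {n : ℕ} (hn : k.natAbs = n) (h : coeff u n = coeff v n) :
      coeff u k = coeff v k := by
    rcases Int.natAbs_eq k with e | e <;> rw [e, hn]
    · exact h
    · rw [coeff_neg, coeff_neg, h]
  have hz : toC (u - v) = 0 := by
    refine eq_zero_of_norm_coeffC_le (g := toC (u + v)) (B := B) (fun k => ?_) hB0
      (by rwa [norm_toC])
    rw [map_sub, map_sub, ← coeff_eq, ← coeff_eq]
    by_cases hk1 : k.natAbs = k₁
    · rw [hnat hk1 h1, sub_self, norm_zero]
      positivity
    by_cases hk2 : k.natAbs = k₂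
    · rw [hnat hk2 h2, sub_self, norm_zero]
      positivity
    have e1 : toC (u + v) * (toC u - toC v) = toC (u ^ 2) - toC (v ^ 2) := by
      rw [toC_pow, toC_pow, map_add]
      ring
    -- Subtracting the equations gives d = L(u² − v²) with u² − v² = (u + v)d, a contraction when u
    -- + v is small.
    have e2 : coeff u k - coeff v k =
        (ell k₁ k₂ c κ T k : ℂ) * (coeff (u ^ 2) k - coeff (v ^ 2) k) := by
      have a1 := hu k hk1 hk2
      have a2 := hv k hk1 hk2
      have a3 : ((c - m T (κ * k) : ℝ) : ℂ) ≠ 0 := by exact_mod_cast hc k hk1 hk2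
      rw [ell, if_neg (by tauto)]
      rw [J] at a1 a2
      have e : (((c - m T (κ * k))⁻¹ : ℝ) : ℂ) = ((c - m T (κ * k) : ℝ) : ℂ)⁻¹ :=
        Complex.ofReal_inv _
      rw [e, eq_inv_mul_iff_mul_eq₀ a3]
      push_cast at a1 a2 ⊢
      linear_combination -a1 + a2
    rw [e1, map_sub, ← coeff_eq, ← coeff_eq, e2, norm_mul, Complex.norm_real]
    exact mul_le_mul_of_nonneg_right (hB k) (norm_nonneg _)
  have h3 : ‖u - v‖ = 0 := by rw [← norm_toC, hz, norm_zero]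
  exact sub_eq_zero.1 (norm_eq_zero.1 h3)

end

section

open Filter Topology BoundedContinuousFunction MeasureTheory AddCircle
open scoped ComplexConjugate

/-! ### Zygmund norms of Fourier series with decaying coefficients -/

lemma toC_reC (U : C(Circ, ℂ)) : toC (reC U) = (2⁻¹ : ℂ) • (U + star U) := by
  ext x
  simp [Complex.re_eq_add_conj]
  ring

lemma norm_fourier' (k : ℤ) : ‖(fourier k : C(Circ, ℂ))‖ = 1 := fourier_norm k

lemma star_fourier (k : ℤ) : star (fourier k : C(Circ, ℂ)) = fourier (-k) := by
  ext x
  simp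

/-- The dyadic blocks of complex-valued functions. -/
def blockC (χ : LPCutoff) (j : ℕ) : C(Circ, ℂ) →L[ℂ] C(Circ, ℂ) :=
  ∑ k ∈ Finset.Icc (-(2 : ℤ) ^ (j + 1)) (2 ^ (j + 1)),
    ((χ.symbol j (k : ℝ) : ℝ) : ℂ) • (coeffC k).smulRight (fourier k : C(Circ, ℂ))

lemma blockC_apply (χ : LPCutoff) (j : ℕ) (U : C(Circ, ℂ)) : blockC χ j U =
    ∑ k ∈ Finset.Icc (-(2 : ℤ) ^ (j + 1)) (2 ^ (j + 1)),
      (((χ.symbol j (k : ℝ) : ℝ) : ℂ) * coeffC k U) • (fourier k : C(Circ, ℂ)) := by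
  rw [blockC, _root_.sum_apply]
  refine Finset.sum_congr rfl fun k _ => ?_
  rw [_root_.smul_apply, ContinuousLinearMap.smulRight_apply, smul_smul]

lemma block_eq (χ : LPCutoff) (j : ℕ) (u : C(Circ, ℝ)) : block χ j u = blockC χ j (toC u) := by
  rw [blockC_apply]
  rfl

lemma coeffC_blockC (χ : LPCutoff) (j : ℕ) (U : C(Circ, ℂ)) (k : ℤ) :
    coeffC k (blockC χ j U) = ((χ.symbol j (k : ℝ) : ℝ) : ℂ) * coeffC k U := by
  simp only [blockC_apply, map_sum, map_smul, coeffC_fourier, smul_eq_mul, mul_ite, mul_one,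
    mul_zero, Finset.sum_ite_eq]
  split_ifs with h
  · rfl
  · rw [symbol_eq_zero χ j k h]
    simp

lemma blockC_fourier (χ : LPCutoff) (j : ℕ) (k : ℤ) :
    blockC χ j (fourier k) = ((χ.symbol j (k : ℝ) : ℝ) : ℂ) • (fourier k : C(Circ, ℂ)) := by
  refine eq_of_coeffC fun l => ?_
  rw [coeffC_blockC, map_smul, coeffC_fourier, smul_eq_mul]
  split_ifs with h
  · rw [h]
  · simp

lemma exists_norm_symbol_le (χ : LPCutoff) : ∃ S, ∀ j ξ, |χ.symbol j ξ| ≤ S := by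
  obtain ⟨S, hS⟩ := (isCompact_Icc (a := (-2 : ℝ)) (b := 2)).exists_bound_of_continuousOn
    χ.smooth.continuous.continuousOn
  have h (ξ : ℝ) : |χ.toFun ξ| ≤ max S 0 := by
    rcases le_total 2 |ξ| with h | h
    · rw [χ.eq_zero ξ h, abs_zero]
      exact le_max_right _ _
    · exact (hS ξ (abs_le.1 h)).trans (le_max_left _ _)
  refine ⟨max S 0 + max S 0, fun j ξ => ?_⟩
  cases j with
  | zero => exact (h ξ).trans (le_add_of_nonneg_right (le_max_right _ _))
  | succ j => exact (abs_sub _ _).trans (add_le_add (h _) (h _))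

/-- For smaller |ξ| both cut-offs in the difference equal 1: the j-th block only sees frequencies of
size at least comparable to 2ʲ. -/
lemma two_pow_le_of_symbol_ne_zero (χ : LPCutoff) {j : ℕ} {ξ : ℝ} (h : χ.symbol j ξ ≠ 0) :
    (2 : ℝ) ^ j ≤ 1 + 2 * |ξ| := by
  cases j with
  | zero => simp
  | succ j =>
    by_contra! hlt
    have h2 : (0 : ℝ) < 2 ^ j := by positivity
    rw [pow_succ] at hlt
    refine h ?_
    rw [LPCutoff.symbol, χ.eq_one, χ.eq_one, sub_self]
    · rw [abs_div, abs_of_pos h2, div_le_one h2]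
      linarith
    · rw [abs_div, abs_of_pos (by positivity : (0 : ℝ) < 2 ^ (j + 1)), div_le_one (by positivity),
        pow_succ]
      linarith [abs_nonneg ξ]

/-- Polynomial growth is beaten by 2^d. This lets the factor 2^{-deg} in `trigFam` pay for the
Zygmund weight of a frequency bounded by a multiple of the degree. -/
lemma exists_rpow_le_two_pow (s : ℝ) {K : ℝ} (hK : 0 ≤ K) :
    ∃ C, 0 ≤ C ∧ ∀ d : ℕ, (1 + K * d) ^ s ≤ C * 2 ^ d := by
  obtain ⟨n, hn⟩ := exists_nat_ge s
  obtain ⟨B, hB⟩ := (tendsto_pow_const_div_const_pow_of_one_lt n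
    (one_lt_two : (1 : ℝ) < 2)).bddAbove_range
  have hB0 : 0 ≤ B := le_trans (by positivity) (hB ⟨0, rfl⟩)
  refine ⟨(1 + K) ^ n * (2 * B), by positivity, fun d => ?_⟩
  have h1 : ((d + 1 : ℕ) : ℝ) ^ n ≤ B * 2 ^ (d + 1) := by
    rw [← div_le_iff₀ (by positivity)]
    exact hB ⟨d + 1, rfl⟩
  calc (1 + K * d) ^ s ≤ (1 + K * d) ^ (n : ℝ) :=
        Real.rpow_le_rpow_of_exponent_le (by nlinarith [show (0 : ℝ) ≤ d by positivity]) hn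
    _ = (1 + K * d) ^ n := Real.rpow_natCast _ _
    _ ≤ ((1 + K) * (d + 1 : ℕ)) ^ n := by
        gcongr
        push_cast
        nlinarith [show (0 : ℝ) ≤ d by positivity]
    _ ≤ (1 + K) ^ n * (B * 2 ^ (d + 1)) := by
        rw [mul_pow]
        gcongr
    _ = _ := by ring

lemma Idx.abs_freq_le (k₁ k₂ : ℕ) (p : Idx) :
    |(p.freq k₁ k₂ : ℝ)| ≤ (k₁ + k₂ : ℝ) * p.deg := by
  simp only [Idx.freq, Idx.deg]
  push_cast
  have h1 : (0 : ℝ) ≤ k₁ := by positivity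
  have h2 : (0 : ℝ) ≤ k₂ := by positivity
  have h3 : (0 : ℝ) ≤ p.1.1 := by positivity
  have h4 : (0 : ℝ) ≤ p.1.2 := by positivity
  have h5 : (0 : ℝ) ≤ p.2.1 := by positivity
  have h6 : (0 : ℝ) ≤ p.2.2 := by positivity
  rw [abs_le]
  constructor <;> nlinarith [mul_nonneg h1 h3, mul_nonneg h1 h4, mul_nonneg h1 h5,
    mul_nonneg h1 h6, mul_nonneg h2 h3, mul_nonneg h2 h4, mul_nonneg h2 h5, mul_nonneg h2 h6]

/-- The trigonometric monomials `2^{-|α|-|β|} N_{α,β} e_{k(α,β)}`. -/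
def trigFam (k₁ k₂ : ℕ) : (Idx →ᵇ ℂ) →L[ℝ] (Idx →ᵇ C(Circ, ℂ)) :=
  have hb (N : Idx →ᵇ ℂ) (p : Idx) :
      ‖(((2 : ℝ)⁻¹ ^ p.deg : ℝ) • N p) • (fourier (p.freq k₁ k₂) : C(Circ, ℂ))‖ ≤ ‖N‖ := by
    rw [norm_smul, norm_fourier', mul_one, norm_smul, Real.norm_of_nonneg (by positivity)]
    exact (mul_le_of_le_one_left (norm_nonneg _) (pow_le_one₀ (by norm_num) (by norm_num))).trans
      (N.norm_coe_le_norm p)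
  LinearMap.mkContinuous
    { toFun N := ofNormedAddCommGroupDiscrete (fun p : Idx => (((2 : ℝ)⁻¹ ^ p.deg : ℝ) • N p) •
        (fourier (p.freq k₁ k₂) : C(Circ, ℂ))) ‖N‖ (hb N)
      map_add' N N' := by
        ext p : 1
        change (((2 : ℝ)⁻¹ ^ p.deg : ℝ) • (N p + N' p)) • (fourier (p.freq k₁ k₂) : C(Circ, ℂ)) =
          (((2 : ℝ)⁻¹ ^ p.deg : ℝ) • N p) • (fourier (p.freq k₁ k₂) : C(Circ, ℂ)) +
          (((2 : ℝ)⁻¹ ^ p.deg : ℝ) • N' p) • (fourier (p.freq k₁ k₂) : C(Circ, ℂ))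
        rw [smul_add, add_smul]
      map_smul' c N := by
        ext p : 1
        change (((2 : ℝ)⁻¹ ^ p.deg : ℝ) • (c • N p)) • (fourier (p.freq k₁ k₂) : C(Circ, ℂ)) =
          c • ((((2 : ℝ)⁻¹ ^ p.deg : ℝ) • N p) • (fourier (p.freq k₁ k₂) : C(Circ, ℂ)))
        rw [smul_comm, smul_assoc] } 1
    (fun N => by
      rw [one_mul]
      exact (BoundedContinuousFunction.norm_le (norm_nonneg _)).2 (hb N))

lemma trigFam_apply (k₁ k₂ : ℕ) (N : Idx →ᵇ ℂ) (p : Idx) : trigFam k₁ k₂ N p =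
    (((2 : ℝ)⁻¹ ^ p.deg : ℝ) • N p) • (fourier (p.freq k₁ k₂) : C(Circ, ℂ)) := rfl

lemma norm_blockC_le (χ : LPCutoff) (j : ℕ) (n : ℂ) (k : ℤ) {R : ℝ}
    (h : |χ.symbol j k| ≤ R) (h' : |χ.symbol j (-k : ℤ)| ≤ R) :
    ‖blockC χ j (toC (reC (n • (fourier k : C(Circ, ℂ)))))‖ ≤ R * ‖n‖ := by
  rw [toC_reC, star_smul, star_fourier, map_smul, map_add, map_smul, map_smul, blockC_fourier,
    blockC_fourier, norm_smul]
  refine (mul_le_mul_of_nonneg_left (norm_add_le _ _) (norm_nonneg _)).trans ?_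
  simp only [norm_smul, norm_fourier', mul_one, Complex.norm_real, Real.norm_eq_abs, norm_star]
  have h0 := norm_nonneg n
  have e : ‖(2⁻¹ : ℂ)‖ = 2⁻¹ := by simp
  rw [e]
  nlinarith [mul_le_mul_of_nonneg_left h h0, mul_le_mul_of_nonneg_left h' h0]

/-- A term of degree d has frequency at most (k₁ + k₂)d, so a block j that sees it satisfies 2^{js}
≤ C 2^d, which the factor 2^{-d} in `trigFam` compensates. Summation uses that `a` lies in ℓ¹. -/
lemma exists_block_trigFam_le (χ : LPCutoff) {s : ℝ} (hs : 0 < s) (k₁ k₂ : ℕ) :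
    ∃ C, 0 ≤ C ∧ ∀ (N : Idx →ᵇ ℂ) (a : L1 Idx) (j : ℕ),
      zTerm χ s (reC (pair (trigFam k₁ k₂ N) a)) j ≤ C * ‖N‖ * ‖a‖ := by
  obtain ⟨S, hS⟩ := exists_norm_symbol_le χ
  obtain ⟨C, hC0, hC⟩ := exists_rpow_le_two_pow s (K := 2 * (k₁ + k₂)) (by positivity)
  have hS0 : 0 ≤ S := (abs_nonneg _).trans (hS 0 0)
  refine ⟨S * C, by positivity, fun N a j => ?_⟩
  have hw : (0 : ℝ) < 2 ^ ((j : ℝ) * s) := by positivity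
  have hsym (p : Idx) (k : ℤ) (hk : |(k : ℝ)| = |(p.freq k₁ k₂ : ℝ)|) :
      |χ.symbol j k| ≤ S * C * 2 ^ p.deg / 2 ^ ((j : ℝ) * s) := by
    rw [le_div_iff₀ hw]
    by_cases h0 : χ.symbol j k = 0
    · rw [h0, abs_zero, zero_mul]
      positivity
    · have h1 : (2 : ℝ) ^ ((j : ℝ) * s) ≤ C * 2 ^ p.deg := by
        rw [Real.rpow_mul zero_le_two, Real.rpow_natCast]
        refine le_trans (Real.rpow_le_rpow (by positivity) ?_ hs.le) (hC p.deg)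
        have h2 := two_pow_le_of_symbol_ne_zero χ h0
        have h3 := Idx.abs_freq_le k₁ k₂ p
        rw [hk] at h2
        linarith
      rw [mul_assoc]
      exact mul_le_mul (hS _ _) h1 hw.le hS0
  let Φ : C(Circ, ℂ) →L[ℝ] C(Circ, ℂ) :=
    ((blockC χ j).restrictScalars ℝ) ∘L (toC ∘L reC)
  have h1 := (hasSum_pair (trigFam k₁ k₂ N) a).mapL Φ
  have h2 (p : Idx) : ‖Φ (a p • trigFam k₁ k₂ N p)‖ ≤
      (S * C / 2 ^ ((j : ℝ) * s) * ‖N‖) * |a p| := by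
    rw [map_smul, norm_smul, Real.norm_eq_abs, mul_comm]
    refine mul_le_mul_of_nonneg_right ?_ (abs_nonneg _)
    rw [trigFam_apply]
    refine (norm_blockC_le χ j _ _ (hsym p _ rfl) (hsym p _ (by simp))).trans ?_
    rw [norm_smul, Real.norm_of_nonneg (by positivity)]
    have h3 := N.norm_coe_le_norm p
    have h4 : (2 : ℝ) ^ p.deg * 2⁻¹ ^ p.deg = 1 := by rw [← mul_pow]; norm_num
    calc S * C * 2 ^ p.deg / 2 ^ ((j : ℝ) * s) * (2⁻¹ ^ p.deg * ‖N p‖)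
        = S * C / 2 ^ ((j : ℝ) * s) * ‖N p‖ * (2 ^ p.deg * 2⁻¹ ^ p.deg) := by ring
      _ ≤ _ := by
        rw [h4, mul_one]
        gcongr
  have h5 := tsum_of_norm_bounded ((L1.hasSum_norm a).mul_left _) h2
  rw [h1.tsum_eq] at h5
  rw [zTerm, block_eq]
  refine (mul_le_mul_of_nonneg_left h5 hw.le).trans (le_of_eq ?_)
  field_simp

lemma Zygmund.toCont_injective {χ : LPCutoff} {s : ℝ} {u v : Zygmund χ s}
    (h : u.toCont = v.toCont) : u = v := Subtype.ext h

/-- The real parts of Fourier series as elements of the Zygmund space. -/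
lemma exists_zyg (χ : LPCutoff) {s : ℝ} (hs : 0 < s) (k₁ k₂ : ℕ) :
    ∃ Φ : (Idx →ᵇ ℂ) →L[ℝ] L1 Idx →L[ℝ] Zygmund χ s,
      ∀ N a, (Φ N a).toCont = reC (pair (trigFam k₁ k₂ N) a) := by
  obtain ⟨C, hC0, hC⟩ := exists_block_trigFam_le χ hs k₁ k₂
  let Ψ (N : Idx →ᵇ ℂ) (a : L1 Idx) : zygmundSubmodule χ s :=
    ⟨reC (pair (trigFam k₁ k₂ N) a), ⟨C * ‖N‖ * ‖a‖, by
      rintro _ ⟨j, rfl⟩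
      exact hC N a j⟩⟩
  let Φ (N : Idx →ᵇ ℂ) (a : L1 Idx) : Zygmund χ s := Ψ N a
  refine ⟨LinearMap.mkContinuous₂ (LinearMap.mk₂ ℝ Φ
    (fun N N' a => Zygmund.toCont_injective (by
      change reC (pair (trigFam k₁ k₂ (N + N')) a) =
        reC (pair (trigFam k₁ k₂ N) a) + reC (pair (trigFam k₁ k₂ N') a)
      simp))
    (fun c N a => Zygmund.toCont_injective (by
      change reC (pair (trigFam k₁ k₂ (c • N)) a) = c • reC (pair (trigFam k₁ k₂ N) a)
      simp))
    (fun N a b => Zygmund.toCont_injective (by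
      change reC (pair (trigFam k₁ k₂ N) (a + b)) =
        reC (pair (trigFam k₁ k₂ N) a) + reC (pair (trigFam k₁ k₂ N) b)
      simp))
    (fun c N a => Zygmund.toCont_injective (by
      change reC (pair (trigFam k₁ k₂ N) (c • a)) = c • reC (pair (trigFam k₁ k₂ N) a)
      simp))) C (fun N a => ?_), fun N a => rfl⟩
  change ‖Φ N a‖ ≤ _
  rw [Zygmund.norm_def]
  exact ciSup_le fun j => hC N a j

lemma hasSum_symbol (χ : LPCutoff) (ξ : ℝ) : HasSum (fun j => χ.symbol j ξ) 1 := by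
  obtain ⟨n, hn⟩ := pow_unbounded_of_one_lt (1 + 2 * |ξ|) (one_lt_two)
  have h0 (j : ℕ) (hj : j ∉ Finset.range (n + 1)) : χ.symbol j ξ = 0 := by
    by_contra h
    have h1 := two_pow_le_of_symbol_ne_zero χ h
    have h2 : (2 : ℝ) ^ n ≤ 2 ^ j :=
      pow_le_pow_right₀ one_le_two (Nat.le_of_succ_le (by simpa using hj))
    linarith
  have h := hasSum_sum_of_ne_finset_zero (L := .unconditional _) h0
  rwa [sum_symbol, χ.eq_one] at h
  rw [abs_div, abs_of_pos (by positivity : (0 : ℝ) < 2 ^ n), div_le_one (by positivity)]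
  linarith [abs_nonneg ξ]

lemma zTerm_le_norm {χ : LPCutoff} {s : ℝ} (u : Zygmund χ s) (j : ℕ) :
    zTerm χ s u.toCont j ≤ ‖u‖ := le_ciSup u.bdd j

/-- The Zygmund norm controls the uniform norm. -/
lemma exists_norm_toCont_le (χ : LPCutoff) {s : ℝ} (hs : 0 < s) :
    ∃ C, ∀ u : Zygmund χ s, ‖u.toCont‖ ≤ C * ‖u‖ := by
  have hq1 : (2 : ℝ) ^ (-s) < 1 := Real.rpow_lt_one_of_one_lt_of_neg one_lt_two (by linarith)
  have hq0 : (0 : ℝ) ≤ 2 ^ (-s) := by positivity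
  have hgeo := hasSum_geometric_of_lt_one hq0 hq1
  refine ⟨(1 - (2 : ℝ) ^ (-s))⁻¹, fun u => ?_⟩
  have hb (j : ℕ) : ‖block χ j u.toCont‖ ≤ ((2 : ℝ) ^ (-s)) ^ j * ‖u‖ := by
    have h1 := zTerm_le_norm u j
    have hw : (0 : ℝ) < 2 ^ ((j : ℝ) * s) := by positivity
    have h2 : ((2 : ℝ) ^ (-s)) ^ j * 2 ^ ((j : ℝ) * s) = 1 := by
      rw [← Real.rpow_natCast, ← Real.rpow_mul zero_le_two, ← Real.rpow_add two_pos]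
      ring_nf
      exact Real.rpow_zero _
    rw [zTerm] at h1
    calc ‖block χ j u.toCont‖ = (((2 : ℝ) ^ (-s)) ^ j * 2 ^ ((j : ℝ) * s)) *
          ‖block χ j u.toCont‖ := by rw [h2, one_mul]
      _ = ((2 : ℝ) ^ (-s)) ^ j * (2 ^ ((j : ℝ) * s) * ‖block χ j u.toCont‖) := by ring
      _ ≤ _ := mul_le_mul_of_nonneg_left h1 (by positivity)
  have hsum : Summable fun j => block χ j u.toCont :=
    .of_norm_bounded (hgeo.summable.mul_right _) hb
  -- The block bounds sum as a geometric series because s > 0; the sum is identified by its Fourier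
  -- coefficients, the symbols adding up to 1.
  have h3 : toC u.toCont = ∑' j, block χ j u.toCont := by
    refine eq_of_coeffC fun k => ?_
    have h4 := hsum.hasSum.mapL (coeffC k)
    have h5 := (Complex.hasSum_ofReal.2 (hasSum_symbol χ k)).mul_right (coeffC k (toC u.toCont))
    rw [Complex.ofReal_one, one_mul] at h5
    refine h5.unique ?_
    simp only [block_eq, coeffC_blockC] at h4
    simpa only [block_eq] using h4
  rw [← norm_toC, h3]
  exact tsum_of_norm_bounded (hgeo.mul_right _) hb

/-- The inclusion of the Zygmund space in the continuous functions. -/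
lemma exists_toContL (χ : LPCutoff) {s : ℝ} (hs : 0 < s) :
    ∃ ι : Zygmund χ s →L[ℝ] C(Circ, ℝ), ∀ u, ι u = u.toCont := by
  obtain ⟨C, hC⟩ := exists_norm_toCont_le χ hs
  exact ⟨LinearMap.mkContinuous
    { toFun := Zygmund.toCont
      map_add' := fun _ _ => rfl
      map_smul' := fun _ _ => rfl } C hC, fun _ => rfl⟩

end

section

open Filter Topology BoundedContinuousFunction MeasureTheory AddCircle
open scoped ComplexConjugate

/-! ### The wave with given coefficients of order `k₁` and `k₂` -/

lemma mono_smul (r : ℝ) (Z : ℂ × ℂ) (p : Idx) : mono (r • Z) p = r ^ p.deg * mono Z p := by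
  simp only [mono, Idx.deg, Prod.smul_fst, Prod.smul_snd, Complex.real_smul, map_mul,
    Complex.conj_ofReal, mul_pow, pow_add]
  ring

/-- The trigonometric monomials `Z^α Z̄^β e_{k(α,β)}`, for `|Z₁|, |Z₂| < 1/2`. -/
def waveFam (k₁ k₂ : ℕ) (Z : ℂ × ℂ) : Idx →ᵇ C(Circ, ℂ) :=
  trigFam k₁ k₂ (monoFam ((2 : ℝ) • Z))

/-- The functions `f` with `f_{α,β} = û_{α,β} t^{|α|+|β|}`, together with the corresponding identity
for the square. -/
def IsCoeffFamily (k₁ k₂ : ℕ) (c κ T t : ℝ) (a : L1 Idx) : Prop :=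
  ∀ p : Idx, a p = uHat k₁ k₂ c κ T p * t ^ p.deg ∧
    conv a a p = uSqHat k₁ k₂ c κ T p * t ^ p.deg

section Wave

variable {k₁ k₂ : ℕ} {c κ T t : ℝ} {a : L1 Idx} {Z : ℂ × ℂ}

lemma norm_two_smul_lt {Z : ℂ × ℂ} (hZ : ‖Z‖ < 1 / 2) :
    ‖((2 : ℝ) • Z).1‖ < 1 ∧ ‖((2 : ℝ) • Z).2‖ < 1 := by
  have h : ‖(2 : ℝ) • Z‖ < 1 := by
    rw [norm_smul]
    norm_num
    linarith
  exact ⟨(norm_fst_le _).trans_lt h, (norm_snd_le _).trans_lt h⟩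

lemma waveFam_apply (hZ : ‖Z‖ < 1 / 2) (p : Idx) :
    waveFam k₁ k₂ Z p = mono Z p • (fourier (p.freq k₁ k₂) : C(Circ, ℂ)) := by
  obtain ⟨h1, h2⟩ := norm_two_smul_lt hZ
  have e : (((2 : ℝ)⁻¹ ^ p.deg : ℝ) : ℂ) * ((2 : ℝ) : ℂ) ^ p.deg = 1 := by
    push_cast
    rw [← mul_pow]
    norm_num
  rw [waveFam, trigFam_apply, monoFam_apply h1 h2, mono_smul, Complex.real_smul, ← mul_assoc, e,
    one_mul]

lemma waveFam_add (hZ : ‖Z‖ < 1 / 2) (p q : Idx) :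
    waveFam k₁ k₂ Z (p + q) = waveFam k₁ k₂ Z p * waveFam k₁ k₂ Z q := by
  rw [waveFam_apply hZ, waveFam_apply hZ, waveFam_apply hZ, mono_add, Idx.freq_add,
    smul_mul_smul_comm]
  congr 1
  ext x
  simp

lemma waveFam_swap (hZ : ‖Z‖ < 1 / 2) (p : Idx) :
    waveFam k₁ k₂ Z p.swap = star (waveFam k₁ k₂ Z p) := by
  rw [waveFam_apply hZ, waveFam_apply hZ, mono_swap, Idx.freq_swap, star_smul, star_fourier]
  rfl

/-- Conjugation exchanges the terms with indices p and `p.swap`, whose coefficients agree; so the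
sum is already real and taking the real part loses nothing. -/
lemma toC_reC_pair_waveFam (hZ : ‖Z‖ < 1 / 2) (ha : ∀ p : Idx, a p.swap = a p) :
    toC (reC (pair (waveFam k₁ k₂ Z) a)) = pair (waveFam k₁ k₂ Z) a := by
  have h1 := hasSum_pair (waveFam k₁ k₂ Z) a
  have h2 : HasSum (fun p : Idx => star (a p • waveFam k₁ k₂ Z p))
    (star (pair (waveFam k₁ k₂ Z) a)) := h1.star
  have h3 := (Equiv.prodComm (ℕ × ℕ) (ℕ × ℕ)).hasSum_iff.2 h1
  have e : star (pair (waveFam k₁ k₂ Z) a) = pair (waveFam k₁ k₂ Z) a := by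
    refine h2.unique ?_
    convert! h3 using 2 with p
    change star (a p • waveFam k₁ k₂ Z p) = a p.swap • waveFam k₁ k₂ Z p.swap
    rw [ha, waveFam_swap hZ, star_smul, star_trivial]
  rw [toC_reC, e, ← two_smul ℂ, smul_smul]
  norm_num

lemma hasSum_coeffC_pair (hZ : ‖Z‖ < 1 / 2) (a : L1 Idx) (k : ℤ) :
    HasSum (fun p : Idx => if p.freq k₁ k₂ = k then (a p : ℂ) * mono Z p else 0)
      (coeffC k (pair (waveFam k₁ k₂ Z) a)) := by
  have h1 := (hasSum_pair (waveFam k₁ k₂ Z) a).mapL ((coeffC k).restrictScalars ℝ)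
  convert! h1 using 2 with p
  change _ = coeffC k (a p • waveFam k₁ k₂ Z p)
  rw [waveFam_apply hZ, ← Complex.coe_smul, map_smul, map_smul, coeffC_fourier]
  simp [eq_comm]

/-- The wave with the coefficient family `a`. -/
def wave (k₁ k₂ : ℕ) (Z : ℂ × ℂ) (a : L1 Idx) : C(Circ, ℝ) := reC (pair (waveFam k₁ k₂ Z) a)

namespace IsCoeffFamily

variable (h : IsCoeffFamily k₁ k₂ c κ T t a)
include h

lemma swap (p : Idx) : a p.swap = a p := by
  rw [(h _).1, (h _).1, uHat_swap, Idx.deg_swap]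

lemma toC_wave (hZ : ‖Z‖ < 1 / 2) : toC (wave k₁ k₂ Z a) = pair (waveFam k₁ k₂ Z) a :=
  toC_reC_pair_waveFam hZ h.swap

lemma toC_wave_sq (hZ : ‖Z‖ < 1 / 2) :
    toC (wave k₁ k₂ Z a ^ 2) = pair (waveFam k₁ k₂ Z) (conv a a) := by
  rw [toC_pow, h.toC_wave hZ, pair_conv_of_mul _ (waveFam_add hZ), sq]

lemma hasSum_coeff (hZ : ‖Z‖ < 1 / 2) (k : ℤ) :
    HasSum (fun p : Idx => if p.freq k₁ k₂ = k then (a p : ℂ) * mono Z p else 0)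
      (coeff (wave k₁ k₂ Z a) k) := by
  rw [coeff_eq, h.toC_wave hZ]
  exact hasSum_coeffC_pair hZ a k

lemma hasSum_coeff_sq (hZ : ‖Z‖ < 1 / 2) (k : ℤ) :
    HasSum (fun p : Idx => if p.freq k₁ k₂ = k then (conv a a p : ℂ) * mono Z p else 0)
      (coeff (wave k₁ k₂ Z a ^ 2) k) := by
  rw [coeff_eq, h.toC_wave_sq hZ]
  exact hasSum_coeffC_pair hZ _ k

omit h in
lemma _root_.Whitham.Idx.eq_of_deg_eq_one {p : Idx} (hp : p.deg = 1) :
    p = ((1, 0), (0, 0)) ∨ p = ((0, 1), (0, 0)) ∨ p = ((0, 0), (1, 0)) ∨ p = ((0, 0), (0, 1)) := by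
  obtain ⟨⟨p1, p2⟩, p3, p4⟩ := p
  simp only [Idx.deg] at hp
  simp only [Prod.mk.injEq]
  omega

/-- The equation holds off the wave numbers `±k₁, ±k₂`. -/
lemma J_eq_zero (hZ : ‖Z‖ < 1 / 2) {k : ℤ} (h1 : k.natAbs ≠ k₁) (h2 : k.natAbs ≠ k₂)
    (hc : c - m T (κ * k) ≠ 0) : J (wave k₁ k₂ Z a) c κ T k = 0 := by
  have hs := ((h.hasSum_coeff hZ k).mul_left ((m T (κ * k) - c : ℝ) : ℂ)).add
    (h.hasSum_coeff_sq hZ k)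
  refine hs.unique ?_
  convert! hasSum_zero using 2 with p
  split_ifs with hp
  · rw [(h p).1, (h p).2]
    rcases lt_or_ge p.deg 2 with hd | hd
    · rw [uSqHat_of_deg_lt_two _ _ _ _ _ hd]
      obtain hd | hd : p.deg = 0 ∨ p.deg = 1 := by omega
      · rw [uHat_of_deg_eq_zero _ _ _ _ _ hd]
        simp
      · exfalso
        rcases Idx.eq_of_deg_eq_one hd with rfl | rfl | rfl | rfl <;>
          simp only [Idx.freq] at hp <;> omega
    · rw [uHat_of_two_le_deg _ _ _ _ _ hd, hp, ell, if_neg (by tauto)]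
      have hc' : (c : ℂ) - (m T (κ * k) : ℂ) ≠ 0 := by exact_mod_cast hc
      push_cast
      field_simp
      ring
  · simp

/-- `ell` vanishes at the critical wave numbers, so only the term of degree one contributes, with
coefficient t/2. The amplitudes can thus be read off from the wave. -/
lemma coeff_wave (hZ : ‖Z‖ < 1 / 2) (h1 : 1 ≤ k₁) (h2 : k₁ < k₂) :
    coeff (wave k₁ k₂ Z a) k₁ = t / 2 * Z.1 ∧ coeff (wave k₁ k₂ Z a) k₂ = t / 2 * Z.2 := by
  have key (k : ℕ) (hk : k = k₁ ∨ k = k₂) (q : Idx) (hq : q.deg = 1) (hqk : q.freq k₁ k₂ = k)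
      (hu : ∀ p : Idx, p.deg = 1 → p.freq k₁ k₂ = k → p = q) :
      coeff (wave k₁ k₂ Z a) k = t / 2 * mono Z q := by
    refine (h.hasSum_coeff hZ k).unique ?_
    have h3 := hasSum_single (f := fun p : Idx =>
      if p.freq k₁ k₂ = k then (a p : ℂ) * mono Z p else 0) q (fun p hpq => by
        split_ifs with hp
        · rw [(h p).1]
          rcases lt_or_ge p.deg 2 with hd | hd
          · obtain hd | hd : p.deg = 0 ∨ p.deg = 1 := by omega
            · rw [uHat_of_deg_eq_zero _ _ _ _ _ hd]
              simp
            · exact absurd (hu p hd hp) hpq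
          · rw [uHat_of_two_le_deg _ _ _ _ _ hd, hp, ell, if_pos (by simpa using hk)]
            simp
        · rfl)
    rw [if_pos hqk, (h q).1, uHat_of_deg_eq_one _ _ _ _ _ hq, hq] at h3
    convert! h3 using 1
    push_cast
    ring
  constructor
  · rw [key k₁ (.inl rfl) ((1, 0), (0, 0)) rfl (by simp [Idx.freq])]
    · simp [mono]
    · intro p hp hpk
      rcases Idx.eq_of_deg_eq_one hp with rfl | rfl | rfl | rfl <;>
        simp only [Idx.freq] at hpk <;> first | rfl | omega
  · rw [key k₂ (.inr rfl) ((0, 1), (0, 0)) rfl (by simp [Idx.freq])]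
    · simp [mono]
    · intro p hp hpk
      rcases Idx.eq_of_deg_eq_one hp with rfl | rfl | rfl | rfl <;>
        simp only [Idx.freq] at hpk <;> first | rfl | omega

end IsCoeffFamily

/-! ### The variational structure -/

/-- The trigonometric monomials multiplied by their wave numbers. -/
def derivFam (k₁ k₂ : ℕ) (Z : ℂ × ℂ) : Idx →ᵇ C(Circ, ℂ) :=
  ofNormedAddCommGroupDiscrete (fun p => (p.freq k₁ k₂ : ℝ) • waveFam k₁ k₂ Z p)
    ((k₁ + k₂ : ℝ) * ‖monoFam ((2 : ℝ) • Z)‖) (fun p => by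
      rw [waveFam, trigFam_apply, norm_smul, norm_smul, norm_smul, norm_fourier', mul_one,
        Real.norm_of_nonneg (by positivity : (0 : ℝ) ≤ 2⁻¹ ^ p.deg), Real.norm_eq_abs, ← mul_assoc]
      refine mul_le_mul ?_ ((monoFam ((2 : ℝ) • Z)).norm_coe_le_norm p) (norm_nonneg _)
        (by positivity)
      have h1 := Idx.abs_freq_le k₁ k₂ p
      have h2 : (p.deg : ℝ) ≤ 2 ^ p.deg := by exact_mod_cast Nat.lt_two_pow_self.le
      rw [inv_pow, ← div_eq_mul_inv, div_le_iff₀ (by positivity)]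
      exact h1.trans (mul_le_mul_of_nonneg_left h2 (by positivity)))

lemma derivFam_apply (p : Idx) :
    derivFam k₁ k₂ Z p = (p.freq k₁ k₂ : ℝ) • waveFam k₁ k₂ Z p := rfl

lemma derivFam_add (hZ : ‖Z‖ < 1 / 2) (p q : Idx) : derivFam k₁ k₂ Z (p + q) =
    derivFam k₁ k₂ Z p * waveFam k₁ k₂ Z q + waveFam k₁ k₂ Z p * derivFam k₁ k₂ Z q := by
  rw [derivFam_apply, derivFam_apply, derivFam_apply, waveFam_add hZ, Idx.freq_add,
    smul_mul_assoc, mul_smul_comm, ← add_smul]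
  push_cast
  rfl

/-- The family represents −i times the x-derivative of the series; the degree weights in `trigFam`
make it bounded. -/
lemma coeffC_pair_derivFam (hZ : ‖Z‖ < 1 / 2) (a : L1 Idx) (k : ℤ) :
    coeffC k (pair (derivFam k₁ k₂ Z) a) = k * coeffC k (pair (waveFam k₁ k₂ Z) a) := by
  have h1 := (hasSum_pair (derivFam k₁ k₂ Z) a).mapL ((coeffC k).restrictScalars ℝ)
  refine h1.unique ?_
  convert! (hasSum_coeffC_pair hZ a k).mul_left (k : ℂ) using 2 with p
  change coeffC k (a p • derivFam k₁ k₂ Z p) = _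
  rw [derivFam_apply, waveFam_apply hZ, ← Complex.coe_smul, ← Complex.coe_smul, map_smul, map_smul,
    map_smul, coeffC_fourier]
  by_cases hp : p.freq k₁ k₂ = k
  · simp [hp]
    ring
  · simp [hp, Ne.symm hp]

/-- The orthogonality of `u²` and `u'`. -/
lemma hasSum_mul_coeff (hZ : ‖Z‖ < 1 / 2) (a : L1 Idx) :
    HasSum (fun k : ℤ => (k : ℂ) * coeffC (-k) (pair (waveFam k₁ k₂ Z) a) *
      coeffC k (pair (waveFam k₁ k₂ Z) (conv a a))) 0 := by
  set U := pair (waveFam k₁ k₂ Z) a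
  set D := pair (derivFam k₁ k₂ Z) a
  have hb : pair (waveFam k₁ k₂ Z) (conv a a) = U * U := pair_conv_of_mul _ (waveFam_add hZ) a a
  -- The derivative of U³ is 3U²U', and a derivative has mean zero; Parseval turns the mean of U²U'
  -- into the asserted sum.
  have h1 : pair (derivFam k₁ k₂ Z) (conv (conv a a) a) = (3 : ℂ) • (D * (U * U)) := by
    rw [pair_conv_of_derivation _ _ (derivFam_add hZ), pair_conv_of_derivation _ _
      (derivFam_add hZ), hb]
    change (D * U + U * D) * U + U * U * D = _
    rw [show (3 : ℂ) = ((3 : ℕ) : ℂ) by norm_num, Nat.cast_smul_eq_nsmul]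
    ring
  have h2 := coeffC_pair_derivFam (k₁ := k₁) (k₂ := k₂) hZ (conv (conv a a) a) 0
  rw [h1, Int.cast_zero, zero_mul, map_smul, smul_eq_zero] at h2
  have h3 := (hasSum_coeffC_mul D (U * U)).neg
  rw [h2.resolve_left (by norm_num), neg_zero] at h3
  convert! h3 using 2 with k
  rw [coeffC_pair_derivFam hZ, hb]
  push_cast
  ring

/-- At noncritical wave numbers the equation makes the coefficient of u² a real multiple of that of
u, so these terms of ⟨u², u'⟩ = 0 have no imaginary part. The critical terms k and −k contribute
equally. -/
lemma IsCoeffFamily.im_eq_zero (h : IsCoeffFamily k₁ k₂ c κ T t a) (hZ : ‖Z‖ < 1 / 2)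
    (hk₁ : 1 ≤ k₁) (hk₂ : k₁ < k₂)
    (hc : ∀ k : ℤ, k.natAbs ≠ k₁ → k.natAbs ≠ k₂ → c - m T (κ * k) ≠ 0) :
    k₁ * (conj (coeff (wave k₁ k₂ Z a) k₁) * coeff (wave k₁ k₂ Z a ^ 2) k₁).im +
      k₂ * (conj (coeff (wave k₁ k₂ Z a) k₂) * coeff (wave k₁ k₂ Z a ^ 2) k₂).im = 0 := by
  set u := wave k₁ k₂ Z a
  have h1 : HasSum (fun k : ℤ => (k : ℂ) * (conj (coeff u k) * coeff (u ^ 2) k)) 0 := by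
    convert! hasSum_mul_coeff (k₁ := k₁) (k₂ := k₂) hZ a using 2 with k
    rw [← h.toC_wave hZ, ← h.toC_wave_sq hZ, ← coeff_eq, ← coeff_eq, coeff_neg, mul_assoc]
  have h2 := h1.mapL Complex.imCLM
  have e (k : ℤ) : Complex.imCLM ((k : ℂ) * (conj (coeff u k) * coeff (u ^ 2) k)) =
      k * (conj (coeff u k) * coeff (u ^ 2) k).im := by
    rw [Complex.imCLM_apply, show ((k : ℤ) : ℂ) = ((k : ℝ) : ℂ) by simp, Complex.im_ofReal_mul]
  simp only [e, map_zero] at h2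
  have h3 := hasSum_sum_of_ne_finset_zero (L := .unconditional _)
    (f := fun k : ℤ => (k : ℝ) * (conj (coeff u k) * coeff (u ^ 2) k).im)
    (s := {(k₁ : ℤ), -(k₁ : ℤ), (k₂ : ℤ), -(k₂ : ℤ)}) (fun k hk => by
      simp only [Finset.mem_insert, Finset.mem_singleton, not_or] at hk
      have hJ := h.J_eq_zero hZ (k := k) (by omega) (by omega) (hc k (by omega) (by omega))
      rw [J] at hJ
      have hJ' : coeff (u ^ 2) k = ((c - m T (κ * k) : ℝ) : ℂ) * coeff u k := by
        push_cast at hJ ⊢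
        linear_combination hJ
      rw [hJ', mul_left_comm, Complex.im_ofReal_mul, mul_comm (conj (coeff u k)),
        Complex.mul_conj, Complex.ofReal_im, mul_zero, mul_zero])
  have h4 := h3.unique h2
  rw [Finset.sum_insert (by simp; omega), Finset.sum_insert (by simp; omega),
    Finset.sum_insert (by simp; omega), Finset.sum_singleton] at h4
  have e2 (k : ℤ) : (conj (coeff u (-k)) * coeff (u ^ 2) (-k)).im =
      -(conj (coeff u k) * coeff (u ^ 2) k).im := by
    rw [coeff_neg, coeff_neg, ← map_mul, Complex.conj_im]
  rw [e2, e2] at h4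
  push_cast at h4
  linarith

end Wave

end

section

open Filter Topology BoundedContinuousFunction
open scoped ComplexConjugate

/-! ### The reduced coefficients of the square -/

/-- Exchanging the two wave numbers. -/
def Idx.flip (p : Idx) : Idx := ((p.1.2, p.1.1), (p.2.2, p.2.1))

lemma Idx.freq_flip (k₁ k₂ : ℕ) (p : Idx) : Idx.freq k₂ k₁ p.flip = p.freq k₁ k₂ := by
  simp only [Idx.freq, Idx.flip]
  ring

lemma Idx.deg_flip (p : Idx) : Idx.deg p.flip = p.deg := by
  simp only [Idx.deg, Idx.flip]
  ring

lemma mono_flip (Z : ℂ × ℂ) (p : Idx) : mono Z.swap p.flip = mono Z p := by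
  simp only [mono, Idx.flip, Prod.fst_swap, Prod.snd_swap]
  ring

/-- Pulling back a bounded family along the exchange of the two wave numbers. -/
def pullFlip : (Idx →ᵇ ℝ) →L[ℝ] (Idx →ᵇ ℝ) :=
  compContinuousCLM ℝ ℝ ⟨Idx.flip, continuous_of_discreteTopology⟩

/-- The invariants with the two wave numbers exchanged. -/
def flipInv (s : ℝ × ℝ × ℝ) : ℝ × ℝ × ℝ := (s.2.1, s.1, s.2.2)

lemma contDiff_flipInv : ContDiff ℝ ω flipInv := by
  unfold flipInv
  fun_prop

lemma flipInv_invariants (k₁ k₂ : ℕ) (Z : ℂ × ℂ) :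
    flipInv (invariants k₁ k₂ Z) = invariants k₂ k₁ Z.swap := by
  simp only [flipInv, invariants, Prod.fst_swap, Prod.snd_swap]
  congr 2
  rw [← Complex.conj_re]
  simp [mul_comm]

/-- The families `R` for which the Fourier coefficients of order `k₁`, resp. `k₂`, of `u²` are
`(∑ R 0 p b p) Z₁ + (∑ R 1 p b p) E₁`, resp. `(∑ R 2 p b p) Z₂ + (∑ R 3 p b p) E₂`, with the
exceptional monomials `E₁`, `E₂`. -/
def redFam (k₁ k₂ : ℕ) (s : ℝ × ℝ × ℝ) : Fin 4 → Idx →ᵇ ℝ :=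
  ![redAFam k₁ k₂ s, redBFam k₁ k₂ s, pullFlip (redAFam k₂ k₁ (flipInv s)),
    pullFlip (redBFam k₂ k₁ (flipInv s))]

lemma contDiffAt_redFam_apply {k₁ k₂ : ℕ} (h₁ : 1 ≤ k₁) (h₂ : 1 ≤ k₂) (i : Fin 4) :
    ContDiffAt ℝ ω (fun s => redFam k₁ k₂ s i) 0 := by
  obtain ⟨hA, hB⟩ := contDiffAt_redFam k₁ h₂
  obtain ⟨hA', hB'⟩ := contDiffAt_redFam k₂ h₁
  have h0 : flipInv 0 = 0 := rfl
  fin_cases i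
  · exact hA
  · exact hB
  · exact pullFlip.contDiff.contDiffAt.comp 0
      (ContDiffAt.comp (g := redAFam k₂ k₁) 0 (h0 ▸ hA') contDiff_flipInv.contDiffAt)
  · exact pullFlip.contDiff.contDiffAt.comp 0
      (ContDiffAt.comp (g := redBFam k₂ k₁) 0 (h0 ▸ hB') contDiff_flipInv.contDiffAt)

lemma continuous_invariants (k l : ℕ) : Continuous (invariants k l) := by
  unfold invariants
  have h1 : Continuous fun Z : ℂ × ℂ => Complex.normSq Z.1 :=
    Complex.continuous_normSq.comp continuous_fst
  have h2 : Continuous fun Z : ℂ × ℂ => Complex.normSq Z.2 :=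
    Complex.continuous_normSq.comp continuous_snd
  have h3 : Continuous fun Z : ℂ × ℂ => (conj Z.1 ^ l * Z.2 ^ k).re :=
    Complex.continuous_re.comp
      (((Complex.continuous_conj.comp continuous_fst).pow l).mul (continuous_snd.pow k))
  exact h1.prodMk (h2.prodMk h3)

lemma invariants_zero (k : ℕ) {l : ℕ} (hl : 1 ≤ l) : invariants k l 0 = 0 := by
  simp [invariants, zero_pow (by omega : l ≠ 0)]

lemma eventually_redFam_invariants (k : ℕ) {l : ℕ} (hl : 1 ≤ l) : ∀ᶠ Z in 𝓝 (0 : ℂ × ℂ), ∀ p,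
    redAFam k l (invariants k l Z) p = redA k l (invariants k l Z) p ∧
    redBFam k l (invariants k l Z) p = redB k l (invariants k l Z) p :=
  ((continuous_invariants k l).tendsto' 0 0 (invariants_zero k hl)).eventually
    (eventually_redFam k hl)

lemma hasSum_mono_red {k l : ℕ} (hk : 1 ≤ k) (hl : 1 ≤ l) (hkl : Nat.Coprime k l) {Z : ℂ × ℂ}
    {α β : ℝ} {b : Idx → ℝ} (hα : HasSum (fun p => b p * redA k l (invariants k l Z) p) α)
    (hβ : HasSum (fun p => b p * redB k l (invariants k l Z) p) β) :
    HasSum (fun p : Idx => if p.freq k l = k then (b p : ℂ) * mono Z p else 0)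
      (α * Z.1 + β * exc k l Z) := by
  have h1 := ((Complex.hasSum_ofReal.2 hα).mul_right Z.1).add
    ((Complex.hasSum_ofReal.2 hβ).mul_right (exc k l Z))
  convert! h1 using 2 with p
  split_ifs with hp
  · rw [mono_eq_red hk hl hkl Z hp]
    push_cast
    ring
  · simp [redA, redB, hp]

/-- The reduction of monomials, summed against an arbitrary ℓ¹ family. The statement for k₂ is the
one for k₁ after exchanging the two wave numbers. -/
lemma eventually_hasSum_red {k₁ k₂ : ℕ} (h₁ : 1 ≤ k₁) (h₂ : 1 ≤ k₂) (hk : Nat.Coprime k₁ k₂) :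
    ∀ᶠ Z in 𝓝 (0 : ℂ × ℂ), ∀ b : L1 Idx,
      HasSum (fun p : Idx => if p.freq k₁ k₂ = k₁ then (b p : ℂ) * mono Z p else 0)
        (pair (redFam k₁ k₂ (invariants k₁ k₂ Z) 0) b * Z.1 +
          pair (redFam k₁ k₂ (invariants k₁ k₂ Z) 1) b * exc k₁ k₂ Z) ∧
      HasSum (fun p : Idx => if p.freq k₁ k₂ = k₂ then (b p : ℂ) * mono Z p else 0)
        (pair (redFam k₁ k₂ (invariants k₁ k₂ Z) 2) b * Z.2 +
          pair (redFam k₁ k₂ (invariants k₁ k₂ Z) 3) b * exc k₂ k₁ Z.swap) := by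
  have e2 := (continuous_swap.tendsto' (0 : ℂ × ℂ) 0 rfl).eventually
    (eventually_redFam_invariants k₂ h₁)
  filter_upwards [eventually_redFam_invariants k₁ h₂, e2] with Z hZ1 hZ2 b
  constructor
  · refine hasSum_mono_red h₁ h₂ hk ?_ ?_
    · have h3 := hasSum_pair (redAFam k₁ k₂ (invariants k₁ k₂ Z)) b
      simp only [(hZ1 _).1, smul_eq_mul] at h3
      exact h3
    · have h3 := hasSum_pair (redBFam k₁ k₂ (invariants k₁ k₂ Z)) b
      simp only [(hZ1 _).2, smul_eq_mul] at h3
      exact h3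
  · have hinv (p : Idx) : p.flip.flip = p := rfl
    let e : Idx ≃ Idx := ⟨Idx.flip, Idx.flip, hinv, hinv⟩
    have h := hasSum_mono_red (Z := Z.swap) (b := fun p => b p.flip) h₂ h₁ hk.symm
      (α := pair (redFam k₁ k₂ (invariants k₁ k₂ Z) 2) b)
      (β := pair (redFam k₁ k₂ (invariants k₁ k₂ Z) 3) b) ?_ ?_
    · have h' := e.hasSum_iff.2 h
      convert! h' using 2 with p
      change _ = if Idx.freq k₂ k₁ p.flip = k₂ then (b p.flip.flip : ℂ) * mono Z.swap p.flip else 0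
      rw [Idx.freq_flip, hinv, mono_flip]
    · refine e.hasSum_iff.1 ?_
      have h3 := hasSum_pair (redFam k₁ k₂ (invariants k₁ k₂ Z) 2) b
      convert! h3 using 2 with p
      change b p.flip.flip * redA k₂ k₁ (invariants k₂ k₁ Z.swap) p.flip =
        b p • redAFam k₂ k₁ (flipInv (invariants k₁ k₂ Z)) p.flip
      rw [flipInv_invariants, (hZ2 _).1, hinv, smul_eq_mul]
    · refine e.hasSum_iff.1 ?_
      have h3 := hasSum_pair (redFam k₁ k₂ (invariants k₁ k₂ Z) 3) b
      convert! h3 using 2 with p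
      change b p.flip.flip * redB k₂ k₁ (invariants k₂ k₁ Z.swap) p.flip =
        b p • redBFam k₂ k₁ (flipInv (invariants k₁ k₂ Z)) p.flip
      rw [flipInv_invariants, (hZ2 _).2, hinv, smul_eq_mul]

/-- At vanishing invariants the reduction keeps only terms of degree one, which `b` does not have,
and the exceptional monomial. -/
lemma pair_redFam_zero {k₁ k₂ : ℕ} (h₁ : 1 ≤ k₁) (h₂ : 1 ≤ k₂) (hk : Nat.Coprime k₁ k₂)
    {b : L1 Idx} (hb : ∀ p : Idx, p.deg < 2 → b p = 0) :
    pair (redFam k₁ k₂ 0 0) b = 0 ∧ pair (redFam k₁ k₂ 0 2) b = 0 ∧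
      pair (redFam k₁ k₂ 0 1) b = b ((0, k₁), (k₂ - 1, 0)) := by
  have e1 := (eventually_redFam k₁ h₂).self_of_nhds
  have e2 := (eventually_redFam k₂ h₁).self_of_nhds
  refine ⟨(hasSum_pair _ b).unique ?_, (hasSum_pair _ b).unique ?_, (hasSum_pair _ b).unique ?_⟩
  · convert! hasSum_zero using 2 with p
    change b p • redAFam k₁ k₂ 0 p = 0
    rw [(e1 p).1]
    by_cases hp : p.deg = 1
    · rw [hb p (by omega), zero_smul]
    · rw [redA_zero h₁ hk hp, smul_zero]
  · convert! hasSum_zero using 2 with p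
    change b p • redAFam k₂ k₁ 0 p.flip = 0
    rw [(e2 _).1]
    by_cases hp : p.deg = 1
    · rw [hb p (by omega), zero_smul]
    · rw [redA_zero h₂ hk.symm (by rwa [Idx.deg_flip]), smul_zero]
  · have e (p : Idx) : b p • redFam k₁ k₂ 0 1 p =
        if p = ((0, k₁), (k₂ - 1, 0)) then b p else 0 := by
      change b p • redBFam k₁ k₂ 0 p = _
      rw [(e1 p).2, redB_zero h₁ h₂ hk]
      simp
    simp only [e]
    have := hasSum_single (f := fun p : Idx => if p = ((0, k₁), (k₂ - 1, 0)) then b p else 0)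
      ((0, k₁), (k₂ - 1, 0)) (fun p hp => if_neg hp)
    simpa using this

/-! ### The linearization of the bifurcation equations -/

section Linearization

variable {k₁ k₂ : ℕ} {c₀ κ₀ T₀ : ℝ}

lemma IsDoubleBifurcationPoint.m_eq (h : IsDoubleBifurcationPoint k₁ k₂ c₀ κ₀ T₀) :
    m T₀ (κ₀ * k₁) = c₀ ∧ m T₀ (κ₀ * k₂) = c₀ :=
  ⟨(h.iff k₁ h.one_le).2 (.inl rfl), (h.iff k₂ (h.one_le.trans h.lt.le)).2 (.inr rfl)⟩

/-- The value chosen by `Classical.epsilon` is pinned down by the uniqueness in `eq_of_m_eq`. -/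
lemma kappa0_eq {T κ : ℝ} (h1 : 1 ≤ k₁) (h2 : k₁ < k₂) (hT : 0 < T) (hκ : 0 < κ)
    (h : m T (κ * k₁) = m T (κ * k₂)) : kappa0 k₁ k₂ T = κ := by
  have hs : 0 < kappa0 k₁ k₂ T ∧ m T (kappa0 k₁ k₂ T * k₁) = m T (kappa0 k₁ k₂ T * k₂) :=
    Classical.epsilon_spec (p := fun κ : ℝ => 0 < κ ∧ m T (κ * k₁) = m T (κ * k₂)) ⟨κ, hκ, h⟩
  exact eq_of_m_eq hT (by exact_mod_cast h1) (by exact_mod_cast h2) hs.1 hκ hs.2 h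

/-- The critical point of the symbol lies strictly between κ₀k₁ and κ₀k₂. The opposite signs give
the transversality in κ used for the curve and for the linearization. -/
lemma IsDoubleBifurcationPoint.deriv_neg_pos (h : IsDoubleBifurcationPoint k₁ k₂ c₀ κ₀ T₀) :
    deriv (fun κ => m T₀ (κ * k₁)) κ₀ < 0 ∧ 0 < deriv (fun κ => m T₀ (κ * k₂)) κ₀ := by
  have hk1 : (0 : ℝ) < k₁ := by exact_mod_cast h.one_le
  have hk2 : (0 : ℝ) < k₂ := hk1.trans (by exact_mod_cast h.lt)
  have hκ := h.κ_pos
  obtain ⟨ξ, hξ1, hξ2, hξ⟩ := exists_critical_point h.T_pos (mul_pos hκ hk1)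
    (mul_lt_mul_of_pos_left (by exact_mod_cast h.lt) hκ) (h.m_eq.1.trans h.m_eq.2.symm)
  have hd {k : ℝ} (hk : 0 < k) :
      deriv (fun κ => m T₀ (κ * k)) κ₀ = deriv (m T₀) (κ₀ * k) * k := by
    have h1 := (hasDerivAt_m h.T_pos (mul_pos hκ hk)).differentiableAt.hasDerivAt
    have h2 := h1.comp κ₀ ((hasDerivAt_id κ₀).mul_const k)
    rw [one_mul] at h2
    exact h2.deriv
  rw [hd hk1, hd hk2]
  exact ⟨mul_neg_of_neg_of_pos (deriv_m_neg h.T_pos hξ (mul_pos hκ hk1) hξ1) hk1,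
    mul_pos (deriv_m_pos h.T_pos hξ ((mul_pos hκ hk1).trans hξ1) hξ2) hk2⟩

/-- The curve of double bifurcation points through the given one. -/
lemma IsDoubleBifurcationPoint.exists_curve (h : IsDoubleBifurcationPoint k₁ k₂ c₀ κ₀ T₀) :
    DifferentiableAt ℝ (kappa0 k₁ k₂) T₀ ∧ kappa0 k₁ k₂ T₀ = κ₀ ∧
      ∀ᶠ T in 𝓝 T₀, m T (kappa0 k₁ k₂ T * k₁) = m T (kappa0 k₁ k₂ T * k₂) := by
  have hω : (ω : WithTop ℕ∞) ≠ 0 := by simp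
  obtain ⟨hn, hp⟩ := h.deriv_neg_pos
  let f : ℝ × ℝ → ℝ := fun v => m v.1 (v.2 * k₁) - m v.1 (v.2 * k₂)
  have hm (k : ℕ) : ContDiffAt ℝ ω (fun v : ℝ × ℝ => m v.1 (v.2 * k)) (T₀, κ₀) :=
    ContDiffAt.comp (g := fun x : ℝ × ℝ => m x.2 (x.1 * k)) (f := Prod.swap) (T₀, κ₀)
      (contDiffAt_m (x₀ := (κ₀, T₀)) h.κ_pos h.T_pos k)
      (contDiffAt_snd.prodMk contDiffAt_fst)
  have hf : ContDiffAt ℝ ω f (T₀, κ₀) := (hm k₁).sub (hm k₂)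
  have hd (k : ℕ) : DifferentiableAt ℝ (fun κ => m T₀ (κ * k)) κ₀ :=
    DifferentiableAt.comp (g := fun v : ℝ × ℝ => m v.1 (v.2 * k)) κ₀
      ((hm k).differentiableAt hω) (by fun_prop)
  let d := deriv (fun κ => m T₀ (κ * k₁)) κ₀ - deriv (fun κ => m T₀ (κ * k₂)) κ₀
  have hd0 : d ≠ 0 := (by linarith : d < 0).ne
  have hA : HasFDerivAt (fun κ => f (T₀, κ)) (ContinuousLinearEquiv.unitsEquivAut ℝ
      (Units.mk0 d hd0) : ℝ →L[ℝ] ℝ) κ₀ := by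
    refine (((hd k₁).hasDerivAt.sub (hd k₂).hasDerivAt).hasFDerivAt).congr_fderiv ?_
    ext
    simp [d]
  obtain ⟨φ, hφ0, hφ, hφ1, -⟩ := exists_analytic_implicit hf _ hA
    (by simp [f, h.m_eq.1, h.m_eq.2])
  -- Uniqueness of κ identifies the implicit function with `kappa0`, which thereby inherits
  -- differentiability.
  have hev : ∀ᶠ T in 𝓝 T₀, kappa0 k₁ k₂ T = φ T := by
    filter_upwards [hφ1, lt_mem_nhds h.T_pos,
      hφ.continuousAt.eventually (lt_mem_nhds (by rw [hφ0]; exact h.κ_pos))] with T h1 h2 h3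
    exact kappa0_eq h.one_le h.lt h2 h3 (sub_eq_zero.1 h1)
  refine ⟨(hφ.differentiableAt hω).congr_of_eventuallyEq hev, hφ0 ▸ hev.self_of_nhds, ?_⟩
  filter_upwards [hφ1, hev] with T h1 h2
  rw [h2]
  exact sub_eq_zero.1 h1

/-- The linearization of `((m_T(κk₁) - c) r, (m_T(κk₂) - c) r, Ψ(c, κ, T))` is injective if `Ψ` has
a nonzero derivative along the curve of double bifurcation points. -/
lemma IsDoubleBifurcationPoint.linearization_injective
    (h : IsDoubleBifurcationPoint k₁ k₂ c₀ κ₀ T₀) {r : ℝ} (hr : r ≠ 0) {Ψ : ℝ × ℝ × ℝ → ℝ}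
    (hΨ : DifferentiableAt ℝ Ψ (c₀, κ₀, T₀))
    (hΨ' : deriv (fun T => Ψ (c0 k₁ k₂ T, kappa0 k₁ k₂ T, T)) T₀ ≠ 0)
    {L : ℝ × ℝ × ℝ →L[ℝ] ℝ × ℝ × ℝ}
    (hL : HasFDerivAt (fun l : ℝ × ℝ × ℝ => ((m l.2.2 (l.2.1 * k₁) - l.1) * r,
      (m l.2.2 (l.2.1 * k₂) - l.1) * r, Ψ l)) L (c₀, κ₀, T₀)) :
    Function.Injective L := by
  have hω : (ω : WithTop ℕ∞) ≠ 0 := by simp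
  obtain ⟨hn, hp⟩ := h.deriv_neg_pos
  obtain ⟨hκd, hκ0, hκ⟩ := h.exists_curve
  have hg (k : ℕ) := ((contDiffAt_m (x₀ := (κ₀, T₀)) h.κ_pos h.T_pos k).differentiableAt
    hω).hasFDerivAt
  set G : ℕ → (ℝ × ℝ →L[ℝ] ℝ) := fun k => fderiv ℝ (fun x : ℝ × ℝ => m x.2 (x.1 * k)) (κ₀, T₀)
    with hG
  have hGκ (k : ℕ) : deriv (fun κ => m T₀ (κ * k)) κ₀ = G k (1, 0) := by
    have h1 : HasFDerivAt (fun κ : ℝ => (κ, T₀)) (ContinuousLinearMap.inl ℝ ℝ ℝ) κ₀ :=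
      hasFDerivAt_prodMk_left κ₀ T₀
    have h2 := (HasFDerivAt.comp κ₀ (g := fun x : ℝ × ℝ => m x.2 (x.1 * k)) (hg k) h1).hasDerivAt
    refine h2.deriv.trans ?_
    simp [G]
  have hGlin (k : ℕ) (x y : ℝ) : G k (x, y) = x * G k (1, 0) + y * G k (0, 1) := by
    have : (x, y) = x • ((1, 0) : ℝ × ℝ) + y • ((0, 1) : ℝ × ℝ) := by simp
    rw [this, map_add, map_smul, map_smul, smul_eq_mul, smul_eq_mul]
  have hL' (k : ℕ) : HasFDerivAt (fun l : ℝ × ℝ × ℝ => (m l.2.2 (l.2.1 * k) - l.1) * r)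
      (r • (G k ∘L .snd ℝ ℝ (ℝ × ℝ) - .fst ℝ ℝ (ℝ × ℝ))) (c₀, κ₀, T₀) :=
    ((HasFDerivAt.comp (c₀, κ₀, T₀) (g := fun x : ℝ × ℝ => m x.2 (x.1 * k)) (hg k)
      hasFDerivAt_snd).sub hasFDerivAt_fst).mul_const r
  have hLeq := hL.unique ((hL' k₁).prodMk ((hL' k₂).prodMk hΨ.hasFDerivAt))
  -- the tangent vector of the curve
  have hγκ : HasDerivAt (kappa0 k₁ k₂) (deriv (kappa0 k₁ k₂) T₀) T₀ := hκd.hasDerivAt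
  set κ' := deriv (kappa0 k₁ k₂) T₀
  have hγ : HasDerivAt (fun T => (kappa0 k₁ k₂ T, T)) (κ', 1) T₀ := hγκ.prodMk (hasDerivAt_id T₀)
  have hc (k : ℕ) : HasDerivAt (fun T => m T (kappa0 k₁ k₂ T * k)) (G k (κ', 1)) T₀ :=
    HasFDerivAt.comp_hasDerivAt T₀ (l := fun x : ℝ × ℝ => m x.2 (x.1 * k))
      (f := fun T => (kappa0 k₁ k₂ T, T)) (by simpa only [hκ0] using hg k) hγ
  have hc12 : G k₁ (κ', 1) = G k₂ (κ', 1) :=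
    (hc k₁).unique ((hc k₂).congr_of_eventuallyEq hκ)
  have hc0 : c0 k₁ k₂ T₀ = c₀ := by rw [c0, hκ0, h.m_eq.1]
  have hΨγ : HasDerivAt (fun T => Ψ (c0 k₁ k₂ T, kappa0 k₁ k₂ T, T))
      (fderiv ℝ Ψ (c₀, κ₀, T₀) (G k₁ (κ', 1), κ', 1)) T₀ :=
    HasFDerivAt.comp_hasDerivAt T₀ (l := Ψ)
      (f := fun T => (c0 k₁ k₂ T, kappa0 k₁ k₂ T, T))
      (by simpa only [hκ0, hc0] using hΨ.hasFDerivAt) ((hc k₁).prodMk hγ)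
  rw [hΨγ.deriv] at hΨ'
  rw [injective_iff_map_eq_zero]
  rintro ⟨x, y, z⟩ hv
  rw [hLeq] at hv
  simp only [ContinuousLinearMap.prod_apply, _root_.smul_apply, _root_.sub_apply,
    ContinuousLinearMap.comp_apply, ContinuousLinearMap.coe_snd', ContinuousLinearMap.coe_fst',
    Prod.mk_eq_zero, smul_eq_mul, mul_eq_zero, hr, false_or, sub_eq_zero] at hv
  obtain ⟨h1, h2, h3⟩ := hv
  -- The first two equations force a kernel vector to be z times the tangent of the curve; the third
  -- then reads z times the derivative of `Ψ` along the curve.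
  have hy : y = z * κ' := by
    rw [hGlin] at h1 h2
    rw [hGlin k₁, hGlin k₂] at hc12
    rw [hGκ] at hn hp
    have : (y - z * κ') * (G k₁ (1, 0) - G k₂ (1, 0)) = 0 := by linear_combination h1 - h2 - z * hc12
    rcases mul_eq_zero.1 this with h4 | h4
    · linarith
    · linarith
  have hv : ((x, y, z) : ℝ × ℝ × ℝ) = z • (G k₁ (κ', 1), κ', 1) := by
    have hx : x = z * G k₁ (κ', 1) := by
      rw [← h1, hy, hGlin, hGlin k₁ κ']
      ring
    rw [hx, hy]
    simp
  rw [hv, map_smul, smul_eq_mul, mul_eq_zero] at h3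
  have hz : z = 0 := h3.resolve_right hΨ'
  rw [hv, hz, zero_smul]

end Linearization

end

section

open Filter Topology BoundedContinuousFunction
open scoped ComplexConjugate

/-! ### Solution of the bifurcation equations -/

/-- The coefficients in the reduced bifurcation equations. -/
def redCoeff (k₁ k₂ : ℕ) (a : ℝ × ℝ × ℝ → L1 Idx) (i : Fin 4)
    (v : (ℝ × ℝ × ℝ) × (ℝ × ℝ × ℝ)) : ℝ :=
  pair (redFam k₁ k₂ v.1 i) (conv (a v.2) (a v.2))

lemma contDiffAt_conv_self {a : ℝ × ℝ × ℝ → L1 Idx} {l₀ : ℝ × ℝ × ℝ} (ha : ContDiffAt ℝ ω a l₀) :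
    ContDiffAt ℝ ω (fun l => conv (a l) (a l)) l₀ :=
  (conv.contDiff.contDiffAt.comp _ ha).clm_apply ha

lemma contDiffAt_redCoeff {k₁ k₂ : ℕ} (h₁ : 1 ≤ k₁) (h₂ : 1 ≤ k₂) {a : ℝ × ℝ × ℝ → L1 Idx}
    {l₀ : ℝ × ℝ × ℝ} (ha : ContDiffAt ℝ ω a l₀) (i : Fin 4) :
    ContDiffAt ℝ ω (redCoeff k₁ k₂ a i) (0, l₀) := by
  have h1 : ContDiffAt ℝ ω (fun v : (ℝ × ℝ × ℝ) × (ℝ × ℝ × ℝ) => redFam k₁ k₂ v.1 i) (0, l₀) :=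
    ContDiffAt.comp (g := fun s => redFam k₁ k₂ s i) _ (contDiffAt_redFam_apply h₁ h₂ i)
      contDiffAt_fst
  have h2 : ContDiffAt ℝ ω (fun v : (ℝ × ℝ × ℝ) × (ℝ × ℝ × ℝ) => conv (a v.2) (a v.2)) (0, l₀) :=
    ContDiffAt.comp (g := fun l => conv (a l) (a l)) (0, l₀) (contDiffAt_conv_self ha)
      contDiffAt_snd
  exact ((pair (ι := Idx) (E := ℝ)).contDiff.contDiffAt.comp _ h1).clm_apply h2

/-- The product `Z̄₁^{k₂} Z₂^{k₁}`, whose imaginary part vanishes for symmetric waves. -/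
def resonance (k₁ k₂ : ℕ) (Z : ℂ × ℂ) : ℂ := conj Z.1 ^ k₂ * Z.2 ^ k₁

lemma conj_mul_exc_fst {k₁ k₂ : ℕ} (h₂ : 1 ≤ k₂) (Z : ℂ × ℂ) :
    conj Z.1 * exc k₁ k₂ Z = resonance k₁ k₂ Z := conj_mul_exc h₂ Z

lemma conj_mul_exc_snd {k₁ k₂ : ℕ} (h₁ : 1 ≤ k₁) (Z : ℂ × ℂ) :
    conj Z.2 * exc k₂ k₁ Z.swap = conj (resonance k₁ k₂ Z) := by
  refine (conj_mul_exc h₁ Z.swap).trans ?_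
  simp [resonance, mul_comm]

/-- The map w ↦ Z̄₁^{k₂} w^{k₁} is holomorphic and not locally constant, since a fibre is the finite
root set of a polynomial. By the open mapping theorem it takes non-real values arbitrarily close to
any given point, including w = 0. -/
lemma frequently_im_resonance_ne_zero {k₁ k₂ : ℕ} (h₁ : 1 ≤ k₁) {Z : ℂ × ℂ} (hZ : Z.1 ≠ 0) :
    ∃ᶠ w in 𝓝 Z.2, (resonance k₁ k₂ (Z.1, w)).im ≠ 0 := by
  set q : ℂ := conj Z.1 ^ k₂ with hq
  have hq0 : q ≠ 0 := pow_ne_zero _ (by simpa using hZ)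
  have han : AnalyticAt ℂ (fun w : ℂ => q * w ^ k₁) Z.2 := by fun_prop
  rcases han.eventually_constant_or_nhds_le_map_nhds with h | h
  · exfalso
    let P : Polynomial ℂ := Polynomial.X ^ k₁ - Polynomial.C (Z.2 ^ k₁)
    have hP : P ≠ 0 := Polynomial.X_pow_sub_C_ne_zero h₁ _
    have h2 : ∀ᶠ w in 𝓝 Z.2, w ∈ (P.roots.toFinset : Set ℂ) := by
      filter_upwards [h] with w hw
      rw [Finset.mem_coe, Multiset.mem_toFinset, Polynomial.mem_roots hP]
      simpa [P, sub_eq_zero] using mul_left_cancel₀ hq0 hw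
    exact infinite_of_mem_nhds Z.2 h2 P.roots.toFinset.finite_toSet
  · have h2 : ∃ᶠ y in 𝓝 (q * Z.2 ^ k₁), y.im ≠ 0 := by
      set y₀ := q * Z.2 ^ k₁
      intro hev
      have hc : Tendsto (fun t : ℝ => y₀ + t * Complex.I) (𝓝[≠] 0) (𝓝 y₀) :=
        ((by fun_prop : Continuous fun t : ℝ => y₀ + t * Complex.I).tendsto' 0 y₀
          (by simp)).mono_left nhdsWithin_le_nhds
      have h0 : y₀.im = 0 := not_not.1 hev.self_of_nhds
      obtain ⟨t, ht1, ht2⟩ := ((hc.eventually hev).and self_mem_nhdsWithin).exists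
      refine ht1 ?_
      simpa [h0] using ht2
    exact h2.filter_mono h

section Reduced

variable {k₁ k₂ : ℕ} {c₀ κ₀ T₀ t : ℝ} {a : ℝ × ℝ × ℝ → L1 Idx}

/-- The properties of the parameters and of the amplitudes close to the bifurcation point that are
used below. -/
structure Regular (k₁ k₂ : ℕ) (t : ℝ) (a : ℝ × ℝ × ℝ → L1 Idx) (l : ℝ × ℝ × ℝ) (Z : ℂ × ℂ) :
    Prop where
  norm_lt : ‖Z‖ < 1 / 2
  coeffFamily : IsCoeffFamily k₁ k₂ l.1 l.2.1 l.2.2 t (a l)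
  ne_zero : ∀ k : ℤ, k.natAbs ≠ k₁ → k.natAbs ≠ k₂ → l.1 - m l.2.2 (l.2.1 * k) ≠ 0
  coeff_sq_fst : coeff (wave k₁ k₂ Z (a l) ^ 2) k₁ =
    redCoeff k₁ k₂ a 0 (invariants k₁ k₂ Z, l) * Z.1 +
      redCoeff k₁ k₂ a 1 (invariants k₁ k₂ Z, l) * exc k₁ k₂ Z
  coeff_sq_snd : coeff (wave k₁ k₂ Z (a l) ^ 2) k₂ =
    redCoeff k₁ k₂ a 2 (invariants k₁ k₂ Z, l) * Z.2 +
      redCoeff k₁ k₂ a 3 (invariants k₁ k₂ Z, l) * exc k₂ k₁ Z.swap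

lemma eventually_regular {l₀ : ℝ × ℝ × ℝ} (h₁ : 1 ≤ k₁) (h₂ : 1 ≤ k₂) (hk : Nat.Coprime k₁ k₂)
    (ha : ∀ᶠ l in 𝓝 l₀, IsCoeffFamily k₁ k₂ l.1 l.2.1 l.2.2 t (a l) ∧
      ∀ k : ℤ, k.natAbs ≠ k₁ → k.natAbs ≠ k₂ → l.1 - m l.2.2 (l.2.1 * k) ≠ 0) :
    ∀ᶠ v in 𝓝 (l₀, (0 : ℂ × ℂ)), Regular k₁ k₂ t a v.1 v.2 := by
  have hn : ∀ᶠ Z in 𝓝 (0 : ℂ × ℂ), ‖Z‖ < 1 / 2 :=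
    (continuous_norm.tendsto' (0 : ℂ × ℂ) 0 norm_zero).eventually (gt_mem_nhds (by norm_num))
  rw [nhds_prod_eq]
  filter_upwards [ha.prod_mk (hn.and (eventually_hasSum_red h₁ h₂ hk))] with v hv
  obtain ⟨⟨h1, h2⟩, h3, h4⟩ := hv
  exact ⟨h3, h1, h2, (h1.hasSum_coeff_sq h3 k₁).unique (h4 _).1,
    (h1.hasSum_coeff_sq h3 k₂).unique (h4 _).2⟩

namespace Regular

variable {l : ℝ × ℝ × ℝ} {Z : ℂ × ℂ}

lemma J_fst (h : Regular k₁ k₂ t a l Z) (h₁ : 1 ≤ k₁) (h₁₂ : k₁ < k₂) :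
    J (wave k₁ k₂ Z (a l)) l.1 l.2.1 l.2.2 k₁ =
      ((m l.2.2 (l.2.1 * k₁) - l.1) * (t / 2) + redCoeff k₁ k₂ a 0 (invariants k₁ k₂ Z, l) : ℝ) *
        Z.1 + redCoeff k₁ k₂ a 1 (invariants k₁ k₂ Z, l) * exc k₁ k₂ Z := by
  rw [J, h.coeff_sq_fst, (h.coeffFamily.coeff_wave h.norm_lt h₁ h₁₂).1]
  push_cast
  ring

lemma J_snd (h : Regular k₁ k₂ t a l Z) (h₁ : 1 ≤ k₁) (h₁₂ : k₁ < k₂) :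
    J (wave k₁ k₂ Z (a l)) l.1 l.2.1 l.2.2 k₂ =
      ((m l.2.2 (l.2.1 * k₂) - l.1) * (t / 2) + redCoeff k₁ k₂ a 2 (invariants k₁ k₂ Z, l) : ℝ) *
        Z.2 + redCoeff k₁ k₂ a 3 (invariants k₁ k₂ Z, l) * exc k₂ k₁ Z.swap := by
  rw [J, h.coeff_sq_snd, (h.coeffFamily.coeff_wave h.norm_lt h₁ h₁₂).2]
  push_cast
  ring

/-- Insert the reduced form into the orthogonality relation. The terms in |Z₁|² and |Z₂|² are real,
and the exceptional ones are multiples of I and of its conjugate, whose imaginary parts are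
opposite. -/
lemma redundancy (h : Regular k₁ k₂ t a l Z) (ht : 0 < t) (h₁ : 1 ≤ k₁) (h₁₂ : k₁ < k₂) :
    (k₁ * redCoeff k₁ k₂ a 1 (invariants k₁ k₂ Z, l) -
      k₂ * redCoeff k₁ k₂ a 3 (invariants k₁ k₂ Z, l)) * (resonance k₁ k₂ Z).im = 0 := by
  have h1 := h.coeffFamily.im_eq_zero h.norm_lt h₁ h₁₂ h.ne_zero
  obtain ⟨e1, e2⟩ := h.coeffFamily.coeff_wave h.norm_lt h₁ h₁₂
  rw [e1, e2, h.coeff_sq_fst, h.coeff_sq_snd] at h1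
  have key (z w : ℂ) (x y : ℝ) :
      (conj (t / 2 * z) * (x * z + y * w)).im = t / 2 * (y * (conj z * w).im) := by
    have : conj (t / 2 * z) * (x * z + y * w) =
        ((t / 2 * (x * Complex.normSq z) : ℝ) : ℂ) + ((t / 2 * y : ℝ) : ℂ) * (conj z * w) := by
      push_cast
      rw [← Complex.mul_conj]
      simp only [map_mul, map_div₀, Complex.conj_ofReal, map_ofNat]
      ring
    rw [this, Complex.add_im, Complex.ofReal_im, Complex.im_ofReal_mul]
    ring
  rw [key, key, conj_mul_exc_fst (by omega), conj_mul_exc_snd h₁, Complex.conj_im] at h1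
  have : t / 2 * ((k₁ * redCoeff k₁ k₂ a 1 (invariants k₁ k₂ Z, l) -
      k₂ * redCoeff k₁ k₂ a 3 (invariants k₁ k₂ Z, l)) * (resonance k₁ k₂ Z).im) = 0 := by
    linear_combination h1
  exact (mul_eq_zero.1 this).resolve_left (by positivity)

lemma isSolution (h : Regular k₁ k₂ t a l Z)
    (e1 : J (wave k₁ k₂ Z (a l)) l.1 l.2.1 l.2.2 k₁ = 0)
    (e2 : J (wave k₁ k₂ Z (a l)) l.1 l.2.1 l.2.2 k₂ = 0) :
    IsSolution (wave k₁ k₂ Z (a l)) l.1 l.2.1 l.2.2 := by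
  have hJ (k : ℤ) : J (wave k₁ k₂ Z (a l)) l.1 l.2.1 l.2.2 (-k) =
      conj (J (wave k₁ k₂ Z (a l)) l.1 l.2.1 l.2.2 k) := by
    rw [J, J, coeff_neg, coeff_neg, Int.cast_neg, mul_neg, m_neg]
    simp
  have key {k : ℤ} {n : ℕ} (hn : k.natAbs = n)
      (hJn : J (wave k₁ k₂ Z (a l)) l.1 l.2.1 l.2.2 n = 0) :
      J (wave k₁ k₂ Z (a l)) l.1 l.2.1 l.2.2 k = 0 := by
    rcases Int.natAbs_eq k with e | e <;> rw [e, hn]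
    · exact hJn
    · rw [hJ, hJn, map_zero]
  intro k
  by_cases hk1 : k.natAbs = k₁
  · exact key hk1 e1
  by_cases hk2 : k.natAbs = k₂
  · exact key hk2 e2
  exact h.coeffFamily.J_eq_zero h.norm_lt hk1 hk2 (h.ne_zero k hk1 hk2)

/-- The solutions that are not resonant satisfy the reduced equations. -/
lemma eq_zero_of_isSolution (h : Regular k₁ k₂ t a l Z) (h₁ : 1 ≤ k₁) (h₁₂ : k₁ < k₂)
    (hs : IsSolution (wave k₁ k₂ Z (a l)) l.1 l.2.1 l.2.2) (hI : (resonance k₁ k₂ Z).im ≠ 0) :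
    (m l.2.2 (l.2.1 * k₁) - l.1) * (t / 2) + redCoeff k₁ k₂ a 0 (invariants k₁ k₂ Z, l) = 0 ∧
    (m l.2.2 (l.2.1 * k₂) - l.1) * (t / 2) + redCoeff k₁ k₂ a 2 (invariants k₁ k₂ Z, l) = 0 ∧
    redCoeff k₁ k₂ a 1 (invariants k₁ k₂ Z, l) = 0 := by
  -- Multiplying by z̄ makes the first term real; the imaginary part then gives y = 0, and x = 0
  -- follows.
  have key (x y : ℝ) (z w : ℂ) (hzw : (conj z * w).im ≠ 0) (h0 : x * z + y * w = 0) :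
      x = 0 ∧ y = 0 := by
    have h1 : ((x * Complex.normSq z : ℝ) : ℂ) + y * (conj z * w) = 0 := by
      push_cast
      rw [← Complex.mul_conj]
      linear_combination conj z * h0
    have h2 := congrArg Complex.im h1
    rw [Complex.add_im, Complex.ofReal_im, Complex.im_ofReal_mul, zero_add, Complex.zero_im] at h2
    have hy : y = 0 := (mul_eq_zero.1 h2).resolve_right hzw
    have hz : z ≠ 0 := by
      rintro rfl
      simp at hzw
    rw [hy] at h0
    simp only [Complex.ofReal_zero, zero_mul, add_zero, mul_eq_zero, hz, or_false,
      Complex.ofReal_eq_zero] at h0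
    exact ⟨h0, hy⟩
  have e1 := hs k₁
  have e2 := hs k₂
  rw [h.J_fst h₁ h₁₂] at e1
  rw [h.J_snd h₁ h₁₂] at e2
  obtain ⟨f1, f2⟩ := key _ _ _ _ (by rwa [conj_mul_exc_fst (by omega)]) e1
  obtain ⟨f3, -⟩ := key _ _ _ _ (by
    rw [conj_mul_exc_snd h₁, Complex.conj_im]
    exact neg_ne_zero.2 hI) e2
  exact ⟨f1, f3, f2⟩

end Regular

/-- The redundancy relation gives k₁B₁ = k₂B₂ wherever the resonant product is not real. For Z₁ ≠ 0
such amplitudes accumulate at Z, so the relation extends by continuity and the fourth real equation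
follows from the third. -/
lemma eventually_redCoeff_mul_exc (ht : 0 < t) (h₁ : 1 ≤ k₁) (h₁₂ : k₁ < k₂) {l₀ : ℝ × ℝ × ℝ}
    (ha : ContDiffAt ℝ ω a l₀)
    (hreg : ∀ᶠ v in 𝓝 (l₀, (0 : ℂ × ℂ)), Regular k₁ k₂ t a v.1 v.2) :
    ∀ᶠ v in 𝓝 (l₀, (0 : ℂ × ℂ)), redCoeff k₁ k₂ a 1 (invariants k₁ k₂ v.2, v.1) = 0 →
      redCoeff k₁ k₂ a 3 (invariants k₁ k₂ v.2, v.1) * exc k₂ k₁ v.2.swap = 0 := by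
  let d : (ℝ × ℝ × ℝ) × (ℝ × ℝ × ℝ) → ℝ := fun v =>
    k₁ * redCoeff k₁ k₂ a 1 v - k₂ * redCoeff k₁ k₂ a 3 v
  have hd : ContDiffAt ℝ ω d (0, l₀) :=
    (contDiffAt_const.mul (contDiffAt_redCoeff h₁ (by omega) ha 1)).sub
      (contDiffAt_const.mul (contDiffAt_redCoeff h₁ (by omega) ha 3))
  have hd' : ∀ᶠ v in 𝓝 ((0 : ℝ × ℝ × ℝ), l₀), ContinuousAt d v := by
    filter_upwards [hd.eventually (by simp)] with v hv using hv.continuousAt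
  have hinv : Continuous fun v : (ℝ × ℝ × ℝ) × (ℂ × ℂ) => (invariants k₁ k₂ v.2, v.1) :=
    ((continuous_invariants k₁ k₂).comp continuous_snd).prodMk continuous_fst
  filter_upwards [(hinv.tendsto' (l₀, 0) (0, l₀)
    (by simp [invariants_zero k₁ (by omega : 1 ≤ k₂)])).eventually hd',
    eventually_eventually_nhds.2 hreg] with ⟨l, Z⟩ h1 h2 h3
  -- If Z₁ = 0 the perturbation in Z₂ is of no use, but the exceptional monomial Z̄₂^{k₁-1} Z₁^{k₂}
  -- is then zero itself.
  by_cases hZ : Z.1 = 0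
  · rw [exc, Prod.snd_swap, hZ, zero_pow (by omega), mul_zero, mul_zero]
  · have hcont : Continuous fun w : ℂ => (l, (Z.1, w)) := by fun_prop
    have h4 : ∀ᶠ w in 𝓝 Z.2, Regular k₁ k₂ t a l (Z.1, w) := (hcont.tendsto Z.2).eventually h2
    have h5 : Tendsto (fun w : ℂ => d (invariants k₁ k₂ (Z.1, w), l)) (𝓝 Z.2)
        (𝓝 (d (invariants k₁ k₂ Z, l))) :=
      Tendsto.comp (f := fun w : ℂ => (invariants k₁ k₂ (Z.1, w), l)) h1
        ((hinv.comp hcont).tendsto Z.2)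
    have h6 : d (invariants k₁ k₂ Z, l) = 0 := by
      by_contra hne
      obtain ⟨w, hw1, hw2, hw3⟩ := ((frequently_im_resonance_ne_zero (k₂ := k₂) h₁ hZ).and_eventually
        (h4.and (h5.eventually (isOpen_ne.mem_nhds hne)))).exists
      exact hw1 ((mul_eq_zero.1 (hw2.redundancy ht h₁ h₁₂)).resolve_left hw3)
    have h7 : (k₂ : ℝ) * redCoeff k₁ k₂ a 3 (invariants k₁ k₂ Z, l) = 0 := by
      change k₁ * redCoeff k₁ k₂ a 1 (invariants k₁ k₂ Z, l) -
        k₂ * redCoeff k₁ k₂ a 3 (invariants k₁ k₂ Z, l) = 0 at h6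
      have h3' : redCoeff k₁ k₂ a 1 (invariants k₁ k₂ Z, l) = 0 := h3
      rw [h3', mul_zero, zero_sub, neg_eq_zero] at h6
      exact h6
    have h8 : redCoeff k₁ k₂ a 3 (invariants k₁ k₂ Z, l) = 0 :=
      (mul_eq_zero.1 h7).resolve_left (by exact_mod_cast (by omega : k₂ ≠ 0))
    rw [h8, Complex.ofReal_zero, zero_mul]

/-- The left-hand side of the reduced bifurcation equations. -/
def redEq (k₁ k₂ : ℕ) (t : ℝ) (a : ℝ × ℝ × ℝ → L1 Idx) (v : (ℝ × ℝ × ℝ) × (ℝ × ℝ × ℝ)) :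
    ℝ × ℝ × ℝ :=
  ((m v.2.2.2 (v.2.2.1 * k₁) - v.2.1) * (t / 2) + redCoeff k₁ k₂ a 0 v,
    (m v.2.2.2 (v.2.2.1 * k₂) - v.2.1) * (t / 2) + redCoeff k₁ k₂ a 2 v, redCoeff k₁ k₂ a 1 v)

/-- The solution of the reduced bifurcation equations. -/
lemma exists_reduced_solution (hk : Nat.Coprime k₁ k₂)
    (h : IsNondegenerateSymmetryBreaking k₁ k₂ c₀ κ₀ T₀) (ht : 0 < t)
    (ha : ContDiffAt ℝ ω a (c₀, κ₀, T₀))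
    (ha' : ∀ᶠ l in 𝓝 (c₀, κ₀, T₀), IsCoeffFamily k₁ k₂ l.1 l.2.1 l.2.2 t (a l)) :
    ∃ Λ : ℝ × ℝ × ℝ → ℝ × ℝ × ℝ, Λ 0 = (c₀, κ₀, T₀) ∧ ContDiffAt ℝ ω Λ 0 ∧
      ∀ᶠ v in 𝓝 ((0 : ℝ × ℝ × ℝ), (c₀, κ₀, T₀)), (redEq k₁ k₂ t a v = 0 ↔ Λ v.1 = v.2) := by
  have hω : (ω : WithTop ℕ∞) ≠ 0 := by simp
  have hb := h.toIsDoubleBifurcationPoint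
  have h₁ := hb.one_le
  have h₂ : 1 ≤ k₂ := h₁.trans hb.lt.le
  have hm (k : ℕ) : ContDiffAt ℝ ω (fun v : (ℝ × ℝ × ℝ) × (ℝ × ℝ × ℝ) =>
      (m v.2.2.2 (v.2.2.1 * k) - v.2.1) * (t / 2)) (0, (c₀, κ₀, T₀)) := by
    refine ((ContDiffAt.comp (g := fun x : ℝ × ℝ => m x.2 (x.1 * k))
      (f := fun v : (ℝ × ℝ × ℝ) × (ℝ × ℝ × ℝ) => v.2.2) (0, (c₀, κ₀, T₀))
      (contDiffAt_m (x₀ := (κ₀, T₀)) hb.κ_pos hb.T_pos k) (by fun_prop)).sub ?_).mul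
      contDiffAt_const
    fun_prop
  have hH : ContDiffAt ℝ ω (redEq k₁ k₂ t a) (0, (c₀, κ₀, T₀)) :=
    ((hm k₁).add (contDiffAt_redCoeff h₁ h₂ ha 0)).prodMk
      (((hm k₂).add (contDiffAt_redCoeff h₁ h₂ ha 2)).prodMk (contDiffAt_redCoeff h₁ h₂ ha 1))
  set q : Idx := ((0, k₁), (k₂ - 1, 0)) with hq
  let Ψ : ℝ × ℝ × ℝ → ℝ := fun l => conv (a l) (a l) q
  have hΨ : DifferentiableAt ℝ Ψ (c₀, κ₀, T₀) :=
    (((lp.evalCLM ℝ (fun _ : Idx => ℝ) 1 q).contDiff.contDiffAt.comp _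
      (contDiffAt_conv_self ha)).differentiableAt hω)
  have hH0 : ∀ᶠ l in 𝓝 (c₀, κ₀, T₀), redEq k₁ k₂ t a (0, l) =
      ((m l.2.2 (l.2.1 * k₁) - l.1) * (t / 2), (m l.2.2 (l.2.1 * k₂) - l.1) * (t / 2), Ψ l) := by
    filter_upwards [ha'] with l hl
    obtain ⟨e1, e2, e3⟩ := pair_redFam_zero h₁ h₂ hk (b := conv (a l) (a l)) (fun p hp => by
      rw [(hl p).2, uSqHat_of_deg_lt_two _ _ _ _ _ hp, zero_mul])
    simp only [redEq, redCoeff, e1, e2, e3, add_zero, Ψ, hq]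
  obtain ⟨hκd, hκ0, -⟩ := hb.exists_curve
  have hc0 : c0 k₁ k₂ T₀ = c₀ := by rw [c0, hκ0, hb.m_eq.1]
  have hcc : ContinuousAt (c0 k₁ k₂) T₀ := by
    have h1 := (contDiffAt_m (x₀ := (κ₀, T₀)) hb.κ_pos hb.T_pos k₁).continuousAt
    exact ContinuousAt.comp (g := fun x : ℝ × ℝ => m x.2 (x.1 * k₁))
      (f := fun T => (kappa0 k₁ k₂ T, T)) (by simpa only [hκ0] using h1)
      (hκd.continuousAt.prodMk continuousAt_id)
  have hcurve : Tendsto (fun T => (c0 k₁ k₂ T, kappa0 k₁ k₂ T, T)) (𝓝 T₀) (𝓝 (c₀, κ₀, T₀)) := by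
    have := (hcc.prodMk (hκd.continuousAt.prodMk continuousAt_id)).tendsto
    simpa only [hc0, hκ0, id] using this
  have hphi : ∀ᶠ T in 𝓝 T₀,
      Ψ (c0 k₁ k₂ T, kappa0 k₁ k₂ T, T) = phi k₁ k₂ T * t ^ q.deg := by
    filter_upwards [hcurve.eventually ha'] with T hT
    -- The index in the definition of φ is the conjugate of the exceptional monomial of wave number
    -- k₁; the symmetry of the coefficients makes the two values equal.
    rw [phi, show ((k₂ - 1, 0), (0, k₁)) = q.swap from rfl, uSqHat_swap]
    exact (hT q).2
  have hΨ' : deriv (fun T => Ψ (c0 k₁ k₂ T, kappa0 k₁ k₂ T, T)) T₀ ≠ 0 := by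
    rw [EventuallyEq.deriv_eq hphi, deriv_mul_const_field]
    exact mul_ne_zero h.deriv_ne_zero (pow_ne_zero _ ht.ne')
  have hL : DifferentiableAt ℝ (fun l => redEq k₁ k₂ t a (0, l)) (c₀, κ₀, T₀) :=
    DifferentiableAt.comp (g := redEq k₁ k₂ t a) (c₀, κ₀, T₀) (hH.differentiableAt hω)
      (by fun_prop)
  set L := fderiv ℝ (fun l => redEq k₁ k₂ t a (0, l)) (c₀, κ₀, T₀) with hLdef
  have hinj : Function.Injective L :=
    hb.linearization_injective (r := t / 2) (by positivity) hΨ hΨ'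
      (hL.hasFDerivAt.congr_of_eventuallyEq (EventuallyEq.symm hH0))
  -- An injective endomorphism in finite dimension is invertible.
  let A : (ℝ × ℝ × ℝ) ≃L[ℝ] ℝ × ℝ × ℝ :=
    (LinearEquiv.ofInjectiveEndo (L : (ℝ × ℝ × ℝ) →ₗ[ℝ] ℝ × ℝ × ℝ) hinj).toContinuousLinearEquiv
  have hA : (A : (ℝ × ℝ × ℝ) →L[ℝ] ℝ × ℝ × ℝ) = L := rfl
  obtain ⟨Λ, h1, h2, -, h4⟩ := exists_analytic_implicit hH A (hA ▸ hL.hasFDerivAt) (by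
    rw [hH0.self_of_nhds, hb.m_eq.1, hb.m_eq.2]
    have h5 := hphi.self_of_nhds
    rw [hc0, hκ0, h.phi_eq_zero, zero_mul] at h5
    rw [h5]
    simp)
  exact ⟨Λ, h1, h2, h4⟩

end Reduced

end

section

open Filter Topology BoundedContinuousFunction MeasureTheory AddCircle
open scoped ComplexConjugate

/-! ### Symmetric waves -/

/-- The translate `x ↦ u(x + y)`. -/
def translate (y : Circ) (u : C(Circ, ℝ)) : C(Circ, ℝ) := u.comp ⟨fun x => x + y, by fun_prop⟩

/-- The reflection `x ↦ u(-x)`. -/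
def reflect (u : C(Circ, ℝ)) : C(Circ, ℝ) := u.comp ⟨fun x => -x, by fun_prop⟩

lemma coeff_translate (y : Circ) (u : C(Circ, ℝ)) (k : ℤ) :
    coeff (translate y u) k = fourier k y * coeff u k := by
  rw [coeff, coeff, fourierCoeff, fourierCoeff, ← integral_const_mul]
  rw [← integral_add_right_eq_self (μ := haarAddCircle)
    (fun x : Circ => (fourier k y : ℂ) * ((fourier (-k) x : ℂ) • ((u x : ℝ) : ℂ))) y]
  congr 1
  funext x
  have h1 : (fourier k y : ℂ) * fourier (-k) y = 1 := by
    rw [← fourier_add, add_neg_cancel, fourier_zero]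
  have h2 : (fourier (-k) (x + y) : ℂ) = fourier (-k) x * fourier (-k) y := by
    simp [fourier_apply, smul_add, toCircle_add]
  rw [h2, smul_eq_mul, smul_eq_mul]
  change fourier (-k) x * ((u (x + y) : ℝ) : ℂ) = _
  linear_combination (-(fourier (-k) x * ((u (x + y) : ℝ) : ℂ))) * h1

lemma coeff_reflect (u : C(Circ, ℝ)) (k : ℤ) : coeff (reflect u) k = conj (coeff u k) := by
  rw [← coeff_neg, coeff, coeff, fourierCoeff, fourierCoeff]
  rw [← integral_neg_eq_self (μ := haarAddCircle)
    (fun x : Circ => ((fourier (-(-k)) x : ℂ) • ((u x : ℝ) : ℂ)))]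
  congr 1
  funext x
  change (fourier (-k) x : ℂ) • ((u (-x) : ℝ) : ℂ) = _
  congr 1
  simp [fourier_apply]

lemma eq_of_coeff {u v : C(Circ, ℝ)} (h : ∀ k, coeff u k = coeff v k) : u = v := by
  have h1 : toC u = toC v := eq_of_coeffC h
  ext x
  exact Complex.ofReal_injective (congr($h1 x))

/-- Translation by y multiplies the k-th coefficient by e^{iky} and reflection conjugates it, so
evenness of a translate means that its coefficients are real. -/
lemma isSymmetric_iff (u : C(Circ, ℝ)) : IsSymmetric (fun x : ℝ => u (x : Circ)) ↔
    ∃ y : ℝ, ∀ k, conj (fourier k (y : Circ) * coeff u k) = fourier k (y : Circ) * coeff u k := by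
  refine exists_congr fun y => ?_
  have h1 : (Function.Even fun x : ℝ => u ((x + y : ℝ) : Circ)) ↔
      reflect (translate y u) = translate y u := by
    constructor
    · intro h
      ext x
      obtain ⟨x, rfl⟩ := QuotientAddGroup.mk_surjective x
      exact h x
    · intro h x
      exact congr($h (x : Circ))
  rw [h1]
  constructor
  · intro h k
    rw [← coeff_translate, ← coeff_reflect, h]
  · intro h
    refine eq_of_coeff fun k => ?_
    rw [coeff_reflect, coeff_translate, h]

lemma fourier_coe (k : ℤ) (y : ℝ) : (fourier k (y : Circ) : ℂ) = Complex.exp (k * y * Complex.I) := by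
  rw [fourier_coe_apply]
  congr 1
  push_cast
  field_simp

/-- Translating the wave rotates the amplitudes, and each monomial picks up the phase of its wave
number. -/
lemma mono_rotate (k₁ k₂ : ℕ) (Z : ℂ × ℂ) (y : ℝ) (p : Idx) :
    mono (fourier k₁ (y : Circ) * Z.1, fourier k₂ (y : Circ) * Z.2) p =
      fourier (p.freq k₁ k₂) (y : Circ) * mono Z p := by
  have e (k : ℕ) : conj (Complex.exp ((k : ℤ) * y * Complex.I)) =
      Complex.exp (-(k * y * Complex.I)) := by
    rw [← Complex.exp_conj]
    simp
  simp only [fourier_coe, mono, map_mul, mul_pow, e, ← Complex.exp_nat_mul]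
  have h : Complex.exp (p.freq k₁ k₂ * y * Complex.I) =
      Complex.exp (p.1.1 * ((k₁ : ℤ) * y * Complex.I)) *
      Complex.exp (p.2.1 * -(k₁ * y * Complex.I)) *
      (Complex.exp (p.1.2 * ((k₂ : ℤ) * y * Complex.I)) *
      Complex.exp (p.2.2 * -(k₂ * y * Complex.I))) := by
    rw [← Complex.exp_add, ← Complex.exp_add, ← Complex.exp_add]
    congr 1
    simp only [Idx.freq]
    push_cast
    ring
  rw [h]
  ring

/-- The resonant product is a monomial of wave number zero. -/
lemma resonance_rotate (k₁ k₂ : ℕ) (Z : ℂ × ℂ) (y : ℝ) :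
    resonance k₁ k₂ (fourier k₁ (y : Circ) * Z.1, fourier k₂ (y : Circ) * Z.2) =
      resonance k₁ k₂ Z := by
  have h := mono_rotate k₁ k₂ Z y ((0, k₁), (k₂, 0))
  have hf : Idx.freq k₁ k₂ ((0, k₁), (k₂, 0)) = 0 := by
    simp only [Idx.freq]
    push_cast
    ring
  rw [hf] at h
  simpa [mono, resonance] using h

lemma conj_mono {Z : ℂ × ℂ} (h1 : conj Z.1 = Z.1) (h2 : conj Z.2 = Z.2) (p : Idx) :
    conj (mono Z p) = mono Z p := by
  simp only [mono, map_mul, map_pow, h1, h2]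

section Symmetry

variable {k₁ k₂ : ℕ} {c κ T t : ℝ} {a : L1 Idx}

/-- After translation by y both amplitudes are real, hence so are all monomials; as the family `a`
is real, all Fourier coefficients of the translate are real. -/
lemma IsCoeffFamily.isSymmetric_of_real (h : IsCoeffFamily k₁ k₂ c κ T t a) {Z : ℂ × ℂ}
    (hZ : ‖Z‖ < 1 / 2) (y : ℝ)
    (h1 : conj (fourier k₁ (y : Circ) * Z.1) = fourier k₁ (y : Circ) * Z.1)
    (h2 : conj (fourier k₂ (y : Circ) * Z.2) = fourier k₂ (y : Circ) * Z.2) :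
    IsSymmetric fun x : ℝ => wave k₁ k₂ Z a (x : Circ) := by
  refine (isSymmetric_iff _).2 ⟨y, fun k => ?_⟩
  have h3 := (h.hasSum_coeff hZ k).mul_left (fourier k (y : Circ) : ℂ)
  have h4 := h3.star
  refine h4.unique ?_
  convert! h3 using 2 with p
  split_ifs with hp
  · have e : (fourier k (y : Circ) : ℂ) * ((a p : ℂ) * mono Z p) =
        a p * mono (fourier k₁ (y : Circ) * Z.1, fourier k₂ (y : Circ) * Z.2) p := by
      rw [mono_rotate, hp]
      ring
    rw [e]
    change conj _ = _
    rw [map_mul, Complex.conj_ofReal, conj_mono h1 h2]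
  · simp

/-- Some translate has real coefficients of orders k₁ and k₂, that is, real amplitudes, and the
resonant product does not change under translation. -/
lemma IsCoeffFamily.im_resonance_of_isSymmetric (h : IsCoeffFamily k₁ k₂ c κ T t a) {Z : ℂ × ℂ}
    (hZ : ‖Z‖ < 1 / 2) (ht : 0 < t) (h₁ : 1 ≤ k₁) (h₁₂ : k₁ < k₂)
    (hs : IsSymmetric fun x : ℝ => wave k₁ k₂ Z a (x : Circ)) : (resonance k₁ k₂ Z).im = 0 := by
  obtain ⟨y, hy⟩ := (isSymmetric_iff _).1 hs
  obtain ⟨e1, e2⟩ := h.coeff_wave hZ h₁ h₁₂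
  have key {n : ℕ} {z : ℂ} (hz : coeff (wave k₁ k₂ Z a) n = t / 2 * z) :
      conj (fourier n (y : Circ) * z) = fourier n (y : Circ) * z := by
    have h1 := hy n
    rw [hz, mul_left_comm, map_mul] at h1
    have h2 : conj ((t : ℂ) / 2) = t / 2 := by
      rw [map_div₀, Complex.conj_ofReal, map_ofNat]
    have h3 : (t : ℂ) / 2 ≠ 0 := by
      have : (t : ℂ) ≠ 0 := by exact_mod_cast ht.ne'
      simpa using this
    rw [h2] at h1
    exact mul_left_cancel₀ h3 h1
  rw [← resonance_rotate k₁ k₂ Z y, ← Complex.conj_eq_iff_im]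
  simp only [resonance, map_mul (starRingEnd ℂ) (_ ^ _), map_pow, key e1, key e2]

end Symmetry

/-- The amplitudes `(r₁ e^{ik₁θ₁}, r₂ e^{ik₂θ₂})`. -/
def polar (k₁ k₂ : ℕ) (p : (ℝ × ℝ) × (ℝ × ℝ)) : ℂ × ℂ :=
  (p.1.1 * Complex.exp (k₁ * p.2.1 * Complex.I), p.1.2 * Complex.exp (k₂ * p.2.2 * Complex.I))

lemma contDiff_polar (k₁ k₂ : ℕ) : ContDiff ℝ ω (polar k₁ k₂) := by
  have h : ContDiff ℝ ω (fun x : ℝ => (x : ℂ)) := Complex.ofRealCLM.contDiff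
  have he : ContDiff ℝ ω Complex.exp := Complex.contDiff_exp
  have hI (k : ℕ) {f : (ℝ × ℝ) × (ℝ × ℝ) → ℝ} (hf : ContDiff ℝ ω f) :
      ContDiff ℝ ω fun p => Complex.exp (k * f p * Complex.I) :=
    he.comp ((contDiff_const.mul (h.comp hf)).mul contDiff_const)
  exact ((h.comp (by fun_prop)).mul (hI k₁ (by fun_prop))).prodMk
    ((h.comp (by fun_prop)).mul (hI k₂ (by fun_prop)))

lemma norm_exp_mul_I (k : ℕ) (x : ℝ) : ‖Complex.exp (k * x * Complex.I)‖ = 1 := by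
  rw [show (k * x * Complex.I : ℂ) = ((k * x : ℝ) : ℂ) * Complex.I by push_cast; ring]
  exact Complex.norm_exp_ofReal_mul_I _

lemma norm_polar (k₁ k₂ : ℕ) (p : (ℝ × ℝ) × (ℝ × ℝ)) :
    ‖(polar k₁ k₂ p).1‖ = |p.1.1| ∧ ‖(polar k₁ k₂ p).2‖ = |p.1.2| := by
  simp only [polar, norm_mul, norm_exp_mul_I, Complex.norm_real, Real.norm_eq_abs, mul_one,
    and_self]

lemma polar_periodic {k₁ k₂ : ℕ} (h₁ : 1 ≤ k₁) (h₂ : 1 ≤ k₂) :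
    TorusPeriodic k₁ k₂ (polar k₁ k₂) := by
  have key {k : ℕ} (hk : 1 ≤ k) (x : ℝ) :
      Complex.exp (k * ((x + 2 * Real.pi / k : ℝ) : ℂ) * Complex.I) =
        Complex.exp (k * x * Complex.I) := by
    have hk' : (k : ℂ) ≠ 0 := by exact_mod_cast (by omega : k ≠ 0)
    rw [← Complex.exp_periodic (k * x * Complex.I)]
    congr 1
    push_cast
    field_simp
  intro r θ
  simp only [polar, key h₁, key h₂, and_self]

lemma exists_polar_eq {k₁ k₂ : ℕ} (h₁ : 1 ≤ k₁) (h₂ : 1 ≤ k₂) (z : ℂ × ℂ) :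
    ∃ p, 0 ≤ p.1.1 ∧ 0 ≤ p.1.2 ∧ polar k₁ k₂ p = z := by
  refine ⟨((‖z.1‖, ‖z.2‖), (z.1.arg / k₁, z.2.arg / k₂)), norm_nonneg _, norm_nonneg _, ?_⟩
  have hk₁ : (k₁ : ℂ) ≠ 0 := by exact_mod_cast (by omega : k₁ ≠ 0)
  have hk₂ : (k₂ : ℂ) ≠ 0 := by exact_mod_cast (by omega : k₂ ≠ 0)
  simp only [polar]
  push_cast
  rw [mul_div_cancel₀ _ hk₁, mul_div_cancel₀ _ hk₂, Complex.norm_mul_exp_arg_mul_I,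
    Complex.norm_mul_exp_arg_mul_I]

lemma im_resonance_polar (k₁ k₂ : ℕ) (p : (ℝ × ℝ) × (ℝ × ℝ)) :
    (resonance k₁ k₂ (polar k₁ k₂ p)).im =
      p.1.1 ^ k₂ * p.1.2 ^ k₁ * Real.sin (k₁ * k₂ * (p.2.2 - p.2.1)) := by
  have e : resonance k₁ k₂ (polar k₁ k₂ p) = ((p.1.1 ^ k₂ * p.1.2 ^ k₁ : ℝ) : ℂ) *
      Complex.exp (((k₁ * k₂ * (p.2.2 - p.2.1) : ℝ) : ℂ) * Complex.I) := by
    simp only [resonance, polar, map_mul, ← Complex.exp_conj, Complex.conj_ofReal, mul_pow,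
      map_natCast, Complex.conj_I, ← Complex.exp_nat_mul]
    have h : Complex.exp (((k₁ * k₂ * (p.2.2 - p.2.1) : ℝ) : ℂ) * Complex.I) =
        Complex.exp (k₂ * (k₁ * p.2.1 * -Complex.I)) *
          Complex.exp (k₁ * (k₂ * p.2.2 * Complex.I)) := by
      rw [← Complex.exp_add]
      congr 1
      push_cast
      ring
    rw [h]
    push_cast
    ring
  rw [e, Complex.im_ofReal_mul, Complex.exp_ofReal_mul_I_im]

lemma resonance_smul (k₁ k₂ : ℕ) (r : ℝ) (Z : ℂ × ℂ) :
    resonance k₁ k₂ (r • Z) = ((r ^ (k₁ + k₂) : ℝ) : ℂ) * resonance k₁ k₂ Z := by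
  simp only [resonance, Prod.smul_fst, Prod.smul_snd, Complex.real_smul, map_mul,
    Complex.conj_ofReal, mul_pow, pow_add]
  push_cast
  ring

lemma im_resonance_polar_ne_zero_iff {k₁ k₂ : ℕ} (h₁ : 1 ≤ k₁) (h₂ : 1 ≤ k₂)
    (r₁ r₂ θ₁ θ₂ : ℝ) : (resonance k₁ k₂ (polar k₁ k₂ ((r₁, r₂), (θ₁, θ₂)))).im ≠ 0 ↔
      r₁ * r₂ ≠ 0 ∧ ¬ ∃ n : ℤ, θ₁ - θ₂ = n * (Real.pi / (k₁ * k₂)) := by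
  have hk₁ : (k₁ : ℝ) ≠ 0 := by exact_mod_cast (by omega : k₁ ≠ 0)
  have hk₂ : (k₂ : ℝ) ≠ 0 := by exact_mod_cast (by omega : k₂ ≠ 0)
  have h : (∃ n : ℤ, θ₁ - θ₂ = n * (Real.pi / (k₁ * k₂))) ↔
      Real.sin (k₁ * k₂ * (θ₂ - θ₁)) = 0 := by
    rw [Real.sin_eq_zero_iff]
    constructor
    · rintro ⟨n, hn⟩
      refine ⟨-n, ?_⟩
      rw [← neg_sub θ₁, hn]
      push_cast
      field_simp
    · rintro ⟨n, hn⟩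
      refine ⟨-n, ?_⟩
      have : θ₁ - θ₂ = -(k₁ * k₂ * (θ₂ - θ₁)) / (k₁ * k₂) := by
        field_simp
        ring
      rw [this, ← hn]
      push_cast
      ring
  rw [im_resonance_polar, h, mul_ne_zero_iff, mul_ne_zero_iff, mul_ne_zero_iff,
    pow_ne_zero_iff (by omega), pow_ne_zero_iff (by omega)]

/-- If the resonant product is real, then some translation makes both amplitudes real. -/
lemma exists_rotate_real {k₁ k₂ : ℕ} (h₁ : 1 ≤ k₁) (h₂ : 1 ≤ k₂) (hk : Nat.Coprime k₁ k₂)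
    {Z : ℂ × ℂ} (hZ : (resonance k₁ k₂ Z).im = 0) :
    ∃ y : ℝ, conj (fourier k₁ (y : Circ) * Z.1) = fourier k₁ (y : Circ) * Z.1 ∧
      conj (fourier k₂ (y : Circ) * Z.2) = fourier k₂ (y : Circ) * Z.2 := by
  obtain ⟨⟨⟨r₁, r₂⟩, θ₁, θ₂⟩, -, -, rfl⟩ := exists_polar_eq h₁ h₂ Z
  have hk₁ : (k₁ : ℝ) ≠ 0 := by exact_mod_cast (by omega : k₁ ≠ 0)
  have hk₂ : (k₂ : ℝ) ≠ 0 := by exact_mod_cast (by omega : k₂ ≠ 0)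
  -- a phase that is a multiple of `π` is real
  have key {k : ℕ} {r θ y : ℝ} (hy : Real.sin (k * (y + θ)) = 0) :
      conj (fourier k (y : Circ) * (r * Complex.exp (k * θ * Complex.I))) =
        fourier k (y : Circ) * (r * Complex.exp (k * θ * Complex.I)) := by
    have e : (fourier k (y : Circ) : ℂ) * (r * Complex.exp (k * θ * Complex.I)) =
        (r : ℂ) * Complex.exp (((k * (y + θ) : ℝ) : ℂ) * Complex.I) := by
      rw [fourier_coe, mul_left_comm, ← Complex.exp_add]
      congr 2
      push_cast
      ring
    rw [e, Complex.conj_eq_iff_im, Complex.im_ofReal_mul, Complex.exp_ofReal_mul_I_im, hy, mul_zero]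
  by_cases hr₁ : r₁ = 0
  · exact ⟨-θ₂, by simp [polar, hr₁], key (by simp)⟩
  by_cases hr₂ : r₂ = 0
  · exact ⟨-θ₁, key (by simp), by simp [polar, hr₂]⟩
  have h := (im_resonance_polar_ne_zero_iff h₁ h₂ r₁ r₂ θ₁ θ₂).not.1 (not_not.2 hZ)
  rw [not_and, not_not] at h
  obtain ⟨n, hn⟩ := h (mul_ne_zero hr₁ hr₂)
  obtain ⟨x, y, hxy⟩ := Int.isCoprime_iff_gcd_eq_one.2 (by simpa using hk : Int.gcd k₁ k₂ = 1)
  have hxy' : (x : ℝ) * k₁ + y * k₂ = 1 := by exact_mod_cast hxy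
  -- The shift must bring both phases into πℤ. With xk₁ + yk₂ = 1 and θ₁ − θ₂ = nπ/(k₁k₂), this
  -- choice turns them into ynπ and −xnπ.
  refine ⟨y * n * Real.pi / k₁ - θ₁, key ?_, key ?_⟩
  · rw [Real.sin_eq_zero_iff]
    refine ⟨y * n, ?_⟩
    push_cast
    field_simp
    ring
  · rw [Real.sin_eq_zero_iff]
    refine ⟨-(x * n), ?_⟩
    have : θ₂ = θ₁ - n * (Real.pi / (k₁ * k₂)) := by linarith
    rw [this]
    push_cast
    field_simp
    linear_combination (-(n * Real.pi : ℝ)) * hxy'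

lemma IsCoeffFamily.isAsymmetric_iff {k₁ k₂ : ℕ} {c κ T t : ℝ} {a : L1 Idx}
    (h : IsCoeffFamily k₁ k₂ c κ T t a) {Z : ℂ × ℂ} (hZ : ‖Z‖ < 1 / 2) (ht : 0 < t) (h₁ : 1 ≤ k₁)
    (h₁₂ : k₁ < k₂) (hk : Nat.Coprime k₁ k₂) :
    IsAsymmetric (fun x : ℝ => wave k₁ k₂ Z a (x : Circ)) ↔ (resonance k₁ k₂ Z).im ≠ 0 := by
  refine not_congr ⟨h.im_resonance_of_isSymmetric hZ ht h₁ h₁₂, fun hI => ?_⟩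
  obtain ⟨y, hy1, hy2⟩ := exists_rotate_real h₁ (by omega) hk hI
  exact h.isSymmetric_of_real hZ y hy1 hy2

end

section

open Filter Topology BoundedContinuousFunction
open scoped ComplexConjugate

/-! ### The family of solutions -/

/-- The image of an open subset of `ℂ²` under a continuous map with a continuous left inverse is a
four-dimensional manifold. -/
lemma nonempty_chartedSpace_image {X : Type*} [TopologicalSpace X] {G : ℂ × ℂ → X}
    {B : Set (ℂ × ℂ)} (hB : IsOpen B) (hne : B.Nonempty) (hG : ContinuousOn G B)
    {f : X → ℂ × ℂ} (hf : Continuous f) (h : ∀ Z ∈ B, f (G Z) = Z) :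
    Nonempty (ChartedSpace (EuclideanSpace ℝ (Fin 4)) (G '' B)) := by
  have hdim : Module.finrank ℝ (ℂ × ℂ) = Module.finrank ℝ (EuclideanSpace ℝ (Fin 4)) := by
    simp [Complex.finrank_real_complex]
  let A : (ℂ × ℂ) ≃L[ℝ] EuclideanSpace ℝ (Fin 4) := ContinuousLinearEquiv.ofFinrankEq hdim
  have hmem (x : G '' B) : f x ∈ B := by
    obtain ⟨_, Z, hZ, rfl⟩ := x
    rw [h Z hZ]
    exact hZ
  let e : G '' B ≃ₜ B :=
    { toFun x := ⟨f x, hmem x⟩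
      invFun Z := ⟨G Z, mem_image_of_mem G Z.2⟩
      left_inv := by
        rintro ⟨_, Z, hZ, rfl⟩
        exact Subtype.ext (congrArg G (h Z hZ))
      right_inv Z := Subtype.ext (h Z Z.2)
      continuous_toFun := (hf.comp continuous_subtype_val).subtype_mk hmem
      continuous_invFun := (continuousOn_iff_continuous_domRestrict.1 hG).subtype_mk _ }
  -- The image is homeomorphic to an open subset of a four-dimensional real space, so a single chart
  -- suffices.
  have he : IsOpenEmbedding (fun x : G '' B => A (e x)) :=
    A.toHomeomorph.isOpenEmbedding.comp (hB.isOpenEmbedding_subtypeVal.comp e.isOpenEmbedding)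
  have : Nonempty (G '' B) := (hne.image G).to_subtype
  exact ⟨he.singletonChartedSpace⟩

lemma contDiff_invariants (k l : ℕ) : ContDiff ℝ ω (invariants k l) := by
  have hre : ContDiff ℝ ω Complex.re := Complex.reCLM.contDiff
  have him : ContDiff ℝ ω Complex.im := Complex.imCLM.contDiff
  have hc : ContDiff ℝ ω (fun z : ℂ => conj z) := Complex.conjCLE.contDiff
  have hn : ContDiff ℝ ω (fun z : ℂ => Complex.normSq z) := by
    simp only [Complex.normSq_apply]
    exact (hre.mul hre).add (him.mul him)
  exact (hn.comp contDiff_fst).prodMk ((hn.comp contDiff_snd).prodMk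
    (hre.comp (((hc.comp contDiff_fst).pow l).mul (contDiff_snd.pow k))))

/-- The invariants are at least quadratic in Z: the resonant product contains at least one factor
Z̄₁ and one factor Z₂. This is why c, κ and T deviate only at second order. -/
lemma norm_invariants_le {k l : ℕ} (hk : 1 ≤ k) (hl : 1 ≤ l) {Z : ℂ × ℂ} (hZ : ‖Z‖ ≤ 1) :
    ‖invariants k l Z‖ ≤ ‖Z‖ ^ 2 := by
  have h1 := norm_fst_le Z
  have h2 := norm_snd_le Z
  have h0 := norm_nonneg Z
  refine max_le ?_ (max_le ?_ ?_)
  · change ‖Complex.normSq Z.1‖ ≤ _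
    rw [Complex.normSq_eq_norm_sq, Real.norm_of_nonneg (by positivity)]
    gcongr
  · change ‖Complex.normSq Z.2‖ ≤ _
    rw [Complex.normSq_eq_norm_sq, Real.norm_of_nonneg (by positivity)]
    gcongr
  · refine (Complex.abs_re_le_norm _).trans ?_
    rw [norm_mul, norm_pow, norm_pow, RCLike.norm_conj, sq]
    have e1 : ‖Z.1‖ ^ l ≤ ‖Z‖ := (pow_le_pow_left₀ (norm_nonneg _) h1 l).trans
      (pow_le_of_le_one h0 hZ (by omega))
    have e2 : ‖Z.2‖ ^ k ≤ ‖Z‖ := (pow_le_pow_left₀ (norm_nonneg _) h2 k).trans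
      (pow_le_of_le_one h0 hZ (by omega))
    exact mul_le_mul e1 e2 (by positivity) h0

/-- The part of a family of degree at least two. -/
def highPart (N : Idx →ᵇ ℂ) : Idx →ᵇ ℂ :=
  ofNormedAddCommGroupDiscrete (fun p => if 2 ≤ p.deg then N p else 0) ‖N‖ (fun p => by
    split_ifs
    · exact N.norm_coe_le_norm p
    · simp)

lemma highPart_apply (N : Idx →ᵇ ℂ) (p : Idx) :
    highPart N p = if 2 ≤ p.deg then N p else 0 := rfl

lemma norm_mono_le (Z : ℂ × ℂ) (p : Idx) : ‖mono Z p‖ ≤ ‖Z‖ ^ p.deg := by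
  have h1 := norm_fst_le Z
  have h2 := norm_snd_le Z
  simp only [mono, norm_mul, norm_pow, RCLike.norm_conj, Idx.deg]
  rw [← pow_add, ← pow_add]
  calc ‖Z.1‖ ^ (p.1.1 + p.2.1) * ‖Z.2‖ ^ (p.1.2 + p.2.2)
      ≤ ‖Z‖ ^ (p.1.1 + p.2.1) * ‖Z‖ ^ (p.1.2 + p.2.2) := by gcongr
    _ = _ := by rw [← pow_add]; congr 1; omega

lemma norm_highPart_monoFam_le {Z : ℂ × ℂ} (hZ : ‖Z‖ < 1 / 2) :
    ‖highPart (monoFam ((2 : ℝ) • Z))‖ ≤ 4 * ‖Z‖ ^ 2 := by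
  obtain ⟨h1, h2⟩ := norm_two_smul_lt hZ
  refine (BoundedContinuousFunction.norm_le (by positivity)).2 fun p => ?_
  rw [highPart_apply]
  split_ifs with hp
  · rw [monoFam_apply h1 h2]
    refine (norm_mono_le _ p).trans ?_
    have h3 : ‖(2 : ℝ) • Z‖ = 2 * ‖Z‖ := by rw [norm_smul]; norm_num
    rw [h3]
    calc (2 * ‖Z‖) ^ p.deg ≤ (2 * ‖Z‖) ^ 2 :=
          pow_le_pow_of_le_one (by positivity) (by linarith) hp
      _ = _ := by ring
  · simp only [norm_zero]
    positivity

/-- The degree zero entry vanishes, and the four terms of degree one pair up to twice the real part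
of t/2 times the two fundamental modes; the rest is the high part. -/
lemma IsCoeffFamily.wave_eq {k₁ k₂ : ℕ} {c κ T t : ℝ} {a : L1 Idx} {Z : ℂ × ℂ}
    (h : IsCoeffFamily k₁ k₂ c κ T t a) (hZ : ‖Z‖ < 1 / 2) (x : ℝ) :
    wave k₁ k₂ Z a (x : Circ) = t * (Z.1 * Complex.exp (k₁ * x * Complex.I)).re +
      t * (Z.2 * Complex.exp (k₂ * x * Complex.I)).re +
      reC (pair (trigFam k₁ k₂ (highPart (monoFam ((2 : ℝ) • Z)))) a) (x : Circ) := by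
  set N := monoFam ((2 : ℝ) • Z) with hN
  let S : Finset Idx := {((1, 0), (0, 0)), ((0, 1), (0, 0)), ((0, 0), (1, 0)), ((0, 0), (0, 1))}
  have h1 := (hasSum_pair (trigFam k₁ k₂ N) a).sub (hasSum_pair (trigFam k₁ k₂ (highPart N)) a)
  have h2 := hasSum_sum_of_ne_finset_zero (L := .unconditional _) (s := S)
    (f := fun p => a p • trigFam k₁ k₂ N p - a p • trigFam k₁ k₂ (highPart N) p) (fun p hp => by
      rcases lt_or_ge p.deg 2 with hd | hd
      · obtain hd | hd : p.deg = 0 ∨ p.deg = 1 := by omega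
        · rw [(h p).1, uHat_of_deg_eq_zero _ _ _ _ _ hd, zero_mul, zero_smul, zero_smul, sub_zero]
        · exact absurd (by simpa [S] using Idx.eq_of_deg_eq_one hd) hp
      · rw [trigFam_apply, trigFam_apply, highPart_apply, if_pos hd, sub_self])
  have h3 := h1.unique h2
  have e (p : Idx) (hp : p.deg = 1) : a p • trigFam k₁ k₂ N p - a p • trigFam k₁ k₂ (highPart N) p =
      (t / 2 : ℝ) • (mono Z p • (fourier (p.freq k₁ k₂) : C(Circ, ℂ))) := by
    have e1 : trigFam k₁ k₂ N p = mono Z p • (fourier (p.freq k₁ k₂) : C(Circ, ℂ)) :=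
      waveFam_apply hZ p
    have e2 : trigFam k₁ k₂ (highPart N) p = 0 := by
      rw [trigFam_apply, highPart_apply, if_neg (by omega), smul_zero, zero_smul]
    rw [e1, e2, (h p).1, uHat_of_deg_eq_one _ _ _ _ _ hp, hp, smul_zero, sub_zero]
    congr 1
    ring
  have h4 : ∑ p ∈ S, (a p • trigFam k₁ k₂ N p - a p • trigFam k₁ k₂ (highPart N) p) =
      (t / 2 : ℝ) • (Z.1 • (fourier k₁ : C(Circ, ℂ)) + Z.2 • (fourier k₂ : C(Circ, ℂ)) +
        conj Z.1 • (fourier (-k₁) : C(Circ, ℂ)) + conj Z.2 • (fourier (-k₂) : C(Circ, ℂ))) := by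
    rw [Finset.sum_congr rfl fun p hp => e p (by
      simp only [S, Finset.mem_insert, Finset.mem_singleton] at hp
      rcases hp with rfl | rfl | rfl | rfl <;> rfl)]
    rw [← Finset.smul_sum, Finset.sum_insert (by decide), Finset.sum_insert (by decide),
      Finset.sum_insert (by decide), Finset.sum_singleton]
    simp [mono, Idx.freq, add_assoc]
  rw [h4, sub_eq_iff_eq_add] at h3
  have hw : wave k₁ k₂ Z a = reC (pair (trigFam k₁ k₂ N) a) := rfl
  rw [hw, h3, map_add, ContinuousMap.add_apply, add_left_inj, reC_apply]
  simp only [ContinuousMap.smul_apply, ContinuousMap.add_apply, Complex.real_smul,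
    Complex.re_ofReal_mul, smul_eq_mul]
  have e3 (z : ℂ) (k : ℕ) : (conj z * fourier (-(k : ℤ)) (x : Circ)).re =
      (z * Complex.exp (k * x * Complex.I)).re := by
    rw [fourier_neg, ← map_mul, Complex.conj_re, fourier_coe, Int.cast_natCast]
  simp only [Complex.add_re, e3]
  simp only [fourier_coe, Int.cast_natCast]
  ring

/-! ### Existence and completeness of the solutions in terms of complex amplitudes -/

section Family

variable {k₁ k₂ : ℕ} {c₀ κ₀ T₀ t : ℝ}

/-- At Z = 0 only the entry of degree zero remains, and it is zero; the rest is continuity. The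
smallness is needed for the uniqueness argument. -/
lemma eventually_norm_wave_lt {a : ℝ × ℝ × ℝ → L1 Idx} {l₀ : ℝ × ℝ × ℝ}
    (ha : ContinuousAt a l₀) (h0 : a l₀ 0 = 0) {ε : ℝ} (hε : 0 < ε) :
    ∀ᶠ v in 𝓝 (l₀, (0 : ℂ × ℂ)), ‖wave k₁ k₂ v.2 (a v.1)‖ < ε := by
  have hmono : ContinuousAt (fun Z : ℂ × ℂ => monoFam ((2 : ℝ) • Z)) 0 := by
    have h1 : ContinuousAt monoFam ((2 : ℝ) • (0 : ℂ × ℂ)) :=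
      (contDiffAt_monoFam (by simp) (by simp)).continuousAt
    exact ContinuousAt.comp (f := fun Z : ℂ × ℂ => (2 : ℝ) • Z) h1 (by fun_prop)
  have h2 : ContinuousAt (fun v : (ℝ × ℝ × ℝ) × (ℂ × ℂ) => wave k₁ k₂ v.2 (a v.1)) (l₀, 0) := by
    have h3 : ContinuousAt (fun v : (ℝ × ℝ × ℝ) × (ℂ × ℂ) => monoFam ((2 : ℝ) • v.2)) (l₀, 0) :=
      ContinuousAt.comp (g := fun Z : ℂ × ℂ => monoFam ((2 : ℝ) • Z))
        (f := fun v : (ℝ × ℝ × ℝ) × (ℂ × ℂ) => v.2) hmono continuousAt_snd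
    have h4 : ContinuousAt (fun v : (ℝ × ℝ × ℝ) × (ℂ × ℂ) => a v.1) (l₀, 0) :=
      ContinuousAt.comp (g := a) (f := fun v : (ℝ × ℝ × ℝ) × (ℂ × ℂ) => v.1) ha continuousAt_fst
    have h5 : Continuous fun q : (Idx →ᵇ ℂ) × L1 Idx => reC (pair (trigFam k₁ k₂ q.1) q.2) := by
      fun_prop
    exact ContinuousAt.comp (g := fun q : (Idx →ᵇ ℂ) × L1 Idx => reC (pair (trigFam k₁ k₂ q.1) q.2))
      (f := fun v : (ℝ × ℝ × ℝ) × (ℂ × ℂ) => (monoFam ((2 : ℝ) • v.2), a v.1))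
      h5.continuousAt (h3.prodMk h4)
  have h3 : wave k₁ k₂ 0 (a l₀) = 0 := by
    have h4 : pair (waveFam k₁ k₂ 0) (a l₀) = 0 := by
      refine (hasSum_pair _ _).unique ?_
      convert! hasSum_zero using 2 with p
      rw [waveFam_apply (by simp)]
      by_cases hp : p = 0
      · rw [hp, h0, zero_smul]
      · have h5 : p.deg ≠ 0 := by
          intro hd
          refine hp ?_
          obtain ⟨⟨p1, p2⟩, p3, p4⟩ := p
          simp only [Idx.deg] at hd
          ext <;> simp <;> omega
        have h6 := norm_mono_le 0 p
        rw [norm_zero, zero_pow h5] at h6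
        rw [norm_le_zero_iff.1 h6, zero_smul, smul_zero]
    rw [wave, h4, map_zero]
  refine h2.norm.eventually (gt_mem_nhds ?_)
  simpa only [h3, norm_zero] using hε

lemma IsDoubleBifurcationPoint.exists_amplitudes (h : IsDoubleBifurcationPoint k₁ k₂ c₀ κ₀ T₀) :
    ∃ t > 0, ∃ (a : ℝ × ℝ × ℝ → L1 Idx) (B : ℝ), ContDiffAt ℝ ω a (c₀, κ₀, T₀) ∧
      ∀ᶠ l in 𝓝 (c₀, κ₀, T₀), IsCoeffFamily k₁ k₂ l.1 l.2.1 l.2.2 t (a l) ∧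
        (∀ k : ℤ, k.natAbs ≠ k₁ → k.natAbs ≠ k₂ → l.1 - m l.2.2 (l.2.1 * k) ≠ 0) ∧
        ∀ k : ℤ, |ell k₁ k₂ l.1 l.2.1 l.2.2 k| ≤ B := by
  obtain ⟨t, ht, a, ha, ha'⟩ := exists_analytic_uHat h
  obtain ⟨L, hL, hL'⟩ := exists_analytic_ellSeq h
  refine ⟨t, ht, a, ‖L (c₀, κ₀, T₀)‖ + 1, ha, ?_⟩
  filter_upwards [ha', hL', hL.continuousAt.norm.eventually (gt_mem_nhds (lt_add_one _))]
    with l h1 h2 h3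
  refine ⟨h1, fun k => (h2 k).2, fun k => ?_⟩
  rw [← (h2 k).1]
  exact ((L l).norm_coe_le_norm _).trans h3.le

/-- The properties of the solution with amplitudes `Z`. -/
structure IsFamilyMember {χ : LPCutoff} {s : ℝ} (k₁ k₂ : ℕ) (l₀ : ℝ × ℝ × ℝ) (t C : ℝ)
    (Z : ℂ × ℂ) (u : Zygmund χ s) (l : ℝ × ℝ × ℝ) : Prop where
  c_pos : 0 < l.1
  κ_pos : 0 < l.2.1
  T_pos : 0 < l.2.2
  T_lt : l.2.2 < 1 / 3
  isSolution : IsSolution u.toCont l.1 l.2.1 l.2.2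
  coeff_fst : coeff u.toCont k₁ = t / 2 * Z.1
  coeff_snd : coeff u.toCont k₂ = t / 2 * Z.2
  expansion : ∃ w : Zygmund χ s, ‖w‖ ≤ C * ‖Z‖ ^ 2 ∧ ∀ x : ℝ, u.onLine x =
    t * (Z.1 * Complex.exp (k₁ * x * Complex.I)).re +
      t * (Z.2 * Complex.exp (k₂ * x * Complex.I)).re + w.onLine x
  norm_sub_le : ‖l - l₀‖ ≤ C * ‖Z‖ ^ 2
  isAsymmetric_iff : IsAsymmetric u.onLine ↔ (resonance k₁ k₂ Z).im ≠ 0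

/-- The whole theorem before polar coordinates. Complex amplitudes avoid the degeneracy of (r, θ) at
r₁r₂ = 0, and make the solution map injective through its critical Fourier coefficients. -/
lemma exists_solution_family (χ : LPCutoff) {s : ℝ} (hs : 0 < s) (hk : Nat.Coprime k₁ k₂)
    (h : IsNondegenerateSymmetryBreaking k₁ k₂ c₀ κ₀ T₀) :
    ∃ t > 0, ∃ (C : ℝ) (G : ℂ × ℂ → Zygmund χ s × ℝ × ℝ × ℝ), ∃ ρ > 0,
      (∀ Z ∈ Metric.ball 0 ρ, AnalyticAt ℝ G Z ∧
        IsFamilyMember k₁ k₂ (c₀, κ₀, T₀) t C Z (G Z).1 (G Z).2) ∧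
      ∀ᶠ v in 𝓝 ((0 : Zygmund χ s), (c₀, κ₀, T₀)),
        IsSolution v.1.toCont v.2.1 v.2.2.1 v.2.2.2 → IsAsymmetric v.1.onLine →
          v ∈ G '' Metric.ball 0 ρ := by
  have hb := h.toIsDoubleBifurcationPoint
  have h₁ := hb.one_le
  have h₁₂ := hb.lt
  have h₂ : 1 ≤ k₂ := h₁.trans h₁₂.le
  obtain ⟨t, ht, a, B, ha, hev⟩ := hb.exists_amplitudes
  obtain ⟨Λ, hΛ0, hΛ, hred⟩ := exists_reduced_solution hk h ht ha (hev.mono fun l hl => hl.1)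
  obtain ⟨Φ, hΦ⟩ := exists_zyg χ hs k₁ k₂
  obtain ⟨ι, hι⟩ := exists_toContL χ hs
  set l₀ : ℝ × ℝ × ℝ := (c₀, κ₀, T₀) with hl₀
  have hreg : ∀ᶠ v in 𝓝 (l₀, (0 : ℂ × ℂ)), Regular k₁ k₂ t a v.1 v.2 :=
    eventually_regular h₁ h₂ hk (hev.mono fun l hl => ⟨hl.1, hl.2.1⟩)
  -- The parameters depend on the amplitudes through the translation invariants only.
  let l : ℂ × ℂ → ℝ × ℝ × ℝ := fun Z => Λ (invariants k₁ k₂ Z)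
  have hinv0 : invariants k₁ k₂ 0 = 0 := invariants_zero k₁ h₂
  have hl : ContDiffAt ℝ ω l 0 :=
    ContDiffAt.comp (g := Λ) 0 (hinv0 ▸ hΛ) (contDiff_invariants k₁ k₂).contDiffAt
  have hl0 : l 0 = l₀ := by
    change Λ _ = _
    rw [hinv0, hΛ0]
  have hlt : Tendsto l (𝓝 0) (𝓝 l₀) := by
    simpa only [hl0] using hl.continuousAt.tendsto
  let G : ℂ × ℂ → Zygmund χ s × ℝ × ℝ × ℝ := fun Z =>
    (Φ (monoFam ((2 : ℝ) • Z)) (a (l Z)), l Z)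
  have hal : ContDiffAt ℝ ω (fun Z => a (l Z)) 0 :=
    ContDiffAt.comp (g := a) 0 (hl0 ▸ ha) hl
  have hG : ContDiffAt ℝ ω G 0 := by
    have e1 : ContDiffAt ℝ ω (fun Z : ℂ × ℂ => monoFam ((2 : ℝ) • Z)) 0 :=
      ContDiffAt.comp (g := monoFam) (f := fun Z : ℂ × ℂ => (2 : ℝ) • Z) 0
        (contDiffAt_monoFam (by simp) (by simp)) (by fun_prop)
    exact ((Φ.contDiff.contDiffAt.comp 0 e1).clm_apply hal).prodMk hl
  have hwave (Z : ℂ × ℂ) (b : L1 Idx) :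
      (Φ (monoFam ((2 : ℝ) • Z)) b).toCont = wave k₁ k₂ Z b := hΦ _ _
  have hlZ : Tendsto (fun Z => (l Z, Z)) (𝓝 0) (𝓝 (l₀, 0)) := hlt.prodMk_nhds tendsto_id
  have hinvt : Tendsto (invariants k₁ k₂) (𝓝 0) (𝓝 0) :=
    (continuous_invariants k₁ k₂).tendsto' 0 0 hinv0
  have hinvl : Tendsto (fun Z => (invariants k₁ k₂ Z, l Z)) (𝓝 0) (𝓝 (0, l₀)) :=
    hinvt.prodMk_nhds hlt
  -- the bounds for the higher order terms
  obtain ⟨C₁, hC₁0, hC₁⟩ : ∃ C₁ > 0, ∀ᶠ s in 𝓝 (0 : ℝ × ℝ × ℝ), ‖Λ s - l₀‖ ≤ C₁ * ‖s‖ := by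
    obtain ⟨C₁, hC₁, hb⟩ := ((hΛ.differentiableAt (by simp)).isBigO_sub).exists_pos
    refine ⟨C₁, hC₁, ?_⟩
    filter_upwards [hb.bound] with s hs
    simpa [hΛ0] using hs
  have hbig : ∀ᶠ Z in 𝓝 (0 : ℂ × ℂ), ‖a (l Z)‖ < ‖a (l 0)‖ + 1 :=
    hal.continuousAt.norm.eventually (gt_mem_nhds (lt_add_one _))
  set C₂ := ‖Φ‖ * 4 * (‖a (l 0)‖ + 1) with hC₂
  have hC₂0 : 0 ≤ C₂ := by positivity
  have hpos : ∀ᶠ l in 𝓝 l₀, 0 < l.1 ∧ 0 < l.2.1 ∧ 0 < l.2.2 ∧ l.2.2 < 1 / 3 := by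
    obtain ⟨ξ, hξ1, -, hξ⟩ := exists_critical_point hb.T_pos
      (mul_pos hb.κ_pos (by exact_mod_cast h₁ : (0 : ℝ) < k₁))
      (mul_lt_mul_of_pos_left (by exact_mod_cast h₁₂ : (k₁ : ℝ) < k₂) hb.κ_pos)
      (hb.m_eq.1.trans hb.m_eq.2.symm)
    have hξ0 : 0 < ξ := lt_of_le_of_lt (by have := hb.κ_pos; positivity) hξ1
    have hT : T₀ < 1 / 3 := lt_one_third_of_critical hb.T_pos hξ hξ0
    have c1 : Tendsto (fun l : ℝ × ℝ × ℝ => l.1) (𝓝 l₀) (𝓝 c₀) := continuous_fst.tendsto l₀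
    have c2 : Tendsto (fun l : ℝ × ℝ × ℝ => l.2.1) (𝓝 l₀) (𝓝 κ₀) :=
      (continuous_fst.comp continuous_snd).tendsto l₀
    have c3 : Tendsto (fun l : ℝ × ℝ × ℝ => l.2.2) (𝓝 l₀) (𝓝 T₀) :=
      (continuous_snd.comp continuous_snd).tendsto l₀
    exact (c1.eventually (lt_mem_nhds hb.c_pos)).and ((c2.eventually (lt_mem_nhds hb.κ_pos)).and
      ((c3.eventually (lt_mem_nhds hb.T_pos)).and (c3.eventually (gt_mem_nhds hT))))
  have hgood : ∀ᶠ Z in 𝓝 (0 : ℂ × ℂ), AnalyticAt ℝ G Z ∧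
      IsFamilyMember k₁ k₂ l₀ t (max C₁ C₂) Z (G Z).1 (G Z).2 := by
    filter_upwards [hG.eventually (by simp), hlt.eventually hpos, hlZ.eventually hreg,
      hlZ.eventually (eventually_redCoeff_mul_exc ht h₁ h₁₂ ha hreg), hinvl.eventually hred,
      hinvt.eventually hC₁, hbig] with Z g1 g2 g3 g4 g5 g6 g7
    have hZ := g3.norm_lt
    -- By construction the three real reduced equations hold at (invariants of Z, l(Z)); the fourth
    -- term drops out by `g4 f3`.
    obtain ⟨f1, f2, f3⟩ := Prod.mk_eq_zero.1 (g5.2 rfl) |>.imp_right Prod.mk_eq_zero.1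
    simp only at f1 f2 f3
    obtain ⟨e1, e2⟩ := g3.coeffFamily.coeff_wave hZ h₁ h₁₂
    have hu : (G Z).1.toCont = wave k₁ k₂ Z (a (l Z)) := hwave Z _
    refine ⟨g1.analyticAt, g2.1, g2.2.1, g2.2.2.1, g2.2.2.2, ?_, ?_, ?_, ?_, ?_, ?_⟩
    · rw [hu]
      refine g3.isSolution ?_ ?_
      · rw [g3.J_fst h₁ h₁₂, f1, f3]
        simp
      · rw [g3.J_snd h₁ h₁₂, f2, g4 f3]
        simp
    · rw [hu, e1]
    · rw [hu, e2]
    · refine ⟨Φ (highPart (monoFam ((2 : ℝ) • Z))) (a (l Z)), ?_, fun x => ?_⟩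
      · refine (Φ.le_opNorm₂ _ _).trans ?_
        calc ‖Φ‖ * ‖highPart (monoFam ((2 : ℝ) • Z))‖ * ‖a (l Z)‖
            ≤ ‖Φ‖ * (4 * ‖Z‖ ^ 2) * (‖a (l 0)‖ + 1) := by
              have := norm_highPart_monoFam_le hZ
              gcongr
          _ = C₂ * ‖Z‖ ^ 2 := by rw [hC₂]; ring
          _ ≤ _ := by
              gcongr
              exact le_max_right _ _
      · rw [Zygmund.onLine, Zygmund.onLine, hu, g3.coeffFamily.wave_eq hZ, hΦ]
    · refine g6.trans ?_
      have := norm_invariants_le h₁ h₂ (hZ.le.trans (by norm_num) : ‖Z‖ ≤ 1)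
      have := le_max_left C₁ C₂
      gcongr
    · have := g3.coeffFamily.isAsymmetric_iff hZ ht h₁ h₁₂ hk
      rw [← this, ← hu]
      rfl
  obtain ⟨ρ, hρ, hball⟩ := Metric.eventually_nhds_iff_ball.1 hgood
  refine ⟨t, ht, max C₁ C₂, G, ρ, hρ, hball, ?_⟩
  -- completeness
  let z : Zygmund χ s → ℂ × ℂ := fun u => ((2 / t : ℝ) * coeff u.toCont k₁,
    (2 / t : ℝ) * coeff u.toCont k₂)
  have hcoeff (k : ℤ) : Continuous fun u : Zygmund χ s => coeff u.toCont k := by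
    have : Continuous fun u : Zygmund χ s => coeffC k (toC (ι u)) := by fun_prop
    simp only [hι] at this
    exact this
  have hz : Continuous z :=
    (continuous_const.mul (hcoeff k₁)).prodMk (continuous_const.mul (hcoeff k₂))
  have hz0 : z 0 = 0 := by
    have e (k : ℤ) : coeff (0 : Zygmund χ s).toCont k = 0 := by
      rw [coeff_eq, ← hι, map_zero, map_zero, map_zero]
    simp only [z, e, mul_zero]
    rfl
  have hv1 : Tendsto (fun v : Zygmund χ s × ℝ × ℝ × ℝ => (v.2, z v.1)) (𝓝 (0, l₀))
      (𝓝 (l₀, 0)) :=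
    (continuous_snd.prodMk (hz.comp continuous_fst)).tendsto' _ _ (by simp [hz0])
  have hv2 : Tendsto (fun v : Zygmund χ s × ℝ × ℝ × ℝ => (invariants k₁ k₂ (z v.1), v.2))
      (𝓝 (0, l₀)) (𝓝 (0, l₀)) :=
    (((continuous_invariants k₁ k₂).comp (hz.comp continuous_fst)).prodMk
      continuous_snd).tendsto' _ _ (by simp [hz0, hinv0])
  have hv3 : Tendsto (fun v : Zygmund χ s × ℝ × ℝ × ℝ => z v.1) (𝓝 (0, l₀)) (𝓝 0) :=
    (hz.comp continuous_fst).tendsto' _ _ hz0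
  have hv4 : Tendsto (fun v : Zygmund χ s × ℝ × ℝ × ℝ => v.2) (𝓝 (0, l₀)) (𝓝 l₀) :=
    continuous_snd.tendsto _
  have hv5 : Tendsto (fun v : Zygmund χ s × ℝ × ℝ × ℝ => ‖v.1.toCont‖) (𝓝 (0, l₀)) (𝓝 0) := by
    have : Continuous fun v : Zygmund χ s × ℝ × ℝ × ℝ => ‖ι v.1‖ := by fun_prop
    simpa only [hι] using this.tendsto' (0, l₀) 0 (by simp)
  -- Chosen so that two functions of norm below ε satisfy B‖u + v‖ < 1, the smallness required for
  -- uniqueness.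
  set ε : ℝ := 1 / (2 * (|B| + 1)) with hε
  have hε0 : 0 < ε := by positivity
  have ha0 : a l₀ 0 = 0 := by
    rw [(hev.self_of_nhds.1 0).1, uHat_of_deg_eq_zero _ _ _ _ _ rfl, zero_mul]
  filter_upwards [hv1.eventually hreg, hv2.eventually hred, hv4.eventually hev,
    hv3.eventually (Metric.ball_mem_nhds 0 hρ), hv5.eventually (gt_mem_nhds hε0),
    hv1.eventually (eventually_norm_wave_lt (k₁ := k₁) (k₂ := k₂) ha.continuousAt ha0 hε0)]
    with ⟨u, l'⟩ g1 g2 g3 g4 g5 g6 hsol hasym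
  simp only at g1 g2 g3 g4 g5 g6 hsol hasym
  have ht' : (t : ℂ) ≠ 0 := by exact_mod_cast ht.ne'
  obtain ⟨e1, e2⟩ := g1.coeffFamily.coeff_wave g1.norm_lt h₁ h₁₂
  -- The solution and the wave with the same amplitudes, both at the parameters of the given
  -- solution, solve the noncritical equations and share the critical coefficients.
  have hu : u.toCont = wave k₁ k₂ (z u) (a l') := by
    refine eq_of_coeff_eq_of_J_eq_zero (B := B) (fun k _ _ => hsol k)
      (fun k hk1 hk2 => g1.coeffFamily.J_eq_zero g1.norm_lt hk1 hk2 (g1.ne_zero k hk1 hk2))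
      g1.ne_zero g3.2.2 ?_ ?_ ?_
    · rw [e1]
      simp only [z]
      push_cast
      field_simp
    · rw [e2]
      simp only [z]
      push_cast
      field_simp
    · have h3 := norm_add_le u.toCont (wave k₁ k₂ (z u) (a l'))
      have h4 : ‖u.toCont + wave k₁ k₂ (z u) (a l')‖ < 2 * ε := by linarith
      have h5 : 2 * ε * (|B| + 1) = 1 := by
        rw [hε]
        field_simp
      have h6 := norm_nonneg (u.toCont + wave k₁ k₂ (z u) (a l'))
      have h7 := le_abs_self B
      have h8 := abs_nonneg B
      nlinarith
  -- Asymmetry enters only here: it makes all three reduced equations necessary, so the uniqueness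
  -- of the implicit function determines the parameters.
  have hI : (resonance k₁ k₂ (z u)).im ≠ 0 := by
    rw [← g1.coeffFamily.isAsymmetric_iff g1.norm_lt ht h₁ h₁₂ hk, ← hu]
    exact hasym
  obtain ⟨f1, f2, f3⟩ := g1.eq_zero_of_isSolution h₁ h₁₂ (hu ▸ hsol) hI
  have hlam : l (z u) = l' := g2.1 (by simp only [redEq, f1, f2, f3]; rfl)
  refine ⟨z u, g4, Prod.ext (Zygmund.toCont_injective ?_) hlam⟩
  change (Φ (monoFam ((2 : ℝ) • z u)) (a (l (z u)))).toCont = u.toCont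
  rw [hwave, hlam, hu]

end Family

end

/-! ### Polar coordinates on the ball of amplitudes -/

section

open Filter Topology BoundedContinuousFunction
open scoped ComplexConjugate

section Param

variable {k₁ k₂ : ℕ} {t : ℝ}

lemma norm_inv_smul_polar (ht : 0 < t) (p : (ℝ × ℝ) × (ℝ × ℝ)) :
    ‖t⁻¹ • polar k₁ k₂ p‖ = t⁻¹ * max |p.1.1| |p.1.2| := by
  obtain ⟨h1, h2⟩ := norm_polar k₁ k₂ p
  rw [norm_smul, Prod.norm_def, h1, h2, Real.norm_of_nonneg (by positivity)]

lemma norm_inv_smul_polar_sq_le (ht : 0 < t) (p : (ℝ × ℝ) × (ℝ × ℝ)) :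
    ‖t⁻¹ • polar k₁ k₂ p‖ ^ 2 ≤ (t⁻¹) ^ 2 * (p.1.1 ^ 2 + p.1.2 ^ 2) := by
  rw [norm_inv_smul_polar ht, mul_pow]
  gcongr
  rcases max_choice |p.1.1| |p.1.2| with h | h <;> rw [h, sq_abs]
  · linarith [sq_nonneg p.1.2]
  · linarith [sq_nonneg p.1.1]

lemma inv_smul_polar_mem_ball (ht : 0 < t) {ρ : ℝ} {p : (ℝ × ℝ) × (ℝ × ℝ)}
    (hp : p ∈ paramDomain (t * ρ)) : t⁻¹ • polar k₁ k₂ p ∈ Metric.ball (0 : ℂ × ℂ) ρ := by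
  obtain ⟨⟨⟨h1, h2⟩, h3, h4⟩, -⟩ := hp
  rw [mem_ball_zero_iff, norm_inv_smul_polar ht, abs_of_nonneg h1, abs_of_nonneg h3,
    inv_mul_lt_iff₀ ht]
  exact max_lt h2 h4

/-- The norm on ℂ × ℂ is the maximum norm, so the ball of radius ρ is exactly the product of discs
covered by r ∈ [0, tρ)² after scaling by t⁻¹. -/
lemma image_inv_smul_polar (ht : 0 < t) (h₁ : 1 ≤ k₁) (h₂ : 1 ≤ k₂) (ρ : ℝ) :
    (fun p => t⁻¹ • polar k₁ k₂ p) '' paramDomain (t * ρ) = Metric.ball 0 ρ := by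
  refine Subset.antisymm ?_ fun Z hZ => ?_
  · rintro _ ⟨p, hp, rfl⟩
    exact inv_smul_polar_mem_ball ht hp
  · obtain ⟨p, hp1, hp2, hp⟩ := exists_polar_eq h₁ h₂ (t • Z)
    have hZp : t⁻¹ • polar k₁ k₂ p = Z := by rw [hp, inv_smul_smul₀ ht.ne']
    refine ⟨p, ⟨⟨⟨hp1, ?_⟩, hp2, ?_⟩, mem_univ _⟩, hZp⟩ <;>
    · rw [← hZp, mem_ball_zero_iff, norm_inv_smul_polar ht, abs_of_nonneg hp1, abs_of_nonneg hp2,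
        inv_mul_lt_iff₀ ht] at hZ
      first
      | exact (le_max_left _ _).trans_lt hZ
      | exact (le_max_right _ _).trans_lt hZ

lemma mul_re_polar (ht : 0 < t) (k : ℕ) (r θ x : ℝ) :
    t * (t⁻¹ • ((r : ℂ) * Complex.exp (k * θ * Complex.I)) * Complex.exp (k * x * Complex.I)).re =
      r * Real.cos (k * (x + θ)) := by
  have e : t⁻¹ • ((r : ℂ) * Complex.exp (k * θ * Complex.I)) * Complex.exp (k * x * Complex.I) =
      ((t⁻¹ * r : ℝ) : ℂ) * Complex.exp (((k * (x + θ) : ℝ) : ℂ) * Complex.I) := by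
    rw [smul_mul_assoc, mul_assoc, ← Complex.exp_add, Complex.real_smul]
    push_cast
    rw [← mul_assoc]
    congr 2
    ring
  rw [e, Complex.re_ofReal_mul, Complex.exp_ofReal_mul_I_re]
  field_simp

end Param

end

end Whitham

end

/-! ### The theorem in polar coordinates -/

open Whitham

theorem mainTheorem1 (χ : LPCutoff) (s : ℝ) (hs : 0 < s) (k₁ k₂ : ℕ) (hk : Nat.Coprime k₁ k₂)
    (c₀ κ₀ T₀ : ℝ) (h : IsNondegenerateSymmetryBreaking k₁ k₂ c₀ κ₀ T₀) :
    ∃ ε > 0, ∃ F : (ℝ × ℝ) × (ℝ × ℝ) → Zygmund χ s × ℝ × ℝ × ℝ,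
      -- the four maps are analytic, up to the boundary of the parameter domain
      TorusPeriodic k₁ k₂ F ∧
      AnalyticOnNhd ℝ F (paramDomain ε) ∧
      -- their values are solutions
      (∀ p ∈ paramDomain ε, ∀ u c κ T, F p = (u, c, κ, T) →
        0 < c ∧ 0 < κ ∧ 0 < T ∧ T < 1 / 3 ∧ IsSolution u.toCont c κ T) ∧
      -- the set of these solutions is a four-dimensional manifold
      Nonempty (ChartedSpace (EuclideanSpace ℝ (Fin 4)) (F '' paramDomain ε)) ∧
      -- the leading orders
      (∃ C : ℝ, ∀ r₁ r₂ θ₁ θ₂ : ℝ, ((r₁, r₂), (θ₁, θ₂)) ∈ paramDomain ε →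
        ∀ u c κ T, F ((r₁, r₂), (θ₁, θ₂)) = (u, c, κ, T) →
        (∃ w : Zygmund χ s, ‖w‖ ≤ C * (r₁ ^ 2 + r₂ ^ 2) ∧
          ∀ x : ℝ, u.onLine x =
            r₁ * Real.cos (k₁ * (x + θ₁)) + r₂ * Real.cos (k₂ * (x + θ₂)) + w.onLine x) ∧
        |c - c₀| ≤ C * (r₁ ^ 2 + r₂ ^ 2) ∧
        |κ - κ₀| ≤ C * (r₁ ^ 2 + r₂ ^ 2) ∧
        |T - T₀| ≤ C * (r₁ ^ 2 + r₂ ^ 2)) ∧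
      -- the asymmetric members
      (∀ r₁ r₂ θ₁ θ₂ : ℝ, ((r₁, r₂), (θ₁, θ₂)) ∈ paramDomain ε →
        (IsAsymmetric (F ((r₁, r₂), (θ₁, θ₂))).1.onLine ↔
          r₁ * r₂ ≠ 0 ∧ ¬ ∃ n : ℤ, θ₁ - θ₂ = n * (Real.pi / (k₁ * k₂)))) ∧
      -- all asymmetric solutions close to the bifurcation point are in the manifold
      (∃ δ > 0, ∀ (u : Zygmund χ s) (c κ T : ℝ),
        ‖u‖ < δ → |c - c₀| < δ → |κ - κ₀| < δ → |T - T₀| < δ →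
        IsSolution u.toCont c κ T → IsAsymmetric u.onLine →
        (u, c, κ, T) ∈ F '' paramDomain ε) := by
  obtain ⟨t, ht, C, G, ρ, hρ, hG, hcompl⟩ := exists_solution_family χ hs hk h
  have h₁ : 1 ≤ k₁ := h.one_le
  have h₂ : 1 ≤ k₂ := h₁.trans h.lt.le
  -- Scaling by t⁻¹ cancels the factor t in the leading terms, leaving r₁ and r₂ themselves. Since
  -- `polar` is analytic for all real r and the ball is open, the map is analytic across r₁ = 0 and
  -- r₂ = 0.
  let F : (ℝ × ℝ) × (ℝ × ℝ) → Zygmund χ s × ℝ × ℝ × ℝ := fun p => G (t⁻¹ • polar k₁ k₂ p)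
  have himage : F '' paramDomain (t * ρ) = G '' Metric.ball 0 ρ := by
    rw [← image_inv_smul_polar ht h₁ h₂, image_image]
  have hmem {p : (ℝ × ℝ) × (ℝ × ℝ)} (hp : p ∈ paramDomain (t * ρ)) :=
    hG _ (inv_smul_polar_mem_ball (k₁ := k₁) (k₂ := k₂) ht hp)
  have hsq {D : ℝ} {p : (ℝ × ℝ) × (ℝ × ℝ)} (hD : D ≤ C * ‖t⁻¹ • polar k₁ k₂ p‖ ^ 2) :
      D ≤ |C| * t⁻¹ ^ 2 * (p.1.1 ^ 2 + p.1.2 ^ 2) := by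
    rw [mul_assoc]
    exact hD.trans (mul_le_mul (le_abs_self C) (norm_inv_smul_polar_sq_le ht p) (by positivity)
      (abs_nonneg C))
  refine ⟨t * ρ, by positivity, F, fun r θ => ?_, fun p hp => ?_, fun p hp u c κ T hF => ?_, ?_,
    ⟨|C| * t⁻¹ ^ 2, fun r₁ r₂ θ₁ θ₂ hp u c κ T hF => ?_⟩, fun r₁ r₂ θ₁ θ₂ hp => ?_, ?_⟩
  · obtain ⟨e1, e2⟩ := polar_periodic h₁ h₂ r θ
    exact ⟨congrArg (fun z => G (t⁻¹ • z)) e1, congrArg (fun z => G (t⁻¹ • z)) e2⟩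
  · have e : AnalyticAt ℝ (fun p => t⁻¹ • polar k₁ k₂ p) p :=
      analyticAt_const.fun_smul (contDiff_polar k₁ k₂).contDiffAt.analyticAt
    exact AnalyticAt.comp (g := G) (hmem hp).1 e
  · have hm := (hmem hp).2
    change G (t⁻¹ • polar k₁ k₂ p) = _ at hF
    rw [hF] at hm
    exact ⟨hm.c_pos, hm.κ_pos, hm.T_pos, hm.T_lt, hm.isSolution⟩
  · rw [himage]
    obtain ⟨ι, hι⟩ := exists_toContL χ hs
    have ht' : (t : ℂ) ≠ 0 := by exact_mod_cast ht.ne'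
    -- The continuous left inverse recovers the amplitudes as 2/t times the critical Fourier
    -- coefficients.
    refine nonempty_chartedSpace_image (f := fun v => ((2 / t : ℝ) * coeffC k₁ (toC (ι v.1)),
      (2 / t : ℝ) * coeffC k₂ (toC (ι v.1)))) Metric.isOpen_ball ⟨0, Metric.mem_ball_self hρ⟩
      (fun Z hZ => (hG Z hZ).1.continuousAt.continuousWithinAt) (by fun_prop) fun Z hZ => ?_
    have hm := (hG Z hZ).2
    rw [hι, ← coeff_eq, ← coeff_eq, hm.coeff_fst, hm.coeff_snd]
    push_cast
    ext <;> simp only <;> field_simp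
  · have hm := (hmem hp).2
    change G (t⁻¹ • polar k₁ k₂ _) = _ at hF
    rw [hF] at hm
    obtain ⟨w, hw1, hw2⟩ := hm.expansion
    have hl := hsq hm.norm_sub_le
    refine ⟨⟨w, hsq hw1, fun x => ?_⟩, (le_trans ?_ hl), (le_trans ?_ hl), (le_trans ?_ hl)⟩
    · rw [hw2, ← mul_re_polar ht k₁ r₁ θ₁ x, ← mul_re_polar ht k₂ r₂ θ₂ x]
      rfl
    · exact norm_fst_le ((c, κ, T) - (c₀, κ₀, T₀))
    · exact (norm_fst_le ((κ, T) - (κ₀, T₀))).trans (norm_snd_le ((c, κ, T) - (c₀, κ₀, T₀)))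
    · exact (norm_snd_le ((κ, T) - (κ₀, T₀))).trans (norm_snd_le ((c, κ, T) - (c₀, κ₀, T₀)))
  · rw [← im_resonance_polar_ne_zero_iff h₁ h₂]
    refine (hmem hp).2.isAsymmetric_iff.trans ?_
    -- Scaling the amplitudes by t⁻¹ multiplies the resonant product by a positive number.
    rw [resonance_smul, Complex.im_ofReal_mul, mul_ne_zero_iff]
    exact and_iff_right (by positivity)
  · obtain ⟨δ, hδ, hball⟩ := Metric.eventually_nhds_iff_ball.1 hcompl
    refine ⟨δ, hδ, fun u c κ T hu hc hκ hT hsol hasym => ?_⟩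
    rw [himage]
    refine hball (u, c, κ, T) ?_ hsol hasym
    rw [mem_ball_iff_norm]
    refine max_lt ?_ (max_lt hc (max_lt hκ hT))
    change ‖u - 0‖ < δ
    rwa [sub_zero]
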